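/- Let $\mathbb S^3\subset\mathbb R^4$ be the unit sphere, with points $p=(x_1,y_1,x_2,y_2)=(z_1,z_2)\in\mathbb C^2$, $z_k=x_k+iy_k$, and with the metric $g$ induced from $\mathbb R^4$. Let $T(p)=(-y_1,x_1,-y_2,x_2)$ be the vertical Hopf vector field; a vector $X\in T_p\mathbb S^3$ has horizontal projection $X_h=X-\langle X,T(p)\rangle T(p)$. For a $C^1$ surface $\Sigma\subset\mathbb S^3$ with unit normal $N$ in $(\mathbb S^3,g)$, the sub-Riemannian area is $A(\Sigma)=\int_\Sigma|N_h|\,da$, where $da$ is the Riemannian area element. Put $C_0=\{0\}\times\mathbb S^1=\{p\in\mathbb S^3: z_1=0\}$, $\mathcal S_0^+=\{p\in\mathbb S^3: y_1=0,\ x_1\ge 0\}$, and $\mathcal S_0^+(t)=\varphi_t(\mathcal S_0^+)$, where $\varphi_t(z_1,z_2)=(e^{it}z_1,e^{it}z_2)$. Let $\Sigma\subset\mathbb S^3$ be a compact, connected, orientable embedded surface, of class $C^2$ up to its boundary, with $\partial\Sigma=C_0$. Suppose that from every point of $C_0$ there leaves a nontrivial geodesic segment of $(\mathbb S^3,g)$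 that is contained in $\Sigma$ and is orthogonal to $C_0$ at that point; that is, for every $p\in C_0$ there are a unit vector $U\in T_p\mathbb S^3$ with $\langle U,T(p)\rangle=0$ and a number $\delta>0$ such that $\cos(s)\,p+\sin(s)\,U\in\Sigma$ for all $s\in[0,\delta)$. If $\Sigma\ne\mathcal S_0^+(t)$ for every $t\in[0,2\pi)$, then $$A(\Sigma)>A(\mathcal S_0^+)=\frac{\pi^2}{2}.$$ -/

import Mathlib

open Set MeasureTheory
open scoped ENNReal InnerProductSpace

noncomputable section

namespace SubRiemannianSphere

/-- The ambient space `ℝ⁴` with coordinates `(x₁, y₁, x₂, y₂) = (p 0, p 1, p 2, p 3)`. -/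
abbrev E4 : Type := EuclideanSpace ℝ (Fin 4)

/-- The parameter plane for local parametrizations. -/
abbrev E2 : Type := EuclideanSpace ℝ (Fin 2)

/-- The unit sphere `𝕊³` of `ℝ⁴`. -/
def sphere3 : Set E4 := Metric.sphere 0 1

/-- The vertical Hopf vector field `T(p) = i · p`. -/
def hopf (p : E4) : E4 := !₂[-p 1, p 0, -p 3, p 2]

/-- The horizontal projection `X_h = X - ⟨X, T(p)⟩ T(p)` of a vector `X` at a point `p` of the
sphere. -/
def horizontalPart (p X : E4) : E4 := X - ⟪X, hopf p⟫_ℝ • hopf p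

/-- The vertical translation `φ_t(p) = exp(it) · p`. -/
def vertTrans (t : ℝ) (p : E4) : E4 :=
  !₂[Real.cos t * p 0 - Real.sin t * p 1, Real.sin t * p 0 + Real.cos t * p 1,
    Real.cos t * p 2 - Real.sin t * p 3, Real.sin t * p 2 + Real.cos t * p 3]

/-- The vertical great circle `C₀ = {0} × 𝕊¹`. -/
def circleC0 : Set E4 := {p | p ∈ sphere3 ∧ p 0 = 0 ∧ p 1 = 0}

/-- The closed half-sphere `𝒮₀⁺ = 𝕊³ ∩ {y₁ = 0, x₁ ≥ 0}`. -/
def halfSphere : Set E4 := {p | p ∈ sphere3 ∧ p 1 = 0 ∧ 0 ≤ p 0}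

/-- The vertical translate `𝒮₀⁺(t) = φ_t(𝒮₀⁺)`. -/
def halfSphereTrans (t : ℝ) : Set E4 := vertTrans t '' halfSphere

/-- Near `p`, the set `S` is parametrized by a neighbourhood of `0` in the model domain `H`
(the plane or a closed half-plane): `φ` is a `C²` immersion of an open set `U ∋ 0` with `φ 0 = p`,
and it restricts to a homeomorphism, with inverse `ψ`, of `U ∩ H` onto the open subset `S ∩ W`
of `S`. -/
def HasC2Patch (H : Set E2) (S : Set E4) (p : E4) : Prop :=
  ∃ (U : Set E2) (W : Set E4) (φ : E2 → E4) (ψ : E4 → E2),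
    IsOpen U ∧ IsOpen W ∧ (0 : E2) ∈ U ∧ p ∈ W ∧ φ 0 = p ∧
    ContDiffOn ℝ 2 φ U ∧ (∀ x ∈ U, Function.Injective (fderiv ℝ φ x)) ∧
    φ '' (U ∩ H) = S ∩ W ∧ ContinuousOn ψ (S ∩ W) ∧ ∀ x ∈ U ∩ H, ψ (φ x) = x

/-- `p` is an interior point of the surface `S`. -/
def IsInteriorPoint (S : Set E4) (p : E4) : Prop := HasC2Patch univ S p

/-- `p` is a boundary point of the surface `S`. -/
def IsBoundaryPoint (S : Set E4) (p : E4) : Prop := HasC2Patch {x | 0 ≤ x 0} S p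

/-- `S` is an embedded surface in `𝕊³`, of class `C²` up to its (possibly empty) boundary. -/
def IsC2Surface (S : Set E4) : Prop :=
  S ⊆ sphere3 ∧ ∀ p ∈ S, IsInteriorPoint S p ∨ IsBoundaryPoint S p

/-- The boundary `∂S` of a surface. -/
def surfaceBoundary (S : Set E4) : Set E4 := {p | p ∈ S ∧ IsBoundaryPoint S p}

/-- The tangent plane `T_p S`, a full plane also at boundary points. -/
def tangentPlane (S : Set E4) (p : E4) : Submodule ℝ E4 :=
  Submodule.span ℝ (tangentConeAt ℝ S p)

/-- The unit vectors tangent to `𝕊³` at `p` and normal to `S`: a pair `{N, -N}` when `S` is a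
surface and `p ∈ S`. -/
def unitNormals (S : Set E4) (p : E4) : Set E4 :=
  {N | ‖N‖ = 1 ∧ ⟪N, p⟫_ℝ = 0 ∧ ∀ v ∈ tangentPlane S p, ⟪N, v⟫_ℝ = 0}

/-- Orientability of a surface in `𝕊³`: there is a continuous unit normal vector field. -/
def IsOrientableSurface (S : Set E4) : Prop :=
  ∃ N : E4 → E4, ContinuousOn N S ∧ ∀ p ∈ S, N p ∈ unitNormals S p

/-- The function `|N_h|` of a surface. The supremum runs over the two choices `N, -N` of the unit
normal at `p`, which give the same value. -/
def normNh (S : Set E4) (p : E4) : ℝ≥0∞ := ⨆ N ∈ unitNormals S p, ‖horizontalPart p N‖ₑ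

/-- The sub-Riemannian area `A(S) = ∫_S |N_h| da`, where the Riemannian area element `da` is the
two-dimensional Hausdorff measure, normalized to be Lebesgue measure on Euclidean planes. -/
def area (S : Set E4) : ℝ≥0∞ := ∫⁻ p in S, normNh S p ∂(μHE[2] : Measure E4)

/-- At every point `p` of `C₀` some nontrivial geodesic segment of `𝕊³` (arc of a great circle)
with unit initial velocity `U` orthogonal to `C₀` (that is, to `T(p)`) leaves from `p` inside
`S`. -/
def ContainsOrthogonalSegments (S : Set E4) : Prop :=
  ∀ p ∈ circleC0, ∃ U : E4, ‖U‖ = 1 ∧ ⟪U, p⟫_ℝ = 0 ∧ ⟪U, hopf p⟫_ℝ = 0 ∧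
    ∃ δ > 0, ∀ s ∈ Ico (0 : ℝ) δ, Real.cos s • p + Real.sin s • U ∈ S

end SubRiemannianSphere

end

/-!
The proof is a calibration. Let `Y = i (|z₂|² z₁, -|z₁|² z₂)`, a horizontal field with
`|Y| = |z₁| |z₂|` on the sphere. For every surface with unit normal `N`, pointwise
`⟨N, Y⟩ / |Y| ≤ |N_h|` (`inner_calibField_le`). The unit field `Y / |Y|` is divergence free, and
every surface spanning `C₀` as in the theorem has the same flux of `Y / |Y|`, namely `π² / 2`
(`exists_normal_flux`). This gives `A(Σ) ≥ π² / 2`.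

The flux is computed by Stokes' theorem. `Y / |Y|` is singular on the great circles `z₁ = 0` and
`z₂ = 0`, so it is replaced by `P(|z₁|² |z₂|²) Y` with polynomials `P` approximating
`x ↦ 1 / √x` on `[0, 1]`. These fields are dual to exterior derivatives of polynomial 1-forms
(`exists_calibForm`), hence their flux is a circulation along `C₀`, up to a sign common to the whole
circle (`exists_stokes`); the passage to the limit is by dominated convergence. That the sign does not
vary along `C₀` is read off from the inward conormal, which the geodesic segments exhibit
(`exists_boundary_orientation`). Stokes' theorem on the surface is obtained from Green's formula on a half-plane
by a partition of unity, and integrals over `Σ` are transferred to parameter domains by the area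
formula for the Hausdorff measure (`lintegral_image_eq_lintegral_normDet_mul`).

If `A(Σ) ≤ π² / 2`, equality holds in the pointwise inequality, that is, `N_h` is a nonnegative
multiple of `Y` (`exists_calibrated_normal`). Then the radial field `(|z₂|² z₁, -|z₁|² z₂)` is
tangent to `Σ`, and `Σ` is a union of arcs of great circles from `C₀` to the circle
`C₁ = {z₂ = 0}` (`meridian_mem`). The normal at a point of `C₀` determines the arc that leaves from
there (`normal_eq_rotate`), so its end point in `Σ ∩ C₁` depends continuously on the initial point.
At the points of `Σ ∩ C₁` the normal is vertical, which makes this set discrete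
(`isDiscrete_inter_circleC1`). So all arcs end at the same point `(e^{it}, 0)`, and `Σ` is
`𝒮₀⁺(t)` (`exists_eq_halfSphereTrans`).
-/

open Set MeasureTheory
open scoped ENNReal InnerProductSpace

noncomputable section

namespace SubRiemannianSphere

open Filter Topology Module
open scoped NNReal

/-! ### The area formula for immersions -/

/-- A comparison of distances in two images of the same set gives a comparison of their measures:
the one image is a Lipschitz image of the other. -/
theorem euclideanHausdorffMeasure_image_le_of_edist_le {X Y Z : Type*} [EMetricSpace Y]
    [MeasurableSpace Y] [BorelSpace Y] [EMetricSpace Z] [MeasurableSpace Z] [BorelSpace Z]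
    {f : X → Y} {g : X → Z} {s : Set X} {K : ℝ≥0} (d : ℕ)
    (h : ∀ x ∈ s, ∀ y ∈ s, edist (f x) (f y) ≤ K * edist (g x) (g y)) :
    (μHE[d] : Measure Y) (f '' s) ≤ (K : ℝ≥0∞) ^ d * (μHE[d] : Measure Z) (g '' s) := by
  rcases s.eq_empty_or_nonempty with rfl | hs
  · simp
  obtain ⟨x0, -⟩ := hs
  have : Nonempty X := ⟨x0⟩
  set k : Z → Y := fun z => f (Function.invFunOn g s z) with hk
  have hinv : ∀ x ∈ s, Function.invFunOn g s (g x) ∈ s ∧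
      g (Function.invFunOn g s (g x)) = g x := fun x hx =>
    Function.invFunOn_pos (f := g) ⟨x, hx, rfl⟩
  have hL : LipschitzOnWith K k (g '' s) := by
    rintro _ ⟨x, hx, rfl⟩ _ ⟨y, hy, rfl⟩
    have := h _ (hinv x hx).1 _ (hinv y hy).1
    rwa [(hinv x hx).2, (hinv y hy).2] at this
  have him : k '' (g '' s) = f '' s := by
    rw [image_image]
    refine image_congr fun x hx => ?_
    have := h _ (hinv x hx).1 _ hx
    rw [(hinv x hx).2, edist_self, mul_zero] at this
    exact edist_le_zero.1 this
  have := hL.hausdorffMeasure_image_le (d := d) (Nat.cast_nonneg d)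
  rw [him, ENNReal.rpow_natCast] at this
  simp only [Measure.euclideanHausdorffMeasure_def, Measure.smul_apply, ENNReal.smul_def,
    smul_eq_mul]
  rw [mul_left_comm]
  gcongr

theorem continuous_normDet {U V : Type*} [NormedAddCommGroup U] [InnerProductSpace ℝ U]
    [FiniteDimensional ℝ U] [NormedAddCommGroup V] [InnerProductSpace ℝ V] [CompleteSpace V] :
    Continuous fun A : U →L[ℝ] V => A.toLinearMap.normDet := by
  have : (fun A : U →L[ℝ] V => A.toLinearMap.normDet) =
      fun A : U →L[ℝ] V => √((A.adjoint ∘L A).det) := by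
    funext A
    have := A.normDet_sq
    simp only [RCLike.ofReal_real_eq_id, id_eq] at this
    rw [← this, Real.sqrt_sq (LinearMap.normDet_nonneg _)]
  rw [this]
  refine Real.continuous_sqrt.comp (ContinuousLinearMap.continuous_det.comp ?_)
  exact (ContinuousLinearMap.adjoint.continuous.clm_comp continuous_id)

section AreaFormula

variable {U V : Type*} [NormedAddCommGroup U] [InnerProductSpace ℝ U] [FiniteDimensional ℝ U]
  [MeasurableSpace U] [BorelSpace U] [NormedAddCommGroup V] [InnerProductSpace ℝ V]
  [MeasurableSpace V] [BorelSpace V]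

/-- A map that is well approximated by an injective linear map `A` distorts the Hausdorff measure
nearly as `A` does. -/
theorem exists_approximatesLinearOn_measure_image (A : U →L[ℝ] V) (hA : Function.Injective A)
    {c : ℝ≥0} (hc : 1 < c) : ∃ δ : ℝ≥0, 0 < δ ∧ ∀ (t : Set U) (g : U → V),
      ApproximatesLinearOn g A t δ →
        (μHE[finrank ℝ U] : Measure V) (g '' t) ≤ c * (μHE[finrank ℝ U] : Measure V) (A '' t) ∧
        (μHE[finrank ℝ U] : Measure V) (A '' t) ≤ c * (μHE[finrank ℝ U] : Measure V) (g '' t) := by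
  obtain ⟨k, hk1, hkc⟩ : ∃ k : ℝ≥0, 1 < k ∧ k ^ finrank ℝ U ≤ c := by
    have hcont : Tendsto (fun k : ℝ≥0 => k ^ finrank ℝ U) (𝓝[>] 1) (𝓝 (1 ^ finrank ℝ U)) :=
      ((continuous_pow _).tendsto 1).mono_left nhdsWithin_le_nhds
    rw [one_pow] at hcont
    obtain ⟨k, h1, h2⟩ :=
      ((eventually_mem_nhdsWithin (a := (1 : ℝ≥0)) (s := Ioi 1)).and
        (hcont.eventually_le_const hc)).exists
    exact ⟨k, h1, h2⟩
  -- `δ` is so small that `g` and `A` are bi-Lipschitz equivalent on `t` with constant `k`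
  obtain ⟨K, -, hK⟩ := A.toLinearMap.exists_antilipschitzWith (LinearMap.ker_eq_bot.2 hA)
  have hk1' : (1 : ℝ) < k := by exact_mod_cast hk1
  set δ : ℝ := (1 - 1 / (k : ℝ)) / (K + 1) with hδ
  have hη : 0 < 1 - 1 / (k : ℝ) := by
    rw [sub_pos, div_lt_one (by positivity)]; exact hk1'
  have hδpos : 0 < δ := by positivity
  have hδK : δ * K ≤ 1 - 1 / (k : ℝ) := by
    rw [hδ, div_mul_eq_mul_div, div_le_iff₀ (by positivity)]
    nlinarith [K.coe_nonneg]
  have hkk : 1 - 1 / (k : ℝ) ≤ k - 1 := by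
    have : 1 / (k : ℝ) * k = 1 := by field_simp
    nlinarith [sq_nonneg ((k : ℝ) - 1), one_div_pos.2 (zero_lt_one.trans hk1')]
  refine ⟨⟨δ, hδpos.le⟩, hδpos, fun t g hg => ?_⟩
  have key : ∀ x ∈ t, ∀ y ∈ t, ‖g x - g y - (A x - A y)‖ ≤ (1 - 1 / (k : ℝ)) * ‖A x - A y‖ := by
    intro x hx y hy
    have h1 : ‖g x - g y - A (x - y)‖ ≤ δ * ‖x - y‖ := hg x hx y hy
    have h2 : ‖x - y‖ ≤ K * ‖A x - A y‖ := by
      simpa [dist_eq_norm] using hK.le_mul_dist x y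
    rw [map_sub] at h1
    calc _ ≤ δ * ‖x - y‖ := h1
      _ ≤ δ * (K * ‖A x - A y‖) := by gcongr
      _ = δ * K * ‖A x - A y‖ := by ring
      _ ≤ _ := by gcongr
  have hpow : ((k : ℝ≥0∞)) ^ finrank ℝ U ≤ c := by exact_mod_cast hkc
  constructor
  · refine (euclideanHausdorffMeasure_image_le_of_edist_le (K := k) (g := A) _ ?_).trans
      (by gcongr)
    intro x hx y hy
    rw [edist_dist, edist_dist, ← ENNReal.ofReal_coe_nnreal, ← ENNReal.ofReal_mul (by positivity)]
    refine ENNReal.ofReal_le_ofReal ?_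
    rw [dist_eq_norm, dist_eq_norm]
    have h1 := key x hx y hy
    have h2 := norm_le_norm_sub_add (g x - g y) (A x - A y)
    nlinarith [norm_nonneg (A x - A y)]
  · refine (euclideanHausdorffMeasure_image_le_of_edist_le (K := k) (g := g) _ ?_).trans
      (by gcongr)
    intro x hx y hy
    rw [edist_dist, edist_dist, ← ENNReal.ofReal_coe_nnreal, ← ENNReal.ofReal_mul (by positivity)]
    refine ENNReal.ofReal_le_ofReal ?_
    rw [dist_eq_norm, dist_eq_norm]
    have h1 := key x hx y hy
    have h2 := norm_sub_norm_le (A x - A y) (g x - g y)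
    rw [norm_sub_rev (A x - A y)] at h2
    have h3 : 1 / (k : ℝ) * ‖A x - A y‖ ≤ ‖g x - g y‖ := by nlinarith
    rwa [one_div, inv_mul_le_iff₀ (by positivity)] at h3

/-- Linear maps close to `A` have nearly the Jacobian of `A`; it is read off from their action on
a ball. -/
theorem normDet_le_of_approximates {A B : U →L[ℝ] V} {δ c : ℝ≥0}
    (hδ : ∀ (t : Set U) (g : U → V), ApproximatesLinearOn g A t δ →
        (μHE[finrank ℝ U] : Measure V) (g '' t) ≤ c * (μHE[finrank ℝ U] : Measure V) (A '' t) ∧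
        (μHE[finrank ℝ U] : Measure V) (A '' t) ≤ c * (μHE[finrank ℝ U] : Measure V) (g '' t))
    (hB : ‖B - A‖ ≤ δ) :
    ENNReal.ofReal B.toLinearMap.normDet ≤ c * ENNReal.ofReal A.toLinearMap.normDet ∧
    ENNReal.ofReal A.toLinearMap.normDet ≤ c * ENNReal.ofReal B.toLinearMap.normDet := by
  have happ : ApproximatesLinearOn B A (Metric.ball 0 1) δ := by
    intro x _ y _
    rw [← map_sub, ← sub_apply]
    exact (B - A).le_of_opNorm_le hB _
  have h := hδ _ _ happ
  have e1 := LinearMap.euclideanHausdorffMeasure_image_eq_normDet_mul_volume B.toLinearMap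
    (Metric.ball 0 1)
  have e2 := LinearMap.euclideanHausdorffMeasure_image_eq_normDet_mul_volume A.toLinearMap
    (Metric.ball 0 1)
  simp only [ContinuousLinearMap.coe_coe] at e1 e2
  rw [e1, e2, ← mul_assoc, ← mul_assoc] at h
  have h0 : volume (Metric.ball (0 : U) 1) ≠ 0 := (Metric.measure_ball_pos _ _ one_pos).ne'
  have ht : volume (Metric.ball (0 : U) 1) ≠ ∞ := measure_ball_lt_top.ne
  exact ⟨(ENNReal.mul_le_mul_iff_left h0 ht).1 h.1, (ENNReal.mul_le_mul_iff_left h0 ht).1 h.2⟩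

variable [CompleteSpace V] {f : U → V} {f' : U → U →L[ℝ] V} {s : Set U}

/-- **Area formula**, set version. -/
theorem lintegral_normDet_eq_measure_image (hs : MeasurableSet s)
    (hf : ∀ x ∈ s, HasStrictFDerivAt f (f' x) x) (hcont : ContinuousOn f' s)
    (hinj' : ∀ x ∈ s, Function.Injective (f' x)) (hinj : InjOn f s) :
    ∫⁻ x in s, ENNReal.ofReal (f' x).toLinearMap.normDet =
      (μHE[finrank ℝ U] : Measure V) (f '' s) := by
  set J : U → ℝ≥0∞ := fun x => ENNReal.ofReal (f' x).toLinearMap.normDet with hJ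
  have hfc : ContinuousOn f s := fun x hx => (hf x hx).continuousAt.continuousWithinAt
  -- both measures agree up to the factor `c ^ 2` on small sets, hence everywhere
  have main : ∀ c : ℝ≥0, 1 < c →
      (μHE[finrank ℝ U] : Measure V) (f '' s) ≤ (c : ℝ≥0∞) ^ 2 * ∫⁻ x in s, J x ∧
      ∫⁻ x in s, J x ≤ (c : ℝ≥0∞) ^ 2 * (μHE[finrank ℝ U] : Measure V) (f '' s) := by
    intro c hc
    rcases s.eq_empty_or_nonempty with rfl | hne
    · simp
    have hloc : ∀ x ∈ s, ∃ O : Set U, IsOpen O ∧ x ∈ O ∧ ∀ t ⊆ s ∩ O, MeasurableSet t →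
        (μHE[finrank ℝ U] : Measure V) (f '' t) ≤ (c : ℝ≥0∞) ^ 2 * ∫⁻ x in t, J x ∧
        ∫⁻ x in t, J x ≤ (c : ℝ≥0∞) ^ 2 * (μHE[finrank ℝ U] : Measure V) (f '' t) := by
      intro x hx
      obtain ⟨δ, hδ0, hδ⟩ := exists_approximatesLinearOn_measure_image (f' x) (hinj' x hx) hc
      obtain ⟨O1, hO1, happ⟩ := (hf x hx).approximates_deriv_on_nhds (Or.inr hδ0)
      have h2 : ∀ᶠ y in 𝓝[s] x, ‖f' y - f' x‖ ≤ δ := by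
        have := (hcont x hx).eventually (Metric.closedBall_mem_nhds _ (NNReal.coe_pos.2 hδ0))
        simpa only [Metric.mem_closedBall, dist_eq_norm] using this
      obtain ⟨O2, hO2, hxO2, hsub⟩ := mem_nhdsWithin.1 h2
      refine ⟨interior O1 ∩ O2, isOpen_interior.inter hO2,
        ⟨mem_interior_iff_mem_nhds.2 hO1, hxO2⟩, fun t ht htm => ?_⟩
      have h3 := hδ t f (happ.mono_set fun y hy => interior_subset (ht hy).2.1)
      have h4 : ∀ y ∈ t, J y ≤ c * J x ∧ J x ≤ c * J y := fun y hy =>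
        normDet_le_of_approximates hδ (hsub ⟨(ht hy).2.2, (ht hy).1⟩)
      have e2 := LinearMap.euclideanHausdorffMeasure_image_eq_normDet_mul_volume
        (f' x).toLinearMap t
      simp only [ContinuousLinearMap.coe_coe] at e2
      rw [e2] at h3
      have h5 : J x * volume t ≤ c * ∫⁻ y in t, J y := by
        rw [← lintegral_const_mul' _ _ ENNReal.coe_ne_top, ← setLIntegral_const]
        exact setLIntegral_mono' htm fun y hy => (h4 y hy).2
      have h6 : ∫⁻ y in t, J y ≤ c * (J x * volume t) := by
        rw [← mul_assoc, ← setLIntegral_const]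
        exact setLIntegral_mono' htm fun y hy => (h4 y hy).1
      constructor
      · calc _ ≤ c * (J x * volume t) := h3.1
          _ ≤ c * (c * ∫⁻ y in t, J y) := by gcongr
          _ = _ := by ring
      · calc _ ≤ c * (J x * volume t) := h6
          _ ≤ c * (c * (μHE[finrank ℝ U] : Measure V) (f '' t)) :=
            mul_le_mul_right h3.2 _
          _ = _ := by ring
    choose! O hO hxO hOt using hloc
    obtain ⟨T, hTs, hTc, hcov⟩ := TopologicalSpace.countable_cover_nhdsWithin
      (f := O) (s := s) fun x hx => mem_nhdsWithin_of_mem_nhds ((hO x hx).mem_nhds (hxO x hx))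
    have hTne : T.Nonempty := by
      obtain ⟨x, hx⟩ := hne
      obtain ⟨y, hy, -⟩ := mem_iUnion₂.1 (hcov hx)
      exact ⟨y, hy⟩
    obtain ⟨a, rfl⟩ := hTc.exists_eq_range hTne
    have has : ∀ n, a n ∈ s := fun n => hTs (mem_range_self n)
    set D : ℕ → Set U := fun n => s ∩ disjointed (fun n => O (a n)) n with hD
    have hDm : ∀ n, MeasurableSet (D n) := fun n =>
      hs.inter (MeasurableSet.disjointed (fun i => (hO _ (has i)).measurableSet) n)
    have hDd : Pairwise (Function.onFun Disjoint D) := fun i j hij =>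
      (disjoint_disjointed _ hij).mono inter_subset_right inter_subset_right
    have hDU : s = ⋃ n, D n := by
      rw [hD, ← inter_iUnion, iUnion_disjointed, eq_comm, inter_eq_left]
      simpa using hcov
    have hDO : ∀ n, D n ⊆ s ∩ O (a n) := fun n =>
      inter_subset_inter_right _ (disjointed_subset _ _)
    have e1 : ∫⁻ x in s, J x = ∑' n, ∫⁻ x in D n, J x := by
      conv_lhs => rw [hDU]
      exact lintegral_iUnion hDm hDd _
    have e2 : (μHE[finrank ℝ U] : Measure V) (f '' s) =
        ∑' n, (μHE[finrank ℝ U] : Measure V) (f '' D n) := by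
      conv_lhs => rw [hDU, image_iUnion]
      refine measure_iUnion (fun i j hij => ?_) fun n => ?_
      · exact (hDd hij).image hinj inter_subset_left inter_subset_left
      · exact (hDm n).image_of_continuousOn_injOn (hfc.mono inter_subset_left)
          (hinj.mono inter_subset_left)
    rw [e1, e2, ← ENNReal.tsum_mul_left, ← ENNReal.tsum_mul_left]
    exact ⟨ENNReal.tsum_le_tsum fun n => (hOt _ (has n) _ (hDO n) (hDm n)).1,
      ENNReal.tsum_le_tsum fun n => (hOt _ (has n) _ (hDO n) (hDm n)).2⟩
  have lim : ∀ b : ℝ≥0∞, Tendsto (fun c : ℝ≥0 => (c : ℝ≥0∞) ^ 2 * b) (𝓝[>] 1) (𝓝 b) := by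
    intro b
    have h1 : Tendsto (fun c : ℝ≥0 => ((c ^ 2 : ℝ≥0) : ℝ≥0∞)) (𝓝[>] 1) (𝓝 ((1 ^ 2 : ℝ≥0) : ℝ≥0∞)) :=
      (ENNReal.tendsto_coe.2 ((continuous_pow 2).tendsto 1)).mono_left nhdsWithin_le_nhds
    have := ENNReal.Tendsto.mul_const (b := b) h1 (Or.inl (by simp))
    simpa using this
  refine le_antisymm (ge_of_tendsto (lim _) ?_) (ge_of_tendsto (lim _) ?_)
  · filter_upwards [self_mem_nhdsWithin] with c hc using (main c hc).2
  · filter_upwards [self_mem_nhdsWithin] with c hc using (main c hc).1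

/-- **Area formula**: on the image of an injective immersion, the Hausdorff measure is the
push-forward of Lebesgue measure with density the Jacobian. -/
theorem map_withDensity_normDet (hs : MeasurableSet s)
    (hf : ∀ x ∈ s, HasStrictFDerivAt f (f' x) x) (hcont : ContinuousOn f' s)
    (hinj' : ∀ x ∈ s, Function.Injective (f' x)) (hinj : InjOn f s) :
    Measure.map (s.domRestrict f) (Measure.comap (↑)
      ((volume : Measure U).withDensity fun x => ENNReal.ofReal (f' x).toLinearMap.normDet)) =
      (μHE[finrank ℝ U] : Measure V).restrict (f '' s) := by
  have hfc : ContinuousOn f s := fun x hx => (hf x hx).continuousAt.continuousWithinAt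
  have hme : MeasurableEmbedding (s.domRestrict f) :=
    hfc.measurableEmbedding hs hinj
  refine Measure.ext fun t ht => ?_
  have hpre : MeasurableSet (((↑) : s → U) '' (s.domRestrict f ⁻¹' t)) :=
    hs.subtype_image (hme.measurable ht)
  rw [hme.map_apply, comap_subtype_coe_apply hs, withDensity_apply _ hpre,
    Measure.restrict_apply ht]
  have hsub : ((↑) : s → U) '' (s.domRestrict f ⁻¹' t) ⊆ s := by
    rintro _ ⟨x, -, rfl⟩; exact x.2
  rw [lintegral_normDet_eq_measure_image hpre (fun x hx => hf x (hsub hx)) (hcont.mono hsub)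
    (fun x hx => hinj' x (hsub hx)) (hinj.mono hsub)]
  congr 1
  ext y
  constructor
  · rintro ⟨_, ⟨x, hx, rfl⟩, rfl⟩
    exact ⟨hx, x, x.2, rfl⟩
  · rintro ⟨hy, x, hx, rfl⟩
    exact ⟨x, ⟨⟨x, hx⟩, hy, rfl⟩, rfl⟩

theorem lintegral_image_eq_lintegral_normDet_mul (hs : MeasurableSet s)
    (hf : ∀ x ∈ s, HasStrictFDerivAt f (f' x) x) (hcont : ContinuousOn f' s)
    (hinj' : ∀ x ∈ s, Function.Injective (f' x)) (hinj : InjOn f s) (g : V → ℝ≥0∞) :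
    ∫⁻ y in f '' s, g y ∂(μHE[finrank ℝ U] : Measure V) =
      ∫⁻ x in s, ENNReal.ofReal (f' x).toLinearMap.normDet * g (f x) := by
  have hfc : ContinuousOn f s := fun x hx => (hf x hx).continuousAt.continuousWithinAt
  have hme : MeasurableEmbedding (s.domRestrict f) :=
    hfc.measurableEmbedding hs hinj
  have hJ : AEMeasurable (fun x => ENNReal.ofReal (f' x).toLinearMap.normDet)
      ((volume : Measure U).restrict s) :=
    (continuous_normDet.comp_continuousOn hcont).aemeasurable hs |>.ennreal_ofReal
  rw [← map_withDensity_normDet hs hf hcont hinj' hinj, hme.lintegral_map]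
  simp only [Set.domRestrict_apply, ← Function.comp_apply (f := g)]
  rw [← (MeasurableEmbedding.subtype_coe hs).lintegral_map, map_comap_subtype_coe hs,
    setLIntegral_withDensity_eq_setLIntegral_mul_non_measurable₀ _ _ _ hs]
  · simp only [Pi.mul_apply]
  · simp only [eventually_true, ENNReal.ofReal_lt_top]
  · exact hJ

theorem integral_image_eq_integral_normDet_mul (hs : MeasurableSet s)
    (hf : ∀ x ∈ s, HasStrictFDerivAt f (f' x) x) (hcont : ContinuousOn f' s)
    (hinj' : ∀ x ∈ s, Function.Injective (f' x)) (hinj : InjOn f s) (g : V → ℝ) :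
    ∫ y in f '' s, g y ∂(μHE[finrank ℝ U] : Measure V) =
      ∫ x in s, (f' x).toLinearMap.normDet * g (f x) := by
  have hfc : ContinuousOn f s := fun x hx => (hf x hx).continuousAt.continuousWithinAt
  have hme : MeasurableEmbedding (s.domRestrict f) :=
    hfc.measurableEmbedding hs hinj
  have hJ : AEMeasurable (fun x => Real.toNNReal (f' x).toLinearMap.normDet)
      ((volume : Measure U).restrict s) :=
    (continuous_normDet.comp_continuousOn hcont).aemeasurable hs |>.real_toNNReal
  rw [← map_withDensity_normDet hs hf hcont hinj' hinj, hme.integral_map]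
  simp only [Set.domRestrict_apply, ← Function.comp_apply (f := g), ENNReal.ofReal]
  rw [← (MeasurableEmbedding.subtype_coe hs).integral_map, map_comap_subtype_coe hs,
    setIntegral_withDensity_eq_setIntegral_smul₀ hJ _ hs]
  refine setIntegral_congr_fun hs fun x _ => ?_
  simp only [NNReal.smul_def, Real.coe_toNNReal _ (LinearMap.normDet_nonneg _), smul_eq_mul,
    Function.comp_apply]

end AreaFormula

/-! ### Multilinear algebra of `ℝ⁴` -/

theorem inner_E4 (x y : E4) : ⟪x, y⟫_ℝ = x 0 * y 0 + x 1 * y 1 + x 2 * y 2 + x 3 * y 3 := by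
  simp [PiLp.inner_apply, Fin.sum_univ_four]
  ring

theorem E4_ext {x y : E4} (h0 : x 0 = y 0) (h1 : x 1 = y 1) (h2 : x 2 = y 2) (h3 : x 3 = y 3) :
    x = y := by
  ext i
  fin_cases i <;> assumption

theorem norm_sq_E4 (x : E4) : ‖x‖ ^ 2 = x 0 ^ 2 + x 1 ^ 2 + x 2 ^ 2 + x 3 ^ 2 := by
  rw [← real_inner_self_eq_norm_sq, inner_E4]; ring

theorem hopf_apply (p : E4) : hopf p 0 = -p 1 ∧ hopf p 1 = p 0 ∧ hopf p 2 = -p 3 ∧ hopf p 3 = p 2 :=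
  ⟨rfl, rfl, rfl, rfl⟩

/-- The triple cross product of `ℝ⁴`: `⟪cross p v w, y⟫ = det (p, v, w, y)`. -/
def cross (p v w : E4) : E4 :=
  !₂[-(p 1 * (v 2 * w 3 - v 3 * w 2) - p 2 * (v 1 * w 3 - v 3 * w 1)
        + p 3 * (v 1 * w 2 - v 2 * w 1)),
    p 0 * (v 2 * w 3 - v 3 * w 2) - p 2 * (v 0 * w 3 - v 3 * w 0) + p 3 * (v 0 * w 2 - v 2 * w 0),
    -(p 0 * (v 1 * w 3 - v 3 * w 1) - p 1 * (v 0 * w 3 - v 3 * w 0)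
        + p 3 * (v 0 * w 1 - v 1 * w 0)),
    p 0 * (v 1 * w 2 - v 2 * w 1) - p 1 * (v 0 * w 2 - v 2 * w 0) + p 2 * (v 0 * w 1 - v 1 * w 0)]

theorem cross_zero (p v w : E4) : cross p v w 0 =
    -(p 1 * (v 2 * w 3 - v 3 * w 2) - p 2 * (v 1 * w 3 - v 3 * w 1)
        + p 3 * (v 1 * w 2 - v 2 * w 1)) := rfl

theorem cross_one (p v w : E4) : cross p v w 1 =
    p 0 * (v 2 * w 3 - v 3 * w 2) - p 2 * (v 0 * w 3 - v 3 * w 0)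
      + p 3 * (v 0 * w 2 - v 2 * w 0) := rfl

theorem cross_two (p v w : E4) : cross p v w 2 =
    -(p 0 * (v 1 * w 3 - v 3 * w 1) - p 1 * (v 0 * w 3 - v 3 * w 0)
        + p 3 * (v 0 * w 1 - v 1 * w 0)) := rfl

theorem cross_three (p v w : E4) : cross p v w 3 =
    p 0 * (v 1 * w 2 - v 2 * w 1) - p 1 * (v 0 * w 2 - v 2 * w 0)
      + p 2 * (v 0 * w 1 - v 1 * w 0) := rfl

theorem inner_cross_left (p v w : E4) : ⟪p, cross p v w⟫_ℝ = 0 := by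
  rw [inner_E4, cross_zero, cross_one, cross_two, cross_three]; ring

theorem cross_smul_right (p v w : E4) (a : ℝ) : cross p v (a • w) = a • cross p v w := by
  apply E4_ext <;>
    simp only [PiLp.smul_apply, smul_eq_mul, cross_zero, cross_one, cross_two, cross_three] <;> ring

theorem cross_smul_add_mid (p v w : E4) (a b : ℝ) :
    cross p (a • v + b • w) w = a • cross p v w := by
  apply E4_ext <;>
    simp only [PiLp.smul_apply, PiLp.add_apply, smul_eq_mul, cross_zero, cross_one, cross_two,
      cross_three] <;> ring

/-- On the sphere the cross product of two tangent vectors `v, w` is Hodge dual to `v ∧ w`. -/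
theorem hodge_cross {p v w : E4} (hp : ‖p‖ = 1) (hv : ⟪v, p⟫_ℝ = 0) (hw : ⟪w, p⟫_ℝ = 0) :
    p 2 * cross p v w 3 - p 3 * cross p v w 2 = v 0 * w 1 - v 1 * w 0 ∧
    -(p 1 * cross p v w 3 - p 3 * cross p v w 1) = v 0 * w 2 - v 2 * w 0 ∧
    p 1 * cross p v w 2 - p 2 * cross p v w 1 = v 0 * w 3 - v 3 * w 0 ∧
    p 0 * cross p v w 3 - p 3 * cross p v w 0 = v 1 * w 2 - v 2 * w 1 ∧
    -(p 0 * cross p v w 2 - p 2 * cross p v w 0) = v 1 * w 3 - v 3 * w 1 ∧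
    p 0 * cross p v w 1 - p 1 * cross p v w 0 = v 2 * w 3 - v 3 * w 2 := by
  have hp2 : p 0 ^ 2 + p 1 ^ 2 + p 2 ^ 2 + p 3 ^ 2 = 1 := by rw [← norm_sq_E4, hp]; norm_num
  rw [inner_E4] at hv hw
  simp only [cross_zero, cross_one, cross_two, cross_three]
  refine ⟨?_, ?_, ?_, ?_, ?_, ?_⟩
  · linear_combination p 0 * (v 1 * hw - w 1 * hv) - p 1 * (v 0 * hw - w 0 * hv)
      + (v 0 * w 1 - v 1 * w 0) * hp2
  · linear_combination p 0 * (v 2 * hw - w 2 * hv) - p 2 * (v 0 * hw - w 0 * hv)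
      + (v 0 * w 2 - v 2 * w 0) * hp2
  · linear_combination p 0 * (v 3 * hw - w 3 * hv) - p 3 * (v 0 * hw - w 0 * hv)
      + (v 0 * w 3 - v 3 * w 0) * hp2
  · linear_combination p 1 * (v 2 * hw - w 2 * hv) - p 2 * (v 1 * hw - w 1 * hv)
      + (v 1 * w 2 - v 2 * w 1) * hp2
  · linear_combination p 1 * (v 3 * hw - w 3 * hv) - p 3 * (v 1 * hw - w 1 * hv)
      + (v 1 * w 3 - v 3 * w 1) * hp2
  · linear_combination p 2 * (v 3 * hw - w 3 * hv) - p 3 * (v 2 * hw - w 2 * hv)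
      + (v 2 * w 3 - v 3 * w 2) * hp2

theorem cross_cross {p v w : E4} (n : E4) (hp : ‖p‖ = 1) (hv : ⟪v, p⟫_ℝ = 0) (hw : ⟪w, p⟫_ℝ = 0) :
    cross p (cross p v w) n = ⟪v, n⟫_ℝ • w - ⟪w, n⟫_ℝ • v := by
  obtain ⟨h01, h02, h03, h12, h13, h23⟩ := hodge_cross hp hv hw
  set c := cross p v w
  rw [inner_E4, inner_E4]
  apply E4_ext <;>
    simp only [PiLp.smul_apply, PiLp.sub_apply, smul_eq_mul]
  · rw [cross_zero]
    linear_combination -n 1 * h01 - n 2 * h02 - n 3 * h03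
  · rw [cross_one]
    linear_combination n 0 * h01 - n 2 * h12 - n 3 * h13
  · rw [cross_two]
    linear_combination n 0 * h02 + n 1 * h12 - n 3 * h23
  · rw [cross_three]
    linear_combination n 0 * h03 + n 1 * h13 + n 2 * h23

theorem cross_eq_inner_smul {p v w n : E4} (hp : ‖p‖ = 1) (hv : ⟪v, p⟫_ℝ = 0) (hw : ⟪w, p⟫_ℝ = 0)
    (hn : ‖n‖ = 1) (hnp : ⟪n, p⟫_ℝ = 0) (hnv : ⟪n, v⟫_ℝ = 0) (hnw : ⟪n, w⟫_ℝ = 0) :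
    cross p v w = ⟪cross p v w, n⟫_ℝ • n := by
  have h1 := cross_cross n hp hv hw
  rw [real_inner_comm, hnv, real_inner_comm, hnw, zero_smul, zero_smul, sub_zero] at h1
  have hcp : ⟪cross p v w, p⟫_ℝ = 0 := by rw [real_inner_comm]; exact inner_cross_left _ _ _
  have h2 := cross_cross n hp hcp hnp
  rw [h1, real_inner_self_eq_norm_sq, hn, one_pow, one_smul] at h2
  have h3 : cross p 0 n = 0 := by
    apply E4_ext <;> simp [cross_zero, cross_one, cross_two, cross_three]
  rw [h3] at h2
  exact (sub_eq_zero.1 h2.symm).symm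

theorem norm_sq_cross {p v w : E4} (hp : ‖p‖ = 1) (hv : ⟪v, p⟫_ℝ = 0) (hw : ⟪w, p⟫_ℝ = 0) :
    ‖cross p v w‖ ^ 2 = ‖v‖ ^ 2 * ‖w‖ ^ 2 - ⟪v, w⟫_ℝ ^ 2 := by
  have h1 := cross_cross (cross p v w) hp hv hw
  have hlag : ‖cross p v w‖ ^ 2 = ‖p‖ ^ 2 * (‖v‖ ^ 2 * ‖w‖ ^ 2 - ⟪v, w⟫_ℝ ^ 2)
      - ⟪v, p⟫_ℝ * (⟪v, p⟫_ℝ * ‖w‖ ^ 2 - ⟪v, w⟫_ℝ * ⟪w, p⟫_ℝ)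
      + ⟪w, p⟫_ℝ * (⟪v, p⟫_ℝ * ⟪v, w⟫_ℝ - ‖v‖ ^ 2 * ⟪w, p⟫_ℝ) := by
    simp only [norm_sq_E4, inner_E4, cross_zero, cross_one, cross_two, cross_three]
    ring
  rw [hlag, hp, hv, hw]; ring

/-- The Jacobian of a map into the sphere is the length of the cross product. -/
theorem normDet_eq_norm_cross {p : E4} (A : E2 →L[ℝ] E4) (hp : ‖p‖ = 1)
    (hA : ∀ x, ⟪A x, p⟫_ℝ = 0) : A.toLinearMap.normDet =
      ‖cross p (A (EuclideanSpace.single 0 1)) (A (EuclideanSpace.single 1 1))‖ := by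
  have h1 := A.toLinearMap.normDet_sq_eq_det_gram (EuclideanSpace.basisFun (Fin 2) ℝ)
  have h2 := norm_sq_cross hp (hA (EuclideanSpace.single 0 1)) (hA (EuclideanSpace.single 1 1))
  simp only [RCLike.ofReal_real_eq_id, id_eq, Matrix.det_fin_two, Matrix.gram_apply,
    EuclideanSpace.basisFun_apply, ContinuousLinearMap.coe_coe, real_inner_self_eq_norm_sq] at h1
  rw [← sq_eq_sq₀ (LinearMap.normDet_nonneg _) (norm_nonneg _), h1, h2]
  rw [real_inner_comm (A (EuclideanSpace.single 0 1)), pow_two ⟪_, _⟫_ℝ]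

/-- The value of the 2-form `⟪D v, w⟫ - ⟪D w, v⟫` on the bivector Hodge dual to `p ∧ n`. If `D` is
the derivative at `p` of a vector field `b`, this is the exterior derivative of the 1-form `⟪b, ·⟫`
on an oriented orthonormal frame of the plane orthogonal to `p` and `n`. -/
def dualForm (D : E4 →L[ℝ] E4) (p n : E4) : ℝ :=
  (D (EuclideanSpace.single 0 1) 1 - D (EuclideanSpace.single 1 1) 0) * (p 2 * n 3 - p 3 * n 2)
  - (D (EuclideanSpace.single 0 1) 2 - D (EuclideanSpace.single 2 1) 0) * (p 1 * n 3 - p 3 * n 1)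
  + (D (EuclideanSpace.single 0 1) 3 - D (EuclideanSpace.single 3 1) 0) * (p 1 * n 2 - p 2 * n 1)
  + (D (EuclideanSpace.single 1 1) 2 - D (EuclideanSpace.single 2 1) 1) * (p 0 * n 3 - p 3 * n 0)
  - (D (EuclideanSpace.single 1 1) 3 - D (EuclideanSpace.single 3 1) 1) * (p 0 * n 2 - p 2 * n 0)
  + (D (EuclideanSpace.single 2 1) 3 - D (EuclideanSpace.single 3 1) 2) * (p 0 * n 1 - p 1 * n 0)

theorem dualForm_smul (D : E4 →L[ℝ] E4) (p n : E4) (a : ℝ) :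
    dualForm D p (a • n) = a * dualForm D p n := by
  simp only [dualForm, PiLp.smul_apply, smul_eq_mul]; ring

theorem dualForm_add (D D' : E4 →L[ℝ] E4) (p n : E4) :
    dualForm (D + D') p n = dualForm D p n + dualForm D' p n := by
  simp only [dualForm, add_apply, PiLp.add_apply]; ring

theorem dualForm_zero (p n : E4) : dualForm 0 p n = 0 := by
  simp [dualForm]

theorem map_E4 (D : E4 →L[ℝ] E4) (v : E4) : D v =
    v 0 • D (EuclideanSpace.single 0 1) + v 1 • D (EuclideanSpace.single 1 1)
    + v 2 • D (EuclideanSpace.single 2 1) + v 3 • D (EuclideanSpace.single 3 1) := by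
  have : v = v 0 • EuclideanSpace.single 0 1 + v 1 • EuclideanSpace.single 1 1
    + v 2 • EuclideanSpace.single 2 1 + v 3 • EuclideanSpace.single 3 1 := by
    apply E4_ext <;> simp
  conv_lhs => rw [this]
  simp only [map_add, map_smul]

theorem inner_sub_inner_eq_dualForm {p v w : E4} (D : E4 →L[ℝ] E4) (hp : ‖p‖ = 1)
    (hv : ⟪v, p⟫_ℝ = 0) (hw : ⟪w, p⟫_ℝ = 0) :
    ⟪D v, w⟫_ℝ - ⟪D w, v⟫_ℝ = dualForm D p (cross p v w) := by
  obtain ⟨h01, h02, h03, h12, h13, h23⟩ := hodge_cross hp hv hw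
  rw [map_E4 D v, map_E4 D w, dualForm, inner_E4, inner_E4]
  simp only [PiLp.smul_apply, PiLp.add_apply, smul_eq_mul]
  generalize D (EuclideanSpace.single 0 1) = d0
  generalize D (EuclideanSpace.single 1 1) = d1
  generalize D (EuclideanSpace.single 2 1) = d2
  generalize D (EuclideanSpace.single 3 1) = d3
  linear_combination -(d0 1 - d1 0) * h01 - (d0 2 - d2 0) * h02 - (d0 3 - d3 0) * h03
    - (d1 2 - d2 1) * h12 - (d1 3 - d3 1) * h13 - (d2 3 - d3 2) * h23

/-! ### Convex patches of a surface -/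

/-- The closed half-plane `x₀ ≥ 0`. -/
def halfPlane : Set E2 := {x | 0 ≤ x 0}

/-- A parametrization of `S ∩ W` by the part of a bounded convex open set `U` in the closed
half-plane. Patches around interior points are those with `U` inside the open half-plane, so that
interior and boundary points need no separate treatment. -/
structure SurfacePatch (S : Set E4) where
  /-- the parameter domain -/
  U : Set E2
  /-- the open set of `ℝ⁴` in which `S` is parametrized -/
  W : Set E4
  /-- the parametrization -/
  φ : E2 → E4
  /-- the inverse of the parametrization -/
  ψ : E4 → E2
  isOpen_U : IsOpen U
  convex_U : Convex ℝ U
  isBounded_U : Bornology.IsBounded U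
  isOpen_W : IsOpen W
  contDiffOn : ContDiffOn ℝ 2 φ U
  injective : ∀ x ∈ U, Function.Injective (fderiv ℝ φ x)
  image_eq : φ '' (U ∩ halfPlane) = S ∩ W
  continuousOn_ψ : ContinuousOn ψ (S ∩ W)
  left_inv : ∀ x ∈ U ∩ halfPlane, ψ (φ x) = x
  measure_lt_top : (μHE[2] : Measure E4) (S ∩ W) < ∞

theorem measurableSet_halfPlane : MeasurableSet halfPlane :=
  (isClosed_le continuous_const (PiLp.continuous_apply 2 _ 0)).measurableSet

theorem convex_halfPlane : Convex ℝ halfPlane := by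
  intro x hx y hy a b ha hb _
  simp only [halfPlane, mem_ofPred, PiLp.add_apply, PiLp.smul_apply, smul_eq_mul] at *
  positivity

namespace SurfacePatch

variable {S : Set E4} (P : SurfacePatch S)

theorem hasStrictFDerivAt {x : E2} (hx : x ∈ P.U) :
    HasStrictFDerivAt P.φ (fderiv ℝ P.φ x) x :=
  (P.contDiffOn.contDiffAt (P.isOpen_U.mem_nhds hx)).hasStrictFDerivAt two_ne_zero

theorem hasFDerivAt {x : E2} (hx : x ∈ P.U) : HasFDerivAt P.φ (fderiv ℝ P.φ x) x :=
  (P.hasStrictFDerivAt hx).hasFDerivAt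

theorem contDiffOn_fderiv : ContDiffOn ℝ 1 (fderiv ℝ P.φ) P.U :=
  P.contDiffOn.fderiv_of_isOpen P.isOpen_U (by norm_num)

theorem continuousOn_fderiv : ContinuousOn (fderiv ℝ P.φ) P.U := P.contDiffOn_fderiv.continuousOn

theorem continuousOn_φ : ContinuousOn P.φ P.U := P.contDiffOn.continuousOn

theorem φ_mem {x : E2} (hx : x ∈ P.U ∩ halfPlane) : P.φ x ∈ S ∩ P.W :=
  P.image_eq ▸ mem_image_of_mem _ hx

theorem exists_φ_eq {p : E4} (hp : p ∈ S ∩ P.W) : ∃ x ∈ P.U ∩ halfPlane, P.φ x = p := by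
  rwa [← P.image_eq] at hp

theorem ψ_mem {p : E4} (hp : p ∈ S ∩ P.W) : P.ψ p ∈ P.U ∩ halfPlane ∧ P.φ (P.ψ p) = p := by
  obtain ⟨x, hx, rfl⟩ := P.exists_φ_eq hp
  rw [P.left_inv x hx]
  exact ⟨hx, rfl⟩

theorem injOn : InjOn P.φ (P.U ∩ halfPlane) := fun x hx y hy h => by
  rw [← P.left_inv x hx, h, P.left_inv y hy]

theorem measurableSet_domain : MeasurableSet (P.U ∩ halfPlane) :=
  P.isOpen_U.measurableSet.inter measurableSet_halfPlane

theorem uniqueDiffWithinAt {x : E2} (hx : x ∈ P.U ∩ halfPlane) :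
    UniqueDiffWithinAt ℝ (P.U ∩ halfPlane) x := by
  refine uniqueDiffWithinAt_convex (P.convex_U.inter convex_halfPlane) ?_ (subset_closure hx)
  have hopen : IsOpen (P.U ∩ {y : E2 | 0 < y 0}) :=
    P.isOpen_U.inter (isOpen_lt continuous_const (PiLp.continuous_apply 2 _ 0))
  have hlim : Tendsto (fun t : ℝ => x + t • EuclideanSpace.single (0 : Fin 2) (1 : ℝ))
      (𝓝[>] 0) (𝓝 x) := by
    have : Continuous fun t : ℝ => x + t • EuclideanSpace.single (0 : Fin 2) (1 : ℝ) := by fun_prop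
    simpa using (this.tendsto 0).mono_left nhdsWithin_le_nhds
  obtain ⟨t, ht, ht0⟩ :=
    ((hlim.eventually (P.isOpen_U.mem_nhds hx.1)).and eventually_mem_nhdsWithin).exists
  refine ⟨_, mem_interior.2 ⟨_, ?_, hopen, ht, ?_⟩⟩
  · exact inter_subset_inter_right _ fun y hy => (mem_ofPred.1 hy).le
  · have h0 : (0 : ℝ) ≤ x 0 := hx.2
    have : (0 : ℝ) < t := ht0
    simpa using by linarith

theorem fderiv_mem_tangentPlane {x : E2} (hx : x ∈ P.U ∩ halfPlane) (v : E2) :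
    fderiv ℝ P.φ x v ∈ tangentPlane S (P.φ x) := by
  have h1 := ((P.hasFDerivAt hx.1).hasFDerivWithinAt (s := P.U ∩ halfPlane)).mapsTo_tangent_cone
  have hle : Submodule.span ℝ (tangentConeAt ℝ (P.U ∩ halfPlane) x) ≤
      (tangentPlane S (P.φ x)).comap (fderiv ℝ P.φ x).toLinearMap := by
    refine Submodule.span_le.2 fun u hu => Submodule.subset_span ?_
    exact tangentConeAt_mono (by rw [P.image_eq]; exact inter_subset_left) (h1 hu)
  -- the submodule is closed because the plane has finite dimension
  have hcl := (P.uniqueDiffWithinAt hx).dense_tangentConeAt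
  have htop : Submodule.span ℝ (tangentConeAt ℝ (P.U ∩ halfPlane) x) = ⊤ := by
    rw [← Submodule.dense_iff_topologicalClosure_eq_top.1 hcl]
    exact ((Submodule.closed_of_finiteDimensional _).submodule_topologicalClosure_eq).symm
  exact hle (htop ▸ Submodule.mem_top)

theorem norm_φ (hS : S ⊆ sphere3) {x : E2} (hx : x ∈ P.U ∩ halfPlane) : ‖P.φ x‖ = 1 := by
  simpa [sphere3] using hS (P.φ_mem hx).1

theorem inner_fderiv_self (hS : S ⊆ sphere3) {x : E2} (hx : x ∈ P.U ∩ halfPlane) (v : E2) :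
    ⟪fderiv ℝ P.φ x v, P.φ x⟫_ℝ = 0 := by
  have h1 := (((P.hasFDerivAt hx.1).norm_sq).hasFDerivWithinAt (s := P.U ∩ halfPlane))
  have h2 : HasFDerivWithinAt (fun y => ‖P.φ y‖ ^ 2) (0 : E2 →L[ℝ] ℝ) (P.U ∩ halfPlane) x := by
    refine (hasFDerivWithinAt_const (1 : ℝ) x _).congr (fun y hy => ?_) ?_
    · rw [P.norm_φ hS hy, one_pow]
    · rw [P.norm_φ hS hx, one_pow]
  have h3 := congrArg (fun f : E2 →L[ℝ] ℝ => f v) ((P.uniqueDiffWithinAt hx).eq h1 h2)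
  rw [real_inner_comm]
  simpa using h3

/-- The normal field of the parametrization, of length the Jacobian. -/
def normal (x : E2) : E4 :=
  cross (P.φ x) (fderiv ℝ P.φ x (EuclideanSpace.single 0 1))
    (fderiv ℝ P.φ x (EuclideanSpace.single 1 1))

theorem normDet_eq (hS : S ⊆ sphere3) {x : E2} (hx : x ∈ P.U ∩ halfPlane) :
    (fderiv ℝ P.φ x).toLinearMap.normDet = ‖P.normal x‖ :=
  normDet_eq_norm_cross _ (P.norm_φ hS hx) (P.inner_fderiv_self hS hx)

theorem norm_normal_pos (hS : S ⊆ sphere3) {x : E2} (hx : x ∈ P.U ∩ halfPlane) :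
    0 < ‖P.normal x‖ := by
  rw [← P.normDet_eq hS hx]
  refine (LinearMap.normDet_nonneg _).lt_of_ne fun h => ?_
  exact LinearMap.normDet_eq_zero_iff_ker_ne_bot.1 h.symm (LinearMap.ker_eq_bot.2 (P.injective x hx.1))

theorem continuousOn_normal : ContinuousOn P.normal P.U := by
  have hφ := P.continuousOn_φ
  have h0 : ContinuousOn (fun x => fderiv ℝ P.φ x (EuclideanSpace.single 0 1)) P.U :=
    P.continuousOn_fderiv.clm_apply continuousOn_const
  have h1 : ContinuousOn (fun x => fderiv ℝ P.φ x (EuclideanSpace.single 1 1)) P.U :=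
    P.continuousOn_fderiv.clm_apply continuousOn_const
  have hc : ∀ {f : E2 → E4} (i : Fin 4), ContinuousOn f P.U → ContinuousOn (fun x => f x i) P.U :=
    fun i hf => (PiLp.continuous_apply 2 _ i).comp_continuousOn hf
  have hφi := fun i => hc i hφ
  have h0i := fun i => hc i h0
  have h1i := fun i => hc i h1
  refine (PiLp.continuous_toLp 2 _).comp_continuousOn (continuousOn_pi.2 fun i => ?_)
  fin_cases i
  all_goals
    simp only [Fin.zero_eta, Fin.mk_one, Fin.reduceFinMk, Matrix.cons_val_zero, Matrix.cons_val_one,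
      Matrix.cons_val]
    fun_prop

/-- A unit normal of the surface is orthogonal to the coordinate vectors of a patch. -/
theorem inner_unitNormal {x : E2} (hx : x ∈ P.U ∩ halfPlane) {n : E4}
    (hn : n ∈ unitNormals S (P.φ x)) (v : E2) : ⟪n, fderiv ℝ P.φ x v⟫_ℝ = 0 :=
  hn.2.2 _ (P.fderiv_mem_tangentPlane hx v)

theorem normal_eq_smul (hS : S ⊆ sphere3) {x : E2} (hx : x ∈ P.U ∩ halfPlane) {n : E4}
    (hn : n ∈ unitNormals S (P.φ x)) : P.normal x = ⟪P.normal x, n⟫_ℝ • n :=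
  cross_eq_inner_smul (P.norm_φ hS hx) (P.inner_fderiv_self hS hx _) (P.inner_fderiv_self hS hx _)
    hn.1 hn.2.1 (P.inner_unitNormal hx hn _) (P.inner_unitNormal hx hn _)

theorem abs_inner_normal (hS : S ⊆ sphere3) {x : E2} (hx : x ∈ P.U ∩ halfPlane) {n : E4}
    (hn : n ∈ unitNormals S (P.φ x)) : |⟪P.normal x, n⟫_ℝ| = ‖P.normal x‖ := by
  conv_rhs => rw [P.normal_eq_smul hS hx hn, norm_smul, hn.1, mul_one, Real.norm_eq_abs]

/-- A continuous unit normal either agrees with the normal field of a patch throughout, or is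
opposite to it throughout. -/
theorem exists_sign (hS : S ⊆ sphere3) {N : E4 → E4} (hN : ContinuousOn N S)
    (hN' : ∀ p ∈ S, N p ∈ unitNormals S p) : ∃ s : ℝ, (s = 1 ∨ s = -1) ∧
      ∀ x ∈ P.U ∩ halfPlane, P.normal x = (s * ‖P.normal x‖) • N (P.φ x) := by
  have hmaps : MapsTo P.φ (P.U ∩ halfPlane) S := fun x hx => (P.φ_mem hx).1
  set g : E2 → ℝ := fun x => ⟪P.normal x, N (P.φ x)⟫_ℝ / ‖P.normal x‖
  have hg : ContinuousOn g (P.U ∩ halfPlane) := by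
    have hn := P.continuousOn_normal.mono (inter_subset_left (t := halfPlane))
    refine ContinuousOn.div (hn.inner ?_) hn.norm fun x hx => (P.norm_normal_pos hS hx).ne'
    exact hN.comp (P.continuousOn_φ.mono inter_subset_left) hmaps
  have hgv : ∀ x ∈ P.U ∩ halfPlane, g x = 1 ∨ g x = -1 := by
    intro x hx
    have hpos := P.norm_normal_pos hS hx
    have habs := P.abs_inner_normal hS hx (hN' _ (hmaps hx))
    rcases abs_choice ⟪P.normal x, N (P.φ x)⟫_ℝ with h | h
    · left; simp only [g]; rw [← h, habs, div_self hpos.ne']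
    · right; simp only [g]
      rw [div_eq_iff hpos.ne', neg_one_mul, ← habs, h, neg_neg]
  have hexp : ∀ x ∈ P.U ∩ halfPlane, P.normal x = (g x * ‖P.normal x‖) • N (P.φ x) := by
    intro x hx
    simp only [g]
    rw [div_mul_cancel₀ _ (P.norm_normal_pos hS hx).ne']
    exact P.normal_eq_smul hS hx (hN' _ (hmaps hx))
  rcases (P.U ∩ halfPlane).eq_empty_or_nonempty with he | ⟨x0, hx0⟩
  · exact ⟨1, Or.inl rfl, fun x hx => by simp [he] at hx⟩
  have hpre : IsPreconnected (P.U ∩ halfPlane) := (P.convex_U.inter convex_halfPlane).isPreconnected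
  have hfin : ({1, -1} : Set ℝ).Finite := by simp
  refine ⟨g x0, hgv x0 hx0, fun x hx => ?_⟩
  rw [← hpre.constant_of_mapsTo (T := {1, -1}) hfin.isDiscrete hg (fun y hy => by simpa using hgv y hy) hx hx0]
  exact hexp x hx

/-- A curve in the surface that leaves from a point of a patch has its velocity in the range of the
derivative of the parametrization; at boundary points the coordinate velocity points inwards. -/
theorem exists_fderiv_eq_of_curve {γ : ℝ → E4} {u : E4} {x : E2} (hx : x ∈ P.U ∩ halfPlane)
    (h0 : γ 0 = P.φ x) (hγ : HasDerivWithinAt γ u (Ioi 0) 0) (hS : ∀ᶠ s in 𝓝[>] 0, γ s ∈ S) :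
    ∃ ξ : E2, fderiv ℝ P.φ x ξ = u ∧ (x 0 = 0 → 0 ≤ ξ 0) := by
  set A := fderiv ℝ P.φ x with hA
  obtain ⟨K0, hK0⟩ := A.toLinearMap.exists_leftInverse_of_injective
    (LinearMap.ker_eq_bot.2 (P.injective x hx.1))
  set K : E4 →L[ℝ] E2 := K0.toContinuousLinearMap with hK
  have hKA : ∀ v, K (A v) = v := fun v => LinearMap.congr_fun hK0 v
  set y : ℝ → E2 := fun s => P.ψ (γ s) with hy
  have hy0 : y 0 = x := by simp only [hy]; rw [h0, P.left_inv x hx]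
  have hγc : Tendsto γ (𝓝[>] 0) (𝓝 (P.φ x)) := h0 ▸ hγ.continuousWithinAt.tendsto
  have hSW : ∀ᶠ s in 𝓝[>] 0, γ s ∈ S ∩ P.W := by
    filter_upwards [hS, hγc.eventually (P.isOpen_W.mem_nhds (P.φ_mem hx).2)] with s h1 h2
    exact ⟨h1, h2⟩
  have hyc : Tendsto y (𝓝[>] 0) (𝓝 x) := by
    have := (P.continuousOn_ψ _ (P.φ_mem hx)).tendsto.comp (tendsto_nhdsWithin_iff.2 ⟨hγc, hSW⟩)
    rwa [P.left_inv x hx] at this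
  have hlit : (fun s => P.φ (y s) - P.φ x - A (y s - x)) =o[𝓝[>] 0] fun s => y s - x :=
    (P.hasFDerivAt hx.1).isLittleO.comp_tendsto hyc
  have hφy : (fun s => P.φ (y s) - P.φ x) =ᶠ[𝓝[>] 0] fun s => γ s - γ 0 := by
    filter_upwards [hSW] with s hs
    rw [h0, (P.ψ_mem hs).2]
  have h1 : (fun s => K (γ s - γ 0) - (y s - x)) =o[𝓝[>] 0] fun s => y s - x := by
    have := (K.isBigO_comp (fun s => P.φ (y s) - P.φ x - A (y s - x)) (𝓝[>] 0)).trans_isLittleO hlit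
    refine this.congr' ?_ (EventuallyEq.refl _ _)
    filter_upwards [hφy] with s hs
    rw [map_sub, hKA, hs]
  have hγO : (fun s => γ s - γ 0) =O[𝓝[>] 0] fun s : ℝ => s := by
    simpa using hγ.hasFDerivWithinAt.isBigO_sub
  have h2 : (fun s => y s - x) =O[𝓝[>] 0] fun s : ℝ => s := by
    have h3 : (fun s => y s - x) =O[𝓝[>] 0] fun s => K (γ s - γ 0) := by
      have := h1.right_isBigO_add
      simpa using this
    exact h3.trans ((K.isBigO_comp _ _).trans hγO)
  have hderiv : HasDerivWithinAt y (K u) (Ioi 0) 0 := by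
    rw [hasDerivWithinAt_iff_isLittleO, hy0]
    have e1 := (h1.trans_isBigO h2)
    have e2 := (K.isBigO_comp (fun s => γ s - γ 0 - (s - 0) • u) (𝓝[>] 0)).trans_isLittleO
      (hasDerivWithinAt_iff_isLittleO.1 hγ)
    simp only [sub_zero] at e2 ⊢
    refine (e2.sub e1).congr_left fun s => ?_
    simp only [map_sub, map_smul]
    abel
  refine ⟨K u, ?_, fun hx0 => ?_⟩
  · have hφ : HasFDerivAt P.φ A (y 0) := by rw [hy0]; exact P.hasFDerivAt hx.1
    have h3 := hφ.comp_hasDerivWithinAt (0 : ℝ) hderiv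
    have h4 : HasDerivWithinAt γ (A (K u)) (Ioi 0) 0 := by
      refine h3.congr_of_eventuallyEq ?_ (by rw [Function.comp_apply, hy0, h0])
      filter_upwards [hSW] with s hs
      exact (P.ψ_mem hs).2.symm
    exact (uniqueDiffWithinAt_Ioi (0 : ℝ)).eq_deriv _ h4 hγ
  · have h5 : HasDerivWithinAt (fun s => y s 0) ((K u) 0) (Ioi 0) 0 :=
      ((EuclideanSpace.proj (0 : Fin 2) : E2 →L[ℝ] ℝ).hasFDerivAt.comp_hasDerivWithinAt (0 : ℝ)
        hderiv)
    have h6 := hasDerivWithinAt_iff_tendsto_slope.1 h5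
    rw [show Ioi (0 : ℝ) \ {0} = Ioi 0 by simp] at h6
    refine ge_of_tendsto h6 ?_
    filter_upwards [hSW, self_mem_nhdsWithin] with s hs hs0
    have hs1 : (0 : ℝ) ≤ y s 0 := (P.ψ_mem hs).1.2
    have hs2 : (0 : ℝ) < s := hs0
    rw [slope_def_field, hy0, hx0, sub_zero, sub_zero]
    positivity

/-- The points of a patch with vanishing first coordinate are boundary points. -/
theorem φ_mem_boundary {x : E2} (hx : x ∈ P.U) (hx0 : x 0 = 0) :
    P.φ x ∈ surfaceBoundary S := by
  have hxH : x ∈ P.U ∩ halfPlane := ⟨hx, hx0.ge⟩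
  refine ⟨(P.φ_mem hxH).1, (fun y => y + x) ⁻¹' P.U, P.W, fun y => P.φ (y + x),
    fun q => P.ψ q - x, P.isOpen_U.preimage (by fun_prop), P.isOpen_W, by simpa using hx,
    (P.φ_mem hxH).2, by simp, ?_, ?_, ?_, ?_, ?_⟩
  · exact P.contDiffOn.comp (by fun_prop) fun y hy => hy
  · intro y hy
    rw [fderiv_comp_add_right]
    exact P.injective _ hy
  · rw [← P.image_eq]
    ext q
    constructor
    · rintro ⟨y, ⟨hy1, hy2⟩, rfl⟩
      refine ⟨y + x, ⟨hy1, ?_⟩, rfl⟩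
      simpa [halfPlane, hx0] using hy2
    · rintro ⟨y, ⟨hy1, hy2⟩, rfl⟩
      refine ⟨y - x, ⟨by simpa using hy1, ?_⟩, by simp⟩
      simpa [halfPlane, hx0] using hy2
  · exact P.continuousOn_ψ.sub continuousOn_const
  · rintro y ⟨hy1, hy2⟩
    have : y + x ∈ P.U ∩ halfPlane := ⟨hy1, by simpa [halfPlane, hx0] using hy2⟩
    simp only [P.left_inv _ this, add_sub_cancel_right]

/-- A point with positive first coordinate is not a boundary point in any other patch. -/
theorem coord_ne_zero (Q : SurfacePatch S) {x z : E2} (hx : x ∈ P.U) (hx0 : 0 < x 0)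
    (hz : z ∈ Q.U ∩ halfPlane) (h : Q.φ z = P.φ x) : z 0 ≠ 0 := by
  intro hz0
  have hdir : ∀ v : E2, ∃ ξ : E2, fderiv ℝ Q.φ z ξ = fderiv ℝ P.φ x v ∧ 0 ≤ ξ 0 := by
    intro v
    have hline : HasDerivAt (fun t : ℝ => x + t • v) v 0 := by
      simpa using ((hasDerivAt_id (0 : ℝ)).smul_const v).const_add x
    have hφ : HasFDerivAt P.φ (fderiv ℝ P.φ x) (x + (0 : ℝ) • v) := by
      simpa using P.hasFDerivAt hx
    have hc := (hφ.comp_hasDerivAt (0 : ℝ) hline).hasDerivWithinAt (s := Ioi 0)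
    have hcont : Tendsto (fun t : ℝ => x + t • v) (𝓝[>] 0) (𝓝 x) := by
      have := hline.continuousAt.tendsto.mono_left (nhdsWithin_le_nhds (s := Ioi 0))
      simpa using this
    have hopen : IsOpen (P.U ∩ {y : E2 | 0 < y 0}) :=
      P.isOpen_U.inter (isOpen_lt continuous_const (PiLp.continuous_apply 2 _ 0))
    obtain ⟨ξ, h1, h2⟩ := Q.exists_fderiv_eq_of_curve hz (by simp [h]) hc (by
      filter_upwards [hcont.eventually (hopen.mem_nhds ⟨hx, hx0⟩)] with t ht
      exact (P.φ_mem ⟨ht.1, (mem_ofPred.1 ht.2).le⟩).1)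
    exact ⟨ξ, h1, h2 hz0⟩
  have hdir0 : ∀ v : E2, ∃ ξ : E2, fderiv ℝ Q.φ z ξ = fderiv ℝ P.φ x v ∧ ξ 0 = 0 := by
    intro v
    obtain ⟨ξ, h1, h2⟩ := hdir v
    obtain ⟨ζ, h3, h4⟩ := hdir (-v)
    have : ζ = -ξ := Q.injective z hz.1 (by rw [h3, map_neg, map_neg, h1])
    rw [this, PiLp.neg_apply] at h4
    exact ⟨ξ, h1, by linarith⟩
  obtain ⟨a, ha, ha0⟩ := hdir0 (EuclideanSpace.single 0 1)
  obtain ⟨b, hb, hb0⟩ := hdir0 (EuclideanSpace.single 1 1)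
  have hab : b 1 • a = a 1 • b := by
    ext i; fin_cases i
    · simp [ha0, hb0]
    · simp [mul_comm]
  have h5 : b 1 • EuclideanSpace.single (0 : Fin 2) (1 : ℝ) =
      a 1 • EuclideanSpace.single (1 : Fin 2) (1 : ℝ) := by
    apply P.injective x hx
    rw [map_smul, map_smul, ← ha, ← hb, ← map_smul, ← map_smul, hab]
  have h6 := congrArg (fun v : E2 => v 1) h5
  simp only [PiLp.smul_apply, smul_eq_mul, PiLp.single_apply] at h6
  have h7 : a = 0 := by
    ext i; fin_cases i
    · simpa using ha0
    · simpa using h6.symm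
  rw [h7, map_zero] at ha
  have h8 := P.injective x hx ((map_zero (fderiv ℝ P.φ x)).trans ha)
  simpa using congrArg (fun v : E2 => v 0) h8

end SurfacePatch

/-- The local parametrizations of a surface can be shrunk and shifted to patches with convex
domain. -/
theorem exists_surfacePatch_of_hasC2Patch {S : Set E4} {H : Set E2} {p : E4}
    (h : HasC2Patch H S p) (shift : ℝ → E2)
    (hH : ∀ r > 0, ∀ x ∈ Metric.ball (0 : E2) r, x ∈ H ↔ x + shift r ∈ halfPlane)
    (hHm : MeasurableSet H) (h0H : (0 : E2) ∈ H) :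
    ∃ P : SurfacePatch S, ∃ r > 0, shift r ∈ P.U ∩ halfPlane ∧ P.φ (shift r) = p := by
  obtain ⟨U, W, φ, ψ, hU, hW, h0U, hpW, hφ0, hφ, hinj, him, hψ, hleft⟩ := h
  obtain ⟨r, hr, hrU⟩ := Metric.nhds_basis_closedBall.mem_iff.1 (hU.mem_nhds h0U)
  have ha := hH r hr
  set a := shift r
  have hbU : Metric.ball (0 : E2) r ⊆ U := Metric.ball_subset_closedBall.trans hrU
  obtain ⟨O, hO, hOeq⟩ := continuousOn_iff'.1 hψ _ (Metric.isOpen_ball (x := (0 : E2)) (ε := r))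
  have himage : φ '' (Metric.ball 0 r ∩ H) = S ∩ (W ∩ O) := by
    ext q
    constructor
    · rintro ⟨x, ⟨hx1, hx2⟩, rfl⟩
      have hxU : x ∈ U ∩ H := ⟨hbU hx1, hx2⟩
      have h1 : φ x ∈ S ∩ W := him ▸ mem_image_of_mem _ hxU
      have h2 : φ x ∈ ψ ⁻¹' Metric.ball 0 r ∩ (S ∩ W) := ⟨by simpa [hleft x hxU] using hx1, h1⟩
      rw [hOeq] at h2
      exact ⟨h1.1, h1.2, h2.1⟩
    · rintro ⟨h1, h2, h3⟩
      have h4 : q ∈ ψ ⁻¹' Metric.ball 0 r ∩ (S ∩ W) := hOeq ▸ ⟨h3, h1, h2⟩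
      obtain ⟨x, hx, rfl⟩ : q ∈ φ '' (U ∩ H) := him ▸ ⟨h1, h2⟩
      refine ⟨x, ⟨?_, hx.2⟩, rfl⟩
      simpa [hleft x hx] using h4.1
  have hstrict : ∀ x ∈ U, HasStrictFDerivAt φ (fderiv ℝ φ x) x := fun x hx =>
    (hφ.contDiffAt (hU.mem_nhds hx)).hasStrictFDerivAt two_ne_zero
  have hfc : ContinuousOn (fderiv ℝ φ) U :=
    (hφ.fderiv_of_isOpen (m := 1) hU (by norm_num)).continuousOn
  have hmeas : (μHE[2] : Measure E4) (S ∩ (W ∩ O)) < ∞ := by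
    rw [← himage]
    have hsub : Metric.ball (0 : E2) r ∩ H ⊆ U := inter_subset_left.trans hbU
    have := lintegral_normDet_eq_measure_image (f := φ) (f' := fderiv ℝ φ)
      (s := Metric.ball (0 : E2) r ∩ H) (Metric.isOpen_ball.measurableSet.inter hHm)
      (fun x hx => hstrict x (hsub hx)) (hfc.mono hsub) (fun x hx => hinj x (hsub hx))
      (fun x hx y hy hxy => by
        rw [← hleft x ⟨hsub hx, hx.2⟩, hxy, hleft y ⟨hsub hy, hy.2⟩])
    rw [finrank_euclideanSpace_fin] at this
    rw [← this]
    obtain ⟨C, hC⟩ := (isCompact_closedBall (0 : E2) r).exists_bound_of_continuousOn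
      (continuous_normDet.comp_continuousOn (hfc.mono hrU))
    calc _ ≤ ∫⁻ _ in Metric.ball (0 : E2) r ∩ H, ENNReal.ofReal C :=
          setLIntegral_mono' (Metric.isOpen_ball.measurableSet.inter hHm) fun x hx =>
            ENNReal.ofReal_le_ofReal
              ((le_abs_self _).trans (hC x (Metric.ball_subset_closedBall hx.1)))
      _ = ENNReal.ofReal C * volume (Metric.ball (0 : E2) r ∩ H) := setLIntegral_const _ _
      _ < ∞ := ENNReal.mul_lt_top ENNReal.ofReal_lt_top
            ((measure_mono inter_subset_left).trans_lt measure_ball_lt_top)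
  have hmem : ∀ x : E2, x ∈ Metric.ball a r ↔ x - a ∈ Metric.ball 0 r := fun x => by
    simp [dist_eq_norm]
  have hmemH : ∀ x : E2, x ∈ Metric.ball a r ∩ halfPlane ↔ x - a ∈ Metric.ball 0 r ∩ H := by
    intro x
    rw [mem_inter_iff, mem_inter_iff, hmem]
    refine and_congr_right fun hx => ?_
    rw [ha _ hx, sub_add_cancel]
  refine ⟨{
    U := Metric.ball a r
    W := W ∩ O
    φ := fun x => φ (x - a)
    ψ := fun q => ψ q + a
    isOpen_U := Metric.isOpen_ball
    convex_U := convex_ball a r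
    isBounded_U := Metric.isBounded_ball
    isOpen_W := hW.inter hO
    contDiffOn := hφ.comp (by fun_prop) fun x hx => hbU ((hmem x).1 hx)
    injective := fun x hx => by
      rw [fderiv_comp_sub]; exact hinj _ (hbU ((hmem x).1 hx))
    image_eq := ?_
    continuousOn_ψ := (hψ.mono (inter_subset_inter_right _ inter_subset_left)).add
      continuousOn_const
    left_inv := fun x hx => by
      have := (hmemH x).1 hx
      simp only [hleft _ ⟨hbU this.1, this.2⟩, sub_add_cancel]
    measure_lt_top := hmeas }, r, hr, ?_⟩
  · rw [← himage]
    ext q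
    constructor
    · rintro ⟨x, hx, rfl⟩
      exact ⟨x - a, (hmemH x).1 hx, rfl⟩
    · rintro ⟨x, hx, rfl⟩
      exact ⟨x + a, (hmemH _).2 (by simpa using hx), by simp⟩
  · exact ⟨(hmemH a).2 ⟨by simpa using hr, by simpa using h0H⟩, by simpa [a] using hφ0⟩

/-- Around a boundary point there is a patch in which that point lies on the boundary line. -/
theorem exists_boundaryPatch {S : Set E4} {p : E4} (h : IsBoundaryPoint S p) :
    ∃ P : SurfacePatch S, ∃ z ∈ P.U ∩ halfPlane, P.φ z = p ∧ z 0 = 0 := by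
  obtain ⟨P, r, -, h1, h2⟩ := exists_surfacePatch_of_hasC2Patch h (fun _ => 0)
    (fun r _ x _ => by simp [halfPlane]) measurableSet_halfPlane (by simp)
  exact ⟨P, 0, h1, h2, rfl⟩

theorem exists_surfacePatch {S : Set E4} (hS : IsC2Surface S) {p : E4} (hp : p ∈ S) :
    ∃ P : SurfacePatch S, p ∈ P.W := by
  rcases hS.2 p hp with h | h
  · have hH : ∀ r > 0, ∀ x ∈ Metric.ball (0 : E2) r,
        x ∈ (univ : Set E2) ↔ x + EuclideanSpace.single (0 : Fin 2) r ∈ halfPlane := by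
      refine fun r hr x hx => ⟨fun _ => ?_, fun _ => mem_univ _⟩
      have h1 : |x 0| < r := (PiLp.norm_apply_le x 0).trans_lt (by simpa using hx)
      have h2 : (x + EuclideanSpace.single (0 : Fin 2) r : E2) 0 = x 0 + r := by simp
      rw [halfPlane, mem_ofPred, h2]
      linarith [neg_abs_le (x 0)]
    obtain ⟨P, r, -, h1, rfl⟩ := exists_surfacePatch_of_hasC2Patch h _ hH MeasurableSet.univ
      (mem_univ _)
    exact ⟨P, (P.φ_mem h1).2⟩
  · obtain ⟨P, z, hz, rfl, -⟩ := exists_boundaryPatch h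
    exact ⟨P, (P.φ_mem hz).2⟩

/-! ### Green's formula on the half-plane -/

/-- The measurable identification of `ℝ × ℝ` with the parameter plane. -/
def planeEquiv : ℝ × ℝ ≃ᵐ E2 :=
  (MeasurableEquiv.finTwoArrow (α := ℝ)).symm.trans (MeasurableEquiv.toLp 2 (Fin 2 → ℝ))

theorem planeEquiv_apply (z : ℝ × ℝ) : planeEquiv z = !₂[z.1, z.2] := rfl

theorem measurePreserving_planeEquiv : MeasurePreserving planeEquiv :=
  (volume_preserving_finTwoArrow ℝ).symm.trans
    (EuclideanSpace.volume_preserving_symm_measurableEquiv_toLp (Fin 2)).symm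

theorem hasDerivAt_plane_fst (s t : ℝ) :
    HasDerivAt (fun s : ℝ => (!₂[s, t] : E2)) (EuclideanSpace.single 0 1) s := by
  have : (fun s : ℝ => (!₂[s, t] : E2)) =
      fun s => s • EuclideanSpace.single 0 1 + t • EuclideanSpace.single 1 1 := by
    funext s; ext i; fin_cases i <;> simp
  rw [this]
  simpa using ((hasDerivAt_id s).smul_const (EuclideanSpace.single (0 : Fin 2) (1 : ℝ))).add_const
    (t • EuclideanSpace.single (1 : Fin 2) (1 : ℝ))

theorem hasDerivAt_plane_snd (s t : ℝ) :
    HasDerivAt (fun t : ℝ => (!₂[s, t] : E2)) (EuclideanSpace.single 1 1) t := by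
  have : (fun t : ℝ => (!₂[s, t] : E2)) =
      fun t => s • EuclideanSpace.single 0 1 + t • EuclideanSpace.single 1 1 := by
    funext s; ext i; fin_cases i <;> simp
  rw [this]
  simpa using ((hasDerivAt_id t).smul_const (EuclideanSpace.single (1 : Fin 2) (1 : ℝ))).const_add
    (s • EuclideanSpace.single (0 : Fin 2) (1 : ℝ))

theorem contDiff_plane_fst (t : ℝ) : ContDiff ℝ 1 fun s : ℝ => (!₂[s, t] : E2) := by
  rw [contDiff_euclidean]
  intro i; fin_cases i
  · exact contDiff_id
  · exact contDiff_const

theorem contDiff_plane_snd (s : ℝ) : ContDiff ℝ 1 fun t : ℝ => (!₂[s, t] : E2) := by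
  rw [contDiff_euclidean]
  intro i; fin_cases i
  · exact contDiff_const
  · exact contDiff_id

theorem hasCompactSupport_plane_fst {a : E2 → ℝ} (ha : HasCompactSupport a) (t : ℝ) :
    HasCompactSupport fun s : ℝ => a !₂[s, t] := by
  refine ha.comp_isClosedEmbedding (Isometry.isClosedEmbedding (Isometry.of_dist_eq fun x y => ?_))
  rw [EuclideanSpace.dist_eq, Fin.sum_univ_two]
  simp [Real.sqrt_sq_eq_abs, Real.dist_eq]

theorem hasCompactSupport_plane_snd {a : E2 → ℝ} (ha : HasCompactSupport a) (s : ℝ) :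
    HasCompactSupport fun t : ℝ => a !₂[s, t] := by
  refine ha.comp_isClosedEmbedding (Isometry.isClosedEmbedding (Isometry.of_dist_eq fun x y => ?_))
  rw [EuclideanSpace.dist_eq, Fin.sum_univ_two]
  simp [Real.sqrt_sq_eq_abs, Real.dist_eq]

theorem setIntegral_halfPlane_eq (f : E2 → ℝ) :
    ∫ x in halfPlane, f x = ∫ z in Ioi (0 : ℝ) ×ˢ (univ : Set ℝ), f !₂[z.1, z.2] := by
  rw [← measurePreserving_planeEquiv.setIntegral_preimage_emb planeEquiv.measurableEmbedding f
    halfPlane]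
  have : planeEquiv ⁻¹' halfPlane = Ici (0 : ℝ) ×ˢ (univ : Set ℝ) := by
    ext z; simp [planeEquiv_apply, halfPlane]
  rw [this, Measure.volume_eq_prod]
  have hr : (volume.prod volume : Measure (ℝ × ℝ)).restrict (Ici (0 : ℝ) ×ˢ (univ : Set ℝ)) =
      (volume.prod volume : Measure (ℝ × ℝ)).restrict (Ioi (0 : ℝ) ×ˢ (univ : Set ℝ)) := by
    rw [← Measure.prod_restrict, ← Measure.prod_restrict, restrict_Ioi_eq_restrict_Ici]
  rw [hr]
  rfl

theorem ae_coord_ne_zero : ∀ᵐ x : E2, x 0 ≠ 0 := by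
  have h : MeasurePreserving planeEquiv := measurePreserving_planeEquiv
  rw [ae_iff, ← h.measure_preimage_emb planeEquiv.measurableEmbedding]
  have : planeEquiv ⁻¹' {x | ¬ x 0 ≠ 0} = {(0 : ℝ)} ×ˢ (univ : Set ℝ) := by
    ext z; simp [planeEquiv_apply]
  rw [this, Measure.volume_eq_prod, Measure.prod_prod]
  simp

/-- **Green's formula** on the half-plane, for compactly supported forms. -/
theorem green_halfPlane {a0 a1 : E2 → ℝ} (h0 : ContDiff ℝ 1 a0) (h1 : ContDiff ℝ 1 a1)
    (hc0 : HasCompactSupport a0) (hc1 : HasCompactSupport a1) :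
    ∫ x in halfPlane, (fderiv ℝ a1 x (EuclideanSpace.single 0 1)
      - fderiv ℝ a0 x (EuclideanSpace.single 1 1)) = -∫ t : ℝ, a1 !₂[0, t] := by
  have hint : ∀ {a : E2 → ℝ} (v : E2), ContDiff ℝ 1 a → HasCompactSupport a →
      Integrable fun z : ℝ × ℝ => fderiv ℝ a !₂[z.1, z.2] v := by
    intro a v ha hc
    have hI : Integrable fun x : E2 => fderiv ℝ a x v :=
      ((ha.continuous_fderiv one_ne_zero).clm_apply continuous_const).integrable_of_hasCompactSupport
        (hc.fderiv_apply ℝ v)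
    exact (measurePreserving_planeEquiv.integrable_comp_emb planeEquiv.measurableEmbedding).2 hI
  have e0 : ∫ z in Ioi (0 : ℝ) ×ˢ (univ : Set ℝ),
      fderiv ℝ a0 !₂[z.1, z.2] (EuclideanSpace.single 1 1) = 0 := by
    rw [Measure.volume_eq_prod, setIntegral_prod _ (hint _ h0 hc0).integrableOn]
    refine integral_eq_zero_of_ae (ae_of_all _ fun s => ?_)
    have hC : ContDiff ℝ 1 fun t : ℝ => a0 !₂[s, t] := h0.comp (contDiff_plane_snd s)
    have hd : ∀ t, HasDerivAt (fun t : ℝ => a0 !₂[s, t])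
        (fderiv ℝ a0 !₂[s, t] (EuclideanSpace.single 1 1)) t := fun t =>
      ((h0.differentiable one_ne_zero) _).hasFDerivAt.comp_hasDerivAt t (hasDerivAt_plane_snd s t)
    have hfun : (fun t => fderiv ℝ a0 !₂[s, t] (EuclideanSpace.single 1 1)) =
        deriv fun t : ℝ => a0 !₂[s, t] := funext fun t => (hd t).deriv.symm
    have hcs := hasCompactSupport_plane_snd hc0 s
    rw [Measure.restrict_univ]
    refine integral_eq_zero_of_hasDerivAt_of_integrable hd ?_
      (hC.continuous.integrable_of_hasCompactSupport hcs)
    rw [hfun]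
    exact (hC.continuous_deriv le_rfl).integrable_of_hasCompactSupport hcs.deriv
  have e1 : ∫ z in Ioi (0 : ℝ) ×ˢ (univ : Set ℝ),
      fderiv ℝ a1 !₂[z.1, z.2] (EuclideanSpace.single 0 1) = -∫ t : ℝ, a1 !₂[0, t] := by
    rw [Measure.volume_eq_prod, ← Measure.prod_restrict, integral_prod_symm, Measure.restrict_univ,
      ← integral_neg]
    · refine integral_congr_ae (ae_of_all _ fun t => ?_)
      have hC : ContDiff ℝ 1 fun s : ℝ => a1 !₂[s, t] := h1.comp (contDiff_plane_fst t)
      have hd : ∀ s, HasDerivAt (fun s : ℝ => a1 !₂[s, t])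
          (fderiv ℝ a1 !₂[s, t] (EuclideanSpace.single 0 1)) s := fun s =>
        ((h1.differentiable one_ne_zero) _).hasFDerivAt.comp_hasDerivAt s (hasDerivAt_plane_fst s t)
      have hfun : (fun s => fderiv ℝ a1 !₂[s, t] (EuclideanSpace.single 0 1)) =
          deriv fun s : ℝ => a1 !₂[s, t] := funext fun s => (hd s).deriv.symm
      have := (hasCompactSupport_plane_fst hc1 t).integral_Ioi_deriv_eq hC 0
      rw [← hfun] at this
      exact this
    · rw [Measure.prod_restrict]
      exact (hint _ h1 hc1).integrableOn
  rw [setIntegral_halfPlane_eq (fun x => fderiv ℝ a1 x (EuclideanSpace.single 0 1)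
      - fderiv ℝ a0 x (EuclideanSpace.single 1 1)),
    integral_sub (hint _ h1 hc1).integrableOn (hint _ h0 hc0).integrableOn, e0, e1, sub_zero]

namespace SurfacePatch

variable {S : Set E4} (P : SurfacePatch S)

/-- The exterior derivative of the pull-back of a 1-form, in coordinates. The second derivatives of
the parametrization cancel by symmetry. -/
theorem fderiv_pullback_sub {b : E4 → E4} (hb : ContDiff ℝ 1 b) {x : E2} (hx : x ∈ P.U)
    (e f : E2) :
    fderiv ℝ (fun y => ⟪b (P.φ y), fderiv ℝ P.φ y f⟫_ℝ) x e
      - fderiv ℝ (fun y => ⟪b (P.φ y), fderiv ℝ P.φ y e⟫_ℝ) x f =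
      ⟪fderiv ℝ b (P.φ x) (fderiv ℝ P.φ x e), fderiv ℝ P.φ x f⟫_ℝ
        - ⟪fderiv ℝ b (P.φ x) (fderiv ℝ P.φ x f), fderiv ℝ P.φ x e⟫_ℝ := by
  have hφ2 : ContDiffAt ℝ 2 P.φ x := P.contDiffOn.contDiffAt (P.isOpen_U.mem_nhds hx)
  have hsymm : IsSymmSndFDerivAt ℝ P.φ x := hφ2.isSymmSndFDerivAt (by simp)
  have hbφ : HasFDerivAt (fun y => b (P.φ y)) ((fderiv ℝ b (P.φ x)).comp (fderiv ℝ P.φ x)) x :=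
    ((hb.differentiable one_ne_zero) _).hasFDerivAt.comp x (P.hasFDerivAt hx)
  have hD : DifferentiableAt ℝ (fderiv ℝ P.φ) x :=
    (P.contDiffOn_fderiv.contDiffAt (P.isOpen_U.mem_nhds hx)).differentiableAt one_ne_zero
  have hDv : ∀ v : E2, HasFDerivAt (fun y => fderiv ℝ P.φ y v)
      ((fderiv ℝ (fderiv ℝ P.φ) x).flip v) x := fun v => by
    simpa using hD.hasFDerivAt.clm_apply (hasFDerivAt_const v x)
  have key : ∀ v w : E2, fderiv ℝ (fun y => ⟪b (P.φ y), fderiv ℝ P.φ y v⟫_ℝ) x w =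
      ⟪b (P.φ x), fderiv ℝ (fderiv ℝ P.φ) x w v⟫_ℝ +
        ⟪fderiv ℝ b (P.φ x) (fderiv ℝ P.φ x w), fderiv ℝ P.φ x v⟫_ℝ := by
    intro v w
    rw [fderiv_inner_apply ℝ hbφ.differentiableAt (hDv v).differentiableAt, hbφ.fderiv,
      (hDv v).fderiv]
    rfl
  rw [key, key, hsymm.eq e f]
  ring

/-- **Stokes' theorem** for a compactly supported 1-form in a patch. -/
theorem stokes_coord (hS : S ⊆ sphere3) (hcomp : IsCompact S) {b : E4 → E4} (hb : ContDiff ℝ 1 b)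
    (hbW : tsupport b ⊆ P.W) :
    ∫ x in P.U ∩ halfPlane, dualForm (fderiv ℝ b (P.φ x)) (P.φ x) (P.normal x) =
      -∫ t in {t : ℝ | !₂[0, t] ∈ P.U},
        ⟪b (P.φ !₂[0, t]), fderiv ℝ P.φ !₂[0, t] (EuclideanSpace.single 1 1)⟫_ℝ := by
  set K : Set E4 := S ∩ tsupport b
  have hKW : K ⊆ S ∩ P.W := inter_subset_inter_right _ hbW
  have hK : IsCompact K := hcomp.inter_right (isClosed_tsupport b)
  have hψK : IsCompact (P.ψ '' K) := hK.image_of_continuousOn (P.continuousOn_ψ.mono hKW)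
  have hψU : P.ψ '' K ⊆ P.U := by
    rintro _ ⟨q, hq, rfl⟩
    exact (P.ψ_mem (hKW hq)).1.1
  obtain ⟨κ, hκ0, hκ1, -⟩ := exists_contMDiffMap_zero_one_nhds_of_isClosed (n := 1)
    (modelWithCornersSelf ℝ E2) P.isOpen_U.isClosed_compl hψK.isClosed
    (disjoint_compl_left_iff_subset.2 hψU)
  have hκ : ContDiff ℝ 1 κ := κ.contMDiff.contDiff
  have hκ1' : ∀ x ∈ P.U ∩ halfPlane, b (P.φ x) ≠ 0 → κ x = 1 := by
    intro x hx hbx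
    refine hκ1.self_of_nhdsSet x ⟨P.φ x, ⟨(P.φ_mem hx).1, subset_tsupport _ hbx⟩, P.left_inv x hx⟩
  have hκ0' : ∀ x ∉ P.U, ∀ᶠ y in 𝓝 x, κ y = 0 := fun x hx => hκ0.filter_mono (nhds_le_nhdsSet hx)
  set a : E2 → E2 → ℝ := fun v x => κ x * ⟪b (P.φ x), fderiv ℝ P.φ x v⟫_ℝ with ha
  have haC : ∀ v, ContDiff ℝ 1 (a v) := by
    intro v
    rw [contDiff_iff_contDiffAt]
    intro x
    by_cases hx : x ∈ P.U
    · have hU := P.isOpen_U.mem_nhds hx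
      refine hκ.contDiffAt.mul (ContDiffAt.inner ℝ (hb.contDiffAt.comp x
        ((P.contDiffOn.contDiffAt hU).of_le (by norm_num))) ?_)
      exact (P.contDiffOn_fderiv.contDiffAt hU).clm_apply contDiffAt_const
    · refine (contDiffAt_const (c := (0 : ℝ))).congr_of_eventuallyEq ?_
      filter_upwards [hκ0' x hx] with y hy
      simp [ha, hy]
  have haS : ∀ v, HasCompactSupport (a v) := by
    intro v
    refine HasCompactSupport.intro P.isBounded_U.isCompact_closure fun x hx => ?_
    simp [ha, (hκ0' x fun h => hx (subset_closure h)).self_of_nhds]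
  have haU : ∀ v, ∀ x ∈ P.U ∩ halfPlane, a v x = ⟪b (P.φ x), fderiv ℝ P.φ x v⟫_ℝ := by
    intro v x hx
    by_cases hbx : b (P.φ x) = 0
    · simp [ha, hbx]
    · simp [ha, hκ1' x hx hbx]
  have haU0 : ∀ v, ∀ x ∉ P.U, a v x = 0 := fun v x hx => by
    simp [ha, (hκ0' x hx).self_of_nhds]
  have hgreen := green_halfPlane (haC (EuclideanSpace.single 0 1)) (haC (EuclideanSpace.single 1 1))
    (haS _) (haS _)
  have hL : ∫ x in P.U ∩ halfPlane, dualForm (fderiv ℝ b (P.φ x)) (P.φ x) (P.normal x) =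
      ∫ x in halfPlane, (fderiv ℝ (a (EuclideanSpace.single 1 1)) x (EuclideanSpace.single 0 1)
      - fderiv ℝ (a (EuclideanSpace.single 0 1)) x (EuclideanSpace.single 1 1)) := by
    rw [inter_comm, ← setIntegral_indicator P.isOpen_U.measurableSet]
    refine setIntegral_congr_ae measurableSet_halfPlane ?_
    filter_upwards [ae_coord_ne_zero] with x hx0 hxH
    have hpos : 0 < x 0 := lt_of_le_of_ne hxH (Ne.symm hx0)
    by_cases hx : x ∈ P.U
    · rw [indicator_of_mem hx]
      have hev : ∀ v, a v =ᶠ[𝓝 x] fun y => ⟪b (P.φ y), fderiv ℝ P.φ y v⟫_ℝ := by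
        intro v
        have hopen : IsOpen (P.U ∩ {y : E2 | 0 < y 0}) :=
          P.isOpen_U.inter (isOpen_lt continuous_const (PiLp.continuous_apply 2 _ 0))
        filter_upwards [hopen.mem_nhds ⟨hx, hpos⟩] with y hy
        exact haU v y ⟨hy.1, (mem_ofPred.1 hy.2).le⟩
      rw [(hev _).fderiv_eq, (hev _).fderiv_eq, P.fderiv_pullback_sub hb hx]
      exact (inner_sub_inner_eq_dualForm _ (P.norm_φ hS ⟨hx, hxH⟩)
        (P.inner_fderiv_self hS ⟨hx, hxH⟩ _) (P.inner_fderiv_self hS ⟨hx, hxH⟩ _)).symm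
    · rw [indicator_of_notMem hx]
      have hev : ∀ v, a v =ᶠ[𝓝 x] fun _ => (0 : ℝ) := by
        intro v
        filter_upwards [hκ0' x hx] with y hy
        simp [ha, hy]
      rw [(hev _).fderiv_eq, (hev _).fderiv_eq]
      simp
  have hR : ∫ t in {t : ℝ | !₂[0, t] ∈ P.U},
      ⟪b (P.φ !₂[0, t]), fderiv ℝ P.φ !₂[0, t] (EuclideanSpace.single 1 1)⟫_ℝ =
      ∫ t : ℝ, a (EuclideanSpace.single 1 1) !₂[0, t] := by
    have hm : MeasurableSet {t : ℝ | (!₂[0, t] : E2) ∈ P.U} :=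
      (P.isOpen_U.preimage (contDiff_plane_snd 0).continuous).measurableSet
    rw [← integral_indicator hm]
    congr 1
    funext t
    by_cases ht : (!₂[0, t] : E2) ∈ P.U
    · rw [indicator_of_mem (show t ∈ {t : ℝ | (!₂[0, t] : E2) ∈ P.U} from ht),
        haU _ _ ⟨ht, by simp [halfPlane]⟩]
    · rw [indicator_of_notMem (show t ∉ {t : ℝ | (!₂[0, t] : E2) ∈ P.U} from ht), haU0 _ _ ht]
  rw [hL, hR, hgreen]

/-- The integral over the surface of a function vanishing outside a patch. -/
theorem setIntegral_eq (hS : S ⊆ sphere3) (hSm : MeasurableSet S) {g : E4 → ℝ}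
    (hg : ∀ p ∈ S, p ∉ P.W → g p = 0) :
    ∫ p in S, g p ∂(μHE[2] : Measure E4) = ∫ x in P.U ∩ halfPlane, ‖P.normal x‖ * g (P.φ x) := by
  have h1 : ∫ p in S, g p ∂(μHE[2] : Measure E4) =
      ∫ p in S ∩ P.W, g p ∂(μHE[2] : Measure E4) := by
    refine (setIntegral_eq_of_subset_of_forall_sdiff_eq_zero hSm inter_subset_left ?_)
    exact fun p hp => hg p hp.1 fun h => hp.2 ⟨hp.1, h⟩
  rw [h1, ← P.image_eq]
  have := integral_image_eq_integral_normDet_mul (f := P.φ) (f' := fderiv ℝ P.φ)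
    P.measurableSet_domain (fun x hx => P.hasStrictFDerivAt hx.1)
    (P.continuousOn_fderiv.mono inter_subset_left) (fun x hx => P.injective x hx.1) P.injOn g
  rw [finrank_euclideanSpace_fin] at this
  rw [this]
  exact setIntegral_congr_fun P.measurableSet_domain fun x hx => by simp only [P.normDet_eq hS hx]

/-- **Stokes' theorem** in a patch on which the unit normal `N` has sign `s`. -/
theorem stokes (hS : S ⊆ sphere3) (hcomp : IsCompact S) {N : E4 → E4} {s : ℝ}
    (hs : s = 1 ∨ s = -1)
    (hsN : ∀ x ∈ P.U ∩ halfPlane, P.normal x = (s * ‖P.normal x‖) • N (P.φ x))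
    {b : E4 → E4} (hb : ContDiff ℝ 1 b) (hbW : tsupport b ⊆ P.W) :
    ∫ p in S, dualForm (fderiv ℝ b p) p (N p) ∂(μHE[2] : Measure E4) =
      -(s * ∫ t in {t : ℝ | !₂[0, t] ∈ P.U},
        ⟪b (P.φ !₂[0, t]), fderiv ℝ P.φ !₂[0, t] (EuclideanSpace.single 1 1)⟫_ℝ) := by
  have hss : s * s = 1 := by rcases hs with rfl | rfl <;> norm_num
  rw [P.setIntegral_eq hS hcomp.measurableSet, ← mul_neg, ← P.stokes_coord hS hcomp hb hbW,
    ← integral_const_mul]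
  · refine setIntegral_congr_fun P.measurableSet_domain fun x hx => ?_
    conv_rhs => rw [hsN x hx, dualForm_smul]
    linear_combination (-‖P.normal x‖ * dualForm (fderiv ℝ b (P.φ x)) (P.φ x) (N (P.φ x))) * hss
  · intro p _ hp
    have : fderiv ℝ b p = 0 := by
      by_contra h
      exact hp (hbW (support_fderiv_subset ℝ h))
    rw [this, dualForm_zero]

end SurfacePatch

/-! ### The boundary circle -/

/-- The parametrization of `C₀` by the angle. -/
def circleMapC0 (θ : ℝ) : E4 := !₂[0, 0, Real.cos θ, Real.sin θ]

theorem hasDerivAt_circleMapC0 (θ : ℝ) :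
    HasDerivAt circleMapC0 (hopf (circleMapC0 θ)) θ := by
  have h : circleMapC0 = fun θ =>
      Real.cos θ • EuclideanSpace.single 2 1 + Real.sin θ • EuclideanSpace.single 3 1 := by
    funext θ
    apply E4_ext <;> simp [circleMapC0]
  have h' : hopf (circleMapC0 θ) =
      -Real.sin θ • EuclideanSpace.single 2 1 + Real.cos θ • EuclideanSpace.single 3 1 := by
    apply E4_ext <;> simp [circleMapC0, hopf]
  rw [h', h]
  exact ((Real.hasDerivAt_cos θ).smul_const _).fun_add ((Real.hasDerivAt_sin θ).smul_const _)

theorem contDiff_circleMapC0 : ContDiff ℝ 1 circleMapC0 := by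
  rw [contDiff_euclidean]
  intro i
  fin_cases i
  · exact contDiff_const
  · exact contDiff_const
  · exact Real.contDiff_cos
  · exact Real.contDiff_sin

theorem mem_circleC0_iff {p : E4} :
    p ∈ circleC0 ↔ p 0 = 0 ∧ p 1 = 0 ∧ p 2 ^ 2 + p 3 ^ 2 = 1 := by
  have h : p ∈ sphere3 ↔ p 0 ^ 2 + p 1 ^ 2 + p 2 ^ 2 + p 3 ^ 2 = 1 := by
    rw [← norm_sq_E4, sphere3, mem_sphere_zero_iff_norm]
    constructor
    · intro h; rw [h]; norm_num
    · intro h; nlinarith [norm_nonneg p]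
  rw [circleC0, mem_ofPred, h]
  constructor
  · rintro ⟨h1, h2, h3⟩
    exact ⟨h2, h3, by simpa [h2, h3] using h1⟩
  · rintro ⟨h2, h3, h1⟩
    exact ⟨by simpa [h2, h3] using h1, h2, h3⟩

theorem circleMapC0_mem (θ : ℝ) : circleMapC0 θ ∈ circleC0 := by
  rw [mem_circleC0_iff]
  simp [circleMapC0]

theorem image_circleMapC0 : circleMapC0 '' Ioc (-Real.pi) Real.pi = circleC0 := by
  refine Subset.antisymm (image_subset_iff.2 fun θ _ => circleMapC0_mem θ) fun p hp => ?_
  obtain ⟨h0, h1, h2⟩ := mem_circleC0_iff.1 hp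
  set z : ℂ := ⟨p 2, p 3⟩ with hz
  have hnorm : ‖z‖ = 1 := by
    have : ‖z‖ ^ 2 = 1 := by rw [← Complex.normSq_eq_norm_sq, Complex.normSq_mk, ← h2]; ring
    nlinarith [norm_nonneg z]
  have hz0 : z ≠ 0 := norm_pos_iff.1 (by rw [hnorm]; norm_num)
  refine ⟨z.arg, Complex.arg_mem_Ioc z, ?_⟩
  apply E4_ext
  · simp [circleMapC0, h0]
  · simp [circleMapC0, h1]
  · change Real.cos z.arg = z.re
    rw [Complex.cos_arg hz0, hnorm, div_one]
  · change Real.sin z.arg = z.im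
    rw [Complex.sin_arg, hnorm, div_one]

theorem injOn_circleMapC0 : InjOn circleMapC0 (Ioc (-Real.pi) Real.pi) := by
  intro θ hθ η hη h
  have hc : Real.cos θ = Real.cos η := congrArg (fun p : E4 => p 2) h
  have hs : Real.sin θ = Real.sin η := congrArg (fun p : E4 => p 3) h
  have : Complex.exp (θ * Complex.I) = Complex.exp (η * Complex.I) := by
    apply Complex.ext
    · simpa [Complex.exp_ofReal_mul_I_re] using hc
    · simpa [Complex.exp_ofReal_mul_I_im] using hs
  rw [← Complex.arg_exp_mul_I θ |>.trans (toIocMod_eq_self _ |>.2 ⟨hθ.1, by linarith [hθ.2]⟩),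
    this, Complex.arg_exp_mul_I η |>.trans (toIocMod_eq_self _ |>.2 ⟨hη.1, by linarith [hη.2]⟩)]

theorem isPreconnected_circleC0 : IsPreconnected circleC0 := by
  rw [← image_circleMapC0]
  exact isPreconnected_Ioc.image _ contDiff_circleMapC0.continuous.continuousOn

theorem norm_hopf (p : E4) : ‖hopf p‖ = ‖p‖ := by
  rw [← sq_eq_sq₀ (norm_nonneg _) (norm_nonneg _), norm_sq_E4, norm_sq_E4]
  simp only [hopf_apply]
  ring

theorem normDet_toSpanSingleton {V : Type*} [NormedAddCommGroup V] [InnerProductSpace ℝ V] (v : V) :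
    (ContinuousLinearMap.toSpanSingleton ℝ v).toLinearMap.normDet = ‖v‖ := by
  have h := (ContinuousLinearMap.toSpanSingleton ℝ v).toLinearMap.normDet_sq_eq_det_gram
    (OrthonormalBasis.singleton (Fin 1) ℝ)
  rw [Matrix.det_unique] at h
  simp only [RCLike.ofReal_real_eq_id, id_eq, Matrix.gram_apply,
    OrthonormalBasis.singleton_apply, ContinuousLinearMap.coe_coe,
    ContinuousLinearMap.toSpanSingleton_apply, one_smul, real_inner_self_eq_norm_sq] at h
  exact (sq_eq_sq₀ (LinearMap.normDet_nonneg _) (norm_nonneg _)).1 h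

/-- Change of variables for curves: the length measure of the image. -/
theorem integral_image_curve {γ γ' : ℝ → E4} {I : Set ℝ} (hI : MeasurableSet I)
    (hγ : ∀ t ∈ I, HasStrictDerivAt γ (γ' t) t) (hcont : ContinuousOn γ' I)
    (h0 : ∀ t ∈ I, γ' t ≠ 0) (hinj : InjOn γ I) (g : E4 → ℝ) :
    ∫ p in γ '' I, g p ∂(μHE[1] : Measure E4) = ∫ t in I, ‖γ' t‖ * g (γ t) := by
  have h := integral_image_eq_integral_normDet_mul (f := γ)
    (f' := fun t => ContinuousLinearMap.toSpanSingleton ℝ (γ' t)) hI (fun t ht => hγ t ht)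
    ((ContinuousLinearMap.toSpanSingletonCLE (𝕜 := ℝ) (E := E4)).continuous.comp_continuousOn hcont)
    (fun t ht => ?_) hinj g
  · rw [finrank_self] at h
    simpa only [normDet_toSpanSingleton] using h
  · intro a b hab
    exact smul_left_injective ℝ (h0 t ht) (by simpa using hab)

theorem integral_circleC0 (g : E4 → ℝ) : ∫ p in circleC0, g p ∂(μHE[1] : Measure E4) =
    ∫ θ in Ioc (-Real.pi) Real.pi, g (circleMapC0 θ) := by
  have hn : ∀ θ, ‖hopf (circleMapC0 θ)‖ = 1 := fun θ => by
    rw [norm_hopf]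
    simpa [sphere3] using (circleMapC0_mem θ).1
  have hd : deriv circleMapC0 = fun θ => hopf (circleMapC0 θ) :=
    funext fun θ => (hasDerivAt_circleMapC0 θ).deriv
  rw [← image_circleMapC0, integral_image_curve (γ' := fun θ => hopf (circleMapC0 θ))
    measurableSet_Ioc _ _ _ injOn_circleMapC0]
  · simp only [hn, one_mul]
  · intro θ _
    have := contDiff_circleMapC0.contDiffAt.hasStrictDerivAt one_ne_zero (x := θ)
    rwa [hd] at this
  · rw [← hd]
    exact (contDiff_circleMapC0.continuous_deriv le_rfl).continuousOn
  · intro θ _ h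
    simpa [h] using hn θ

/-- In the tangent plane orthogonal to the boundary circle, the Hopf rotation of `(z₁, 0)`. -/
def rotate (u : E4) : E4 := !₂[-u 1, u 0, 0, 0]

theorem cross_hopf_eq {p u : E4} (hp : p ∈ circleC0) (h1 : ⟪u, p⟫_ℝ = 0)
    (h2 : ⟪u, hopf p⟫_ℝ = 0) : cross p u (hopf p) = -rotate u ∧ u 2 = 0 ∧ u 3 = 0 := by
  obtain ⟨p0, p1, p2⟩ := mem_circleC0_iff.1 hp
  rw [inner_E4] at h1 h2
  simp only [hopf_apply, p0, p1] at h1 h2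
  have u2 : u 2 = 0 := by linear_combination p 2 * h1 - p 3 * h2 - u 2 * p2
  have u3 : u 3 = 0 := by linear_combination p 3 * h1 + p 2 * h2 - u 3 * p2
  refine ⟨?_, u2, u3⟩
  apply E4_ext <;>
    simp only [PiLp.neg_apply, cross_zero, cross_one, cross_two, cross_three, hopf_apply, p0, p1,
      u2, u3, rotate, Matrix.cons_val_zero, Matrix.cons_val_one, Matrix.cons_val]
  · linear_combination u 1 * p2
  · linear_combination -u 0 * p2
  · ring
  · ring

theorem norm_rotate {u : E4} (h2 : u 2 = 0) (h3 : u 3 = 0) : ‖rotate u‖ = ‖u‖ := by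
  rw [← sq_eq_sq₀ (norm_nonneg _) (norm_nonneg _), norm_sq_E4, norm_sq_E4]
  simp [rotate, h2, h3]
  ring

namespace SurfacePatch

variable {S : Set E4} (P : SurfacePatch S)

/-- The parameters of the boundary points in a patch. -/
def boundaryDomain : Set ℝ := {t : ℝ | !₂[0, t] ∈ P.U}

/-- The velocity of the boundary curve of a patch. -/
def boundaryVelocity (t : ℝ) : E4 := fderiv ℝ P.φ !₂[0, t] (EuclideanSpace.single 1 1)

theorem isOpen_boundaryDomain : IsOpen P.boundaryDomain :=
  P.isOpen_U.preimage (contDiff_plane_snd 0).continuous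

theorem mem_domain_of_boundary {t : ℝ} (ht : t ∈ P.boundaryDomain) :
    (!₂[0, t] : E2) ∈ P.U ∩ halfPlane := ⟨ht, by simp [halfPlane]⟩

theorem ordConnected_boundaryDomain : P.boundaryDomain.OrdConnected := by
  rw [← convex_iff_ordConnected]
  intro s hs t ht a b ha hb hab
  have := P.convex_U hs ht ha hb hab
  have h2 : a • (!₂[0, s] : E2) + b • !₂[0, t] = !₂[0, a • s + b • t] := by
    ext i; fin_cases i <;> simp
  rwa [h2] at this

theorem hasStrictDerivAt_boundary {t : ℝ} (ht : t ∈ P.boundaryDomain) :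
    HasStrictDerivAt (fun t : ℝ => P.φ !₂[0, t]) (P.boundaryVelocity t) t := by
  have h1 : HasStrictDerivAt (fun t : ℝ => (!₂[0, t] : E2)) (EuclideanSpace.single 1 1) t := by
    have := (contDiff_plane_snd 0).contDiffAt.hasStrictDerivAt one_ne_zero (x := t)
    rwa [(hasDerivAt_plane_snd 0 t).deriv] at this
  exact (P.hasStrictFDerivAt ht).comp_hasStrictDerivAt t h1

theorem continuousOn_boundaryVelocity : ContinuousOn P.boundaryVelocity P.boundaryDomain :=
  (P.continuousOn_fderiv.clm_apply continuousOn_const).comp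
    (contDiff_plane_snd 0).continuous.continuousOn fun _ ht => ht

theorem boundaryVelocity_ne_zero {t : ℝ} (ht : t ∈ P.boundaryDomain) :
    P.boundaryVelocity t ≠ 0 := fun h => by
  have := P.injective _ ht (h.trans (map_zero _).symm)
  simpa using congrArg (fun v : E2 => v 1) this

theorem injOn_boundary : InjOn (fun t : ℝ => P.φ !₂[0, t]) P.boundaryDomain := by
  intro s hs t ht h
  have := P.injOn (P.mem_domain_of_boundary hs) (P.mem_domain_of_boundary ht) h
  simpa using congrArg (fun v : E2 => v 1) this

variable (hbdry : surfaceBoundary S = circleC0)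
include hbdry

theorem boundary_mem {t : ℝ} (ht : t ∈ P.boundaryDomain) : P.φ !₂[0, t] ∈ circleC0 :=
  hbdry ▸ P.φ_mem_boundary ht rfl

theorem image_boundary :
    (fun t : ℝ => P.φ !₂[0, t]) '' P.boundaryDomain = circleC0 ∩ P.W := by
  ext p
  constructor
  · rintro ⟨t, ht, rfl⟩
    exact ⟨P.boundary_mem hbdry ht, (P.φ_mem (P.mem_domain_of_boundary ht)).2⟩
  · rintro ⟨hp, hW⟩
    rw [← hbdry] at hp
    obtain ⟨x, hx, rfl⟩ := P.exists_φ_eq ⟨hp.1, hW⟩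
    obtain ⟨Q, z, hz, hzx, hz0⟩ := exists_boundaryPatch hp.2
    have hx0 : x 0 = 0 := by
      by_contra h
      exact P.coord_ne_zero Q hx.1 (lt_of_le_of_ne hx.2 (Ne.symm h)) hz hzx hz0
    have hxe : x = !₂[0, x 1] := by ext i; fin_cases i <;> simp [hx0]
    exact ⟨x 1, by rw [boundaryDomain, mem_ofPred, ← hxe]; exact hx.1, by simp only; rw [← hxe]⟩

/-- The boundary curve moves along the Hopf field. -/
theorem boundaryVelocity_eq {t : ℝ} (ht : t ∈ P.boundaryDomain) : P.boundaryVelocity t =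
    ⟪P.boundaryVelocity t, hopf (P.φ !₂[0, t])⟫_ℝ • hopf (P.φ !₂[0, t]) := by
  have hd := (P.hasStrictDerivAt_boundary ht).hasDerivAt
  have hcoord : ∀ i : Fin 4, HasDerivAt (fun t : ℝ => P.φ !₂[0, t] i) (P.boundaryVelocity t i) t :=
    fun i => (EuclideanSpace.proj i : E4 →L[ℝ] ℝ).hasFDerivAt.comp_hasDerivAt t hd
  have hmem : ∀ᶠ s in 𝓝 t, P.φ !₂[0, s] ∈ circleC0 := by
    filter_upwards [P.isOpen_boundaryDomain.mem_nhds ht] with s hs using P.boundary_mem hbdry hs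
  have v0 : P.boundaryVelocity t 0 = 0 := by
    refine (hcoord 0).unique ((hasDerivAt_const t (0 : ℝ)).congr_of_eventuallyEq ?_)
    filter_upwards [hmem] with s hs using (mem_circleC0_iff.1 hs).1
  have v1 : P.boundaryVelocity t 1 = 0 := by
    refine (hcoord 1).unique ((hasDerivAt_const t (0 : ℝ)).congr_of_eventuallyEq ?_)
    filter_upwards [hmem] with s hs using (mem_circleC0_iff.1 hs).2.1
  have v2 : 2 * P.φ !₂[0, t] 2 * P.boundaryVelocity t 2 +
      2 * P.φ !₂[0, t] 3 * P.boundaryVelocity t 3 = 0 := by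
    have h := ((hcoord 2).pow 2).add ((hcoord 3).pow 2)
    have h' := h.unique ((hasDerivAt_const t (1 : ℝ)).congr_of_eventuallyEq (by
      filter_upwards [hmem] with s hs using (mem_circleC0_iff.1 hs).2.2))
    simpa using h'
  obtain ⟨p0, p1, p2⟩ := mem_circleC0_iff.1 (P.boundary_mem hbdry ht)
  set p := P.φ !₂[0, t]
  set v := P.boundaryVelocity t
  rw [inner_E4]
  apply E4_ext <;> simp only [PiLp.smul_apply, smul_eq_mul, hopf_apply, p0, p1, v0, v1]
  · ring
  · ring
  · linear_combination p 2 / 2 * v2 - v 2 * p2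
  · linear_combination p 3 / 2 * v2 - v 3 * p2

/-- Comparison of the sign `s` of a unit normal in a patch with the direction of the boundary curve
and with the inward vector `u`. -/
theorem boundary_sign (hS : S ⊆ sphere3) {N : E4 → E4} (hN' : ∀ p ∈ S, N p ∈ unitNormals S p)
    {s : ℝ} (hs : s = 1 ∨ s = -1)
    (hsN : ∀ x ∈ P.U ∩ halfPlane, P.normal x = (s * ‖P.normal x‖) • N (P.φ x))
    {t : ℝ} (ht : t ∈ P.boundaryDomain) {u : E4} (hu1 : ‖u‖ = 1)
    (hup : ⟪u, P.φ !₂[0, t]⟫_ℝ = 0) (huT : ⟪u, hopf (P.φ !₂[0, t])⟫_ℝ = 0)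
    (hseg : ∃ δ > 0, ∀ r ∈ Ico (0 : ℝ) δ, Real.cos r • P.φ !₂[0, t] + Real.sin r • u ∈ S) :
    |⟪N (P.φ !₂[0, t]), rotate u⟫_ℝ| = 1 ∧
    -(s * ⟪P.boundaryVelocity t, hopf (P.φ !₂[0, t])⟫_ℝ) =
      ⟪N (P.φ !₂[0, t]), rotate u⟫_ℝ * ‖P.boundaryVelocity t‖ := by
  set x : E2 := !₂[0, t] with hxdef
  have hx : x ∈ P.U ∩ halfPlane := P.mem_domain_of_boundary ht
  have hpC := P.boundary_mem hbdry ht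
  have hpn : ‖P.φ x‖ = 1 := P.norm_φ hS hx
  obtain ⟨δ, hδ, hδS⟩ := hseg
  have hcurve : HasDerivAt (fun r : ℝ => Real.cos r • P.φ x + Real.sin r • u) u 0 := by
    simpa using ((Real.hasDerivAt_cos 0).smul_const (P.φ x)).fun_add
      ((Real.hasDerivAt_sin 0).smul_const u)
  obtain ⟨ξ, hξ, hξ0⟩ := P.exists_fderiv_eq_of_curve hx (by simp) hcurve.hasDerivWithinAt (by
    filter_upwards [Ioo_mem_nhdsGT hδ] with r hr using hδS r ⟨hr.1.le, hr.2⟩)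
  have hξ0 : 0 ≤ ξ 0 := hξ0 (by simp [hxdef])
  have hue : u = ξ 0 • fderiv ℝ P.φ x (EuclideanSpace.single 0 1) +
      ξ 1 • fderiv ℝ P.φ x (EuclideanSpace.single 1 1) := by
    rw [← hξ, ← map_smul, ← map_smul, ← map_add]
    congr 1
    ext i; fin_cases i <;> simp
  set τ : ℝ := ⟪P.boundaryVelocity t, hopf (P.φ x)⟫_ℝ with hτ
  have hvel : fderiv ℝ P.φ x (EuclideanSpace.single 1 1) = τ • hopf (P.φ x) :=
    P.boundaryVelocity_eq hbdry ht
  have hτn : ‖P.boundaryVelocity t‖ = |τ| := by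
    rw [P.boundaryVelocity_eq hbdry ht, norm_smul, norm_hopf]
    change |τ| * ‖P.φ x‖ = |τ|
    rw [hpn, mul_one]
  have hτ0 : τ ≠ 0 := fun h => P.boundaryVelocity_ne_zero ht (by
    rw [P.boundaryVelocity_eq hbdry ht]
    change τ • hopf (P.φ x) = 0
    rw [h, zero_smul])
  obtain ⟨hcr, u2, u3⟩ := cross_hopf_eq hpC hup huT
  have hcross : τ • (-rotate u) = (ξ 0 * (s * ‖P.normal x‖)) • N (P.φ x) := by
    rw [← hcr, ← cross_smul_right, ← hvel, mul_smul, ← hsN x hx]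
    conv_lhs => rw [hue, cross_smul_add_mid]
    rfl
  have hNn : ‖N (P.φ x)‖ = 1 := (hN' _ (P.φ_mem hx).1).1
  have hRn : ‖rotate u‖ = 1 := by rw [norm_rotate u2 u3, hu1]
  have hpos := P.norm_normal_pos hS hx
  -- compare lengths and then the components along `rotate u` and `N`
  have e1 : |τ| = ξ 0 * ‖P.normal x‖ := by
    have := congrArg norm hcross
    rw [norm_smul, norm_neg, hRn, mul_one, norm_smul, hNn, mul_one, Real.norm_eq_abs,
      Real.norm_eq_abs, abs_mul, abs_mul, abs_of_nonneg hξ0, abs_of_pos hpos] at this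
    rcases hs with rfl | rfl <;> simpa using this
  have e2 : -τ = |τ| * s * ⟪N (P.φ x), rotate u⟫_ℝ := by
    have := congrArg (fun v => ⟪v, rotate u⟫_ℝ) hcross
    simp only [inner_smul_left, inner_neg_left, real_inner_self_eq_norm_sq, hRn] at this
    simp only [conj_trivial] at this
    rw [e1]
    linear_combination this
  have hss : s * s = 1 := by rcases hs with rfl | rfl <;> norm_num
  have e3 : -(s * τ) = ⟪N (P.φ x), rotate u⟫_ℝ * |τ| := by
    linear_combination s * e2 + (|τ| * ⟪N (P.φ x), rotate u⟫_ℝ) * hss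
  refine ⟨?_, by rw [hτn]; exact e3⟩
  have e4 := congrArg abs e3
  rw [abs_neg, abs_mul, abs_mul, abs_abs] at e4
  have hs1 : |s| = 1 := by rcases hs with rfl | rfl <;> simp
  rw [hs1, one_mul] at e4
  have h5 : |τ| ≠ 0 := abs_ne_zero.2 hτ0
  exact mul_right_cancel₀ h5 (by rw [one_mul]; exact e4.symm)

end SurfacePatch

/-! ### Stokes' theorem on the surface -/

theorem continuous_hopf : Continuous hopf := by
  refine (PiLp.continuous_toLp 2 _).comp (continuous_pi fun i => ?_)
  fin_cases i
  · exact (PiLp.continuous_apply 2 _ 1).neg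
  · exact PiLp.continuous_apply 2 _ 0
  · exact (PiLp.continuous_apply 2 _ 3).neg
  · exact PiLp.continuous_apply 2 _ 2

theorem continuous_dualForm :
    Continuous fun x : (E4 →L[ℝ] E4) × E4 × E4 => dualForm x.1 x.2.1 x.2.2 := by
  have hD : ∀ (v : E4) (i : Fin 4), Continuous fun x : (E4 →L[ℝ] E4) × E4 × E4 => x.1 v i :=
    fun v i => (PiLp.continuous_apply 2 _ i).comp (continuous_fst.clm_apply continuous_const)
  have hp : ∀ i : Fin 4, Continuous fun x : (E4 →L[ℝ] E4) × E4 × E4 => x.2.1 i :=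
    fun i => (PiLp.continuous_apply 2 _ i).comp (continuous_fst.comp continuous_snd)
  have hn : ∀ i : Fin 4, Continuous fun x : (E4 →L[ℝ] E4) × E4 × E4 => x.2.2 i :=
    fun i => (PiLp.continuous_apply 2 _ i).comp (continuous_snd.comp continuous_snd)
  unfold dualForm
  fun_prop

theorem dualForm_sum {ι : Type*} (s : Finset ι) (D : ι → E4 →L[ℝ] E4) (p n : E4) :
    dualForm (∑ i ∈ s, D i) p n = ∑ i ∈ s, dualForm (D i) p n := by
  classical
  induction s using Finset.induction_on with
  | empty => simp [dualForm_zero]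
  | insert a s ha ih => rw [Finset.sum_insert ha, Finset.sum_insert ha, dualForm_add, ih]

theorem exists_finite_patches {S : Set E4} (hsurf : IsC2Surface S) (hcomp : IsCompact S) :
    ∃ (n : ℕ) (P : Fin n → SurfacePatch S), S ⊆ ⋃ i, (P i).W := by
  choose P hP using fun p : S => exists_surfacePatch hsurf p.2
  obtain ⟨t, ht⟩ := hcomp.elim_finite_subcover (fun p : S => (P p).W)
    (fun p => (P p).isOpen_W) fun p hp => mem_iUnion.2 ⟨⟨p, hp⟩, hP ⟨p, hp⟩⟩
  refine ⟨t.card, fun i => P (t.equivFin.symm i : S), fun p hp => ?_⟩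
  obtain ⟨q, hq, hpq⟩ := mem_iUnion₂.1 (ht hp)
  refine mem_iUnion.2 ⟨t.equivFin ⟨q, hq⟩, ?_⟩
  simpa using hpq

theorem measure_surface_lt_top {S : Set E4} (hsurf : IsC2Surface S) (hcomp : IsCompact S) :
    (μHE[2] : Measure E4) S < ∞ := by
  obtain ⟨n, P, hP⟩ := exists_finite_patches hsurf hcomp
  calc (μHE[2] : Measure E4) S ≤ (μHE[2] : Measure E4) (⋃ i, S ∩ (P i).W) := by
        rw [← inter_iUnion]
        exact measure_mono (subset_inter Subset.rfl hP)
    _ ≤ ∑ i, (μHE[2] : Measure E4) (S ∩ (P i).W) := measure_iUnion_fintype_le _ _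
    _ < ∞ := ENNReal.sum_lt_top.2 fun i _ => (P i).measure_lt_top

theorem integrableOn_surface {S : Set E4} (hsurf : IsC2Surface S) (hcomp : IsCompact S)
    {f : E4 → ℝ} (hf : ContinuousOn f S) : IntegrableOn f S (μHE[2] : Measure E4) := by
  obtain ⟨C, hC⟩ := hcomp.exists_bound_of_continuousOn hf
  have : IsFiniteMeasure ((μHE[2] : Measure E4).restrict S) :=
    isFiniteMeasure_restrict.2 (measure_surface_lt_top hsurf hcomp).ne
  exact Integrable.of_bound (hf.aestronglyMeasurable_of_isCompact hcomp hcomp.measurableSet) C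
    (ae_restrict_of_forall_mem hcomp.measurableSet hC)

section Stokes

variable {S : Set E4} (hsurf : IsC2Surface S) (hcomp : IsCompact S)
  (hbdry : surfaceBoundary S = circleC0) (hseg : ContainsOrthogonalSegments S)
  {N : E4 → E4} (hN : ContinuousOn N S) (hN' : ∀ p ∈ S, N p ∈ unitNormals S p)

include hbdry in
theorem circleC0_subset : circleC0 ⊆ S := fun _ hp => (hbdry.symm ▸ hp : _ ∈ surfaceBoundary S).1

include hsurf hbdry hseg hN hN' in
/-- The unit normal induces one and the same orientation along the whole boundary circle. -/
theorem exists_boundary_orientation : ∃ ε : ℝ, (ε = 1 ∨ ε = -1) ∧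
    ∀ (P : SurfacePatch S) (s : ℝ), (s = 1 ∨ s = -1) →
      (∀ x ∈ P.U ∩ halfPlane, P.normal x = (s * ‖P.normal x‖) • N (P.φ x)) →
      ∀ t ∈ P.boundaryDomain, -(s * ⟪P.boundaryVelocity t, hopf (P.φ !₂[0, t])⟫_ℝ) =
        ε * ‖P.boundaryVelocity t‖ := by
  choose! u hu1 hup huT hu using hseg
  set e : E4 → ℝ := fun p => ⟪N p, rotate (u p)⟫_ℝ with he
  have hsign : ∀ (P : SurfacePatch S) (s : ℝ), (s = 1 ∨ s = -1) →
      (∀ x ∈ P.U ∩ halfPlane, P.normal x = (s * ‖P.normal x‖) • N (P.φ x)) →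
      ∀ t ∈ P.boundaryDomain, |e (P.φ !₂[0, t])| = 1 ∧
        -(s * ⟪P.boundaryVelocity t, hopf (P.φ !₂[0, t])⟫_ℝ) =
        e (P.φ !₂[0, t]) * ‖P.boundaryVelocity t‖ := by
    intro P s hs hsN t ht
    have hC := P.boundary_mem hbdry ht
    exact P.boundary_sign hbdry hsurf.1 hN' hs hsN ht (hu1 _ hC) (hup _ hC) (huT _ hC) (hu _ hC)
  have hfin : ({1, -1} : Set ℝ).Finite := by simp
  have habs : ∀ a : ℝ, |a| = 1 → a ∈ ({1, -1} : Set ℝ) := fun a ha => by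
    simpa using (abs_eq zero_le_one).1 ha
  have hloc : ∀ p ∈ circleC0, |e p| = 1 ∧ ContinuousWithinAt e circleC0 p := by
    intro p hp
    obtain ⟨P, hP⟩ := exists_surfacePatch hsurf (circleC0_subset hbdry hp)
    obtain ⟨s, hs, hsN⟩ := P.exists_sign hsurf.1 hN hN'
    have hS := hsign P s hs hsN
    set g : ℝ → ℝ := fun t => e (P.φ !₂[0, t]) with hg
    have hgc : ContinuousOn g P.boundaryDomain := by
      have hγ : ContinuousOn (fun t : ℝ => P.φ !₂[0, t]) P.boundaryDomain := fun t ht =>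
        (P.hasStrictDerivAt_boundary ht).hasDerivAt.continuousAt.continuousWithinAt
      have hv := P.continuousOn_boundaryVelocity
      have : ContinuousOn (fun t => -(s * ⟪P.boundaryVelocity t, hopf (P.φ !₂[0, t])⟫_ℝ) /
          ‖P.boundaryVelocity t‖) P.boundaryDomain :=
        ((continuousOn_const.mul (hv.inner (continuous_hopf.comp_continuousOn hγ))).neg).div hv.norm
          fun t ht => norm_ne_zero_iff.2 (P.boundaryVelocity_ne_zero ht)
      refine this.congr fun t ht => ?_
      change g t = -(s * ⟪P.boundaryVelocity t, hopf (P.φ !₂[0, t])⟫_ℝ) / ‖P.boundaryVelocity t‖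
      rw [(hS t ht).2, mul_div_cancel_right₀]
      exact norm_ne_zero_iff.2 (P.boundaryVelocity_ne_zero ht)
    have hconst := fun t (ht : t ∈ P.boundaryDomain) t' (ht' : t' ∈ P.boundaryDomain) =>
      P.ordConnected_boundaryDomain.isPreconnected.constant_of_mapsTo hfin.isDiscrete hgc
        (fun t ht => habs _ (hS t ht).1) ht ht'
    have himage := P.image_boundary hbdry
    obtain ⟨t, ht, htp⟩ : p ∈ (fun t : ℝ => P.φ !₂[0, t]) '' P.boundaryDomain := himage ▸ ⟨hp, hP⟩
    have hep : g t = e p := congrArg e htp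
    refine ⟨hep ▸ (hS t ht).1, ?_⟩
    have hev : e =ᶠ[𝓝[circleC0] p] fun _ => e p := by
      filter_upwards [self_mem_nhdsWithin, mem_nhdsWithin_of_mem_nhds (P.isOpen_W.mem_nhds hP)]
        with q hq hqW
      obtain ⟨t', ht', rfl⟩ : q ∈ (fun t : ℝ => P.φ !₂[0, t]) '' P.boundaryDomain :=
        himage ▸ ⟨hq, hqW⟩
      exact (hconst t' ht' t ht).trans hep
    exact continuousWithinAt_const.congr_of_eventuallyEq hev rfl
  have hconst : ∀ p ∈ circleC0, ∀ q ∈ circleC0, e p = e q := fun p hp q hq =>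
    isPreconnected_circleC0.constant_of_mapsTo hfin.isDiscrete (fun p hp => (hloc p hp).2)
      (fun p hp => habs _ (hloc p hp).1) hp hq
  refine ⟨e (circleMapC0 0), by simpa using habs _ (hloc _ (circleMapC0_mem 0)).1,
    fun P s hs hsN t ht => ?_⟩
  rw [(hsign P s hs hsN t ht).2,
    hconst _ (P.boundary_mem hbdry ht) _ (circleMapC0_mem 0)]

include hsurf hcomp hN in
theorem integrableOn_dualForm {b : E4 → E4} (hb : ContDiff ℝ 1 b) :
    IntegrableOn (fun p => dualForm (fderiv ℝ b p) p (N p)) S (μHE[2] : Measure E4) := by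
  refine integrableOn_surface hsurf hcomp ?_
  have h : ContinuousOn (fun p => ((fderiv ℝ b p, p, N p) : (E4 →L[ℝ] E4) × E4 × E4)) S :=
    ContinuousOn.prodMk (hb.continuous_fderiv one_ne_zero).continuousOn
      (ContinuousOn.prodMk (f := fun p => p) continuousOn_id hN)
  refine (continuous_dualForm.comp_continuousOn h).congr fun p _ => ?_
  rw [Function.comp_apply]

include hsurf hcomp hbdry hN hN' in
/-- Stokes' theorem for a 1-form supported in a patch. -/
theorem stokes_of_tsupport_subset {ε : ℝ}
    (hε : ∀ (P : SurfacePatch S) (s : ℝ), (s = 1 ∨ s = -1) →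
      (∀ x ∈ P.U ∩ halfPlane, P.normal x = (s * ‖P.normal x‖) • N (P.φ x)) →
      ∀ t ∈ P.boundaryDomain, -(s * ⟪P.boundaryVelocity t, hopf (P.φ !₂[0, t])⟫_ℝ) =
        ε * ‖P.boundaryVelocity t‖)
    (P : SurfacePatch S) {b : E4 → E4} (hb : ContDiff ℝ 1 b) (hbW : tsupport b ⊆ P.W) :
    ∫ p in S, dualForm (fderiv ℝ b p) p (N p) ∂(μHE[2] : Measure E4) =
      ε * ∫ θ in Ioc (-Real.pi) Real.pi, ⟪b (circleMapC0 θ), hopf (circleMapC0 θ)⟫_ℝ := by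
  obtain ⟨s, hs, hsN⟩ := P.exists_sign hsurf.1 hN hN'
  set h : E4 → ℝ := fun p => ⟪b p, hopf p⟫_ℝ with hh
  have h1 : ∫ t in P.boundaryDomain, ‖P.boundaryVelocity t‖ * h (P.φ !₂[0, t]) =
      ∫ θ in Ioc (-Real.pi) Real.pi, h (circleMapC0 θ) := by
    rw [← integral_image_curve P.isOpen_boundaryDomain.measurableSet
      (fun t ht => P.hasStrictDerivAt_boundary ht) P.continuousOn_boundaryVelocity
      (fun t ht => P.boundaryVelocity_ne_zero ht) P.injOn_boundary, P.image_boundary hbdry,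
      ← integral_circleC0]
    symm
    have hm : MeasurableSet circleC0 := by
      rw [← image_circleMapC0]
      exact measurableSet_Ioc.image_of_continuousOn_injOn
        contDiff_circleMapC0.continuous.continuousOn injOn_circleMapC0
    refine setIntegral_eq_of_subset_of_forall_sdiff_eq_zero hm inter_subset_left fun p hp => ?_
    have : b p = 0 := image_eq_zero_of_notMem_tsupport fun hbp => hp.2 ⟨hp.1, hbW hbp⟩
    simp [hh, this]
  have h2 : ∀ t ∈ P.boundaryDomain, -s * ⟪b (P.φ !₂[0, t]), P.boundaryVelocity t⟫_ℝ =
      ε * (‖P.boundaryVelocity t‖ * h (P.φ !₂[0, t])) := by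
    intro t ht
    have h3 : ⟪b (P.φ !₂[0, t]), P.boundaryVelocity t⟫_ℝ =
        ⟪P.boundaryVelocity t, hopf (P.φ !₂[0, t])⟫_ℝ * h (P.φ !₂[0, t]) := by
      conv_lhs => rw [P.boundaryVelocity_eq hbdry ht, inner_smul_right]
    rw [h3]
    linear_combination h (P.φ !₂[0, t]) * hε P s hs hsN t ht
  have h4 : -s * ∫ t in P.boundaryDomain, ⟪b (P.φ !₂[0, t]), P.boundaryVelocity t⟫_ℝ =
      ε * ∫ t in P.boundaryDomain, ‖P.boundaryVelocity t‖ * h (P.φ !₂[0, t]) := by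
    rw [← integral_const_mul, ← integral_const_mul]
    exact setIntegral_congr_fun P.isOpen_boundaryDomain.measurableSet h2
  rw [P.stokes hsurf.1 hcomp hs hsN hb hbW, ← h1, ← h4, neg_mul]
  rfl

include hsurf hcomp hbdry hseg hN hN' in
/-- **Stokes' theorem**: the flux through `S` of the field dual to the exterior derivative of the
1-form `⟪b, ·⟫` is the circulation of `b` along `C₀`. -/
theorem exists_stokes : ∃ ε : ℝ, (ε = 1 ∨ ε = -1) ∧ ∀ b : E4 → E4, ContDiff ℝ 1 b →
    ∫ p in S, dualForm (fderiv ℝ b p) p (N p) ∂(μHE[2] : Measure E4) =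
      ε * ∫ θ in Ioc (-Real.pi) Real.pi, ⟪b (circleMapC0 θ), hopf (circleMapC0 θ)⟫_ℝ := by
  obtain ⟨ε, hε, hεP⟩ := exists_boundary_orientation hsurf hbdry hseg hN hN'
  refine ⟨ε, hε, ?_⟩
  intro b hb
  obtain ⟨n, P, hP⟩ := exists_finite_patches hsurf hcomp
  obtain ⟨K, hK, hSK, hKW⟩ := exists_compact_between hcomp
    (isOpen_iUnion fun i => (P i).isOpen_W) hP
  obtain ⟨f, hf⟩ := SmoothPartitionOfUnity.exists_isSubordinate (modelWithCornersSelf ℝ E4)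
    hK.isClosed (fun i => (P i).W) (fun i => (P i).isOpen_W) hKW
  have hfC : ∀ i, ContDiff ℝ 1 (f i) := fun i => (f i).contMDiff.contDiff.of_le (by simp)
  have hsum : ∀ p ∈ K, ∑ i, f i p • b p = b p := fun p hp => by
    have := f.sum_eq_one hp
    rw [finsum_eq_sum_of_fintype] at this
    rw [← Finset.sum_smul, this, one_smul]
  have hbi : ∀ i, ContDiff ℝ 1 fun p => f i p • b p := fun i => (hfC i).smul hb
  have hint : ∀ i, IntegrableOn (fun p => dualForm (fderiv ℝ (fun p => f i p • b p) p) p (N p)) S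
      (μHE[2] : Measure E4) :=
    fun i => integrableOn_dualForm hsurf hcomp hN (hbi i)
  have hL : ∫ p in S, dualForm (fderiv ℝ b p) p (N p) ∂(μHE[2] : Measure E4) =
      ∑ i, ∫ p in S, dualForm (fderiv ℝ (fun p => f i p • b p) p) p (N p)
        ∂(μHE[2] : Measure E4) := by
    rw [← integral_finsetSum _ fun i _ => hint i]
    refine setIntegral_congr_fun hcomp.measurableSet fun p hp => ?_
    have hev : b =ᶠ[𝓝 p] fun q => ∑ i, f i q • b q := by
      filter_upwards [isOpen_interior.mem_nhds (hSK hp)] with q hq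
      exact (hsum q (interior_subset hq)).symm
    change dualForm (fderiv ℝ b p) p (N p) =
      ∑ i, dualForm (fderiv ℝ (fun p => f i p • b p) p) p (N p)
    rw [hev.fderiv_eq, fderiv_fun_sum fun i _ => (hbi i).differentiable one_ne_zero p, dualForm_sum]
  have hR : ∫ θ in Ioc (-Real.pi) Real.pi, ⟪b (circleMapC0 θ), hopf (circleMapC0 θ)⟫_ℝ =
      ∑ i, ∫ θ in Ioc (-Real.pi) Real.pi,
        ⟪f i (circleMapC0 θ) • b (circleMapC0 θ), hopf (circleMapC0 θ)⟫_ℝ := by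
    have hc := contDiff_circleMapC0.continuous
    have hh : Continuous fun θ => hopf (circleMapC0 θ) := continuous_hopf.comp hc
    rw [← integral_finsetSum]
    · refine setIntegral_congr_fun measurableSet_Ioc fun θ _ => ?_
      change _ = ∑ i, ⟪f i (circleMapC0 θ) • b (circleMapC0 θ), hopf (circleMapC0 θ)⟫_ℝ
      rw [← sum_inner, hsum _ (interior_subset (hSK (circleC0_subset hbdry (circleMapC0_mem θ))))]
    · intro i _
      have : Continuous fun θ => ⟪f i (circleMapC0 θ) • b (circleMapC0 θ), hopf (circleMapC0 θ)⟫_ℝ :=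
        ((hbi i).continuous.comp hc).inner hh
      exact this.integrableOn_Ioc
  rw [hL, hR, Finset.mul_sum]
  refine Finset.sum_congr rfl fun i _ => stokes_of_tsupport_subset hsurf hcomp hbdry hN hN' hεP (P i) (hbi i) ?_
  exact (tsupport_smul_subset_left _ _).trans (hf i)

end Stokes

/-! ### The calibrating field -/

/-- The function `|z₁|²`. -/
def radSq₁ (p : E4) : ℝ := p 0 ^ 2 + p 1 ^ 2

/-- The function `|z₂|²`. -/
def radSq₂ (p : E4) : ℝ := p 2 ^ 2 + p 3 ^ 2

/-- The horizontal field `i (|z₂|² z₁, -|z₁|² z₂)`, of length `|z₁| |z₂|` on the sphere. Away from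
the two great circles `z₁ = 0` and `z₂ = 0` it is a multiple of the unit normals of the half-spheres
`𝒮₀⁺(t)`. -/
def calibField (p : E4) : E4 :=
  !₂[-(radSq₂ p * p 1), radSq₂ p * p 0, radSq₁ p * p 3, -(radSq₁ p * p 2)]

/-- The 1-form `B(|z₁|²) (x₁ dy₁ - y₁ dx₁) - B(|z₂|²) (x₂ dy₂ - y₂ dx₂)`, as a vector field. -/
def calibForm (B : Polynomial ℝ) (p : E4) : E4 :=
  !₂[-(p 1 * B.eval (radSq₁ p)), p 0 * B.eval (radSq₁ p), p 3 * B.eval (radSq₂ p),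
    -(p 2 * B.eval (radSq₂ p))]

theorem radSq₁_nonneg (p : E4) : 0 ≤ radSq₁ p := by unfold radSq₁; positivity

theorem radSq₂_nonneg (p : E4) : 0 ≤ radSq₂ p := by unfold radSq₂; positivity

theorem radSq_add {p : E4} (hp : p ∈ sphere3) : radSq₁ p + radSq₂ p = 1 := by
  have : ‖p‖ = 1 := by simpa [sphere3] using hp
  rw [radSq₁, radSq₂, ← add_assoc, ← norm_sq_E4, this, one_pow]

theorem continuous_radSq₁ : Continuous radSq₁ := by
  unfold radSq₁
  fun_prop

theorem continuous_radSq₂ : Continuous radSq₂ := by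
  unfold radSq₂
  fun_prop

theorem continuous_calibField : Continuous calibField := by
  have h1 := continuous_radSq₁
  have h2 := continuous_radSq₂
  have hc := fun i : Fin 4 => PiLp.continuous_apply 2 (fun _ : Fin 4 => ℝ) i
  refine (PiLp.continuous_toLp 2 _).comp (continuous_pi fun i => ?_)
  fin_cases i
  · exact (h2.mul (hc 1)).neg
  · exact h2.mul (hc 0)
  · exact h1.mul (hc 3)
  · exact (h1.mul (hc 2)).neg

theorem norm_calibField {p : E4} (hp : p ∈ sphere3) :
    ‖calibField p‖ = √(radSq₁ p * radSq₂ p) := by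
  rw [eq_comm, Real.sqrt_eq_iff_eq_sq (mul_nonneg (radSq₁_nonneg p) (radSq₂_nonneg p))
    (norm_nonneg _), norm_sq_E4]
  change _ = (-(radSq₂ p * p 1)) ^ 2 + (radSq₂ p * p 0) ^ 2 + (radSq₁ p * p 3) ^ 2 +
    (-(radSq₁ p * p 2)) ^ 2
  have h := radSq_add hp
  unfold radSq₁ radSq₂ at *
  linear_combination -((p 0 ^ 2 + p 1 ^ 2) * (p 2 ^ 2 + p 3 ^ 2)) * h

theorem inner_calibField_hopf (p : E4) : ⟪calibField p, hopf p⟫_ℝ = 0 := by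
  rw [inner_E4]
  change -(radSq₂ p * p 1) * (-p 1) + (radSq₂ p * p 0) * p 0 + (radSq₁ p * p 3) * (-p 3) +
    (-(radSq₁ p * p 2)) * p 2 = 0
  unfold radSq₁ radSq₂
  ring

theorem contDiff_calibForm (B : Polynomial ℝ) : ContDiff ℝ 1 (calibForm B) := by
  have hc : ∀ i : Fin 4, ContDiff ℝ 1 fun p : E4 => p i := fun i =>
    (EuclideanSpace.proj i : E4 →L[ℝ] ℝ).contDiff
  have hB : ContDiff ℝ 1 fun x : ℝ => B.eval x := by
    simpa [Polynomial.aeval_def] using B.contDiff_aeval (𝕜 := ℝ) (R := ℝ) 1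
  have h1 : ContDiff ℝ 1 radSq₁ := ((hc 0).pow 2).add ((hc 1).pow 2)
  have h2 : ContDiff ℝ 1 radSq₂ := ((hc 2).pow 2).add ((hc 3).pow 2)
  rw [contDiff_euclidean]
  intro i
  fin_cases i
  · exact ((hc 1).mul (hB.comp h1)).neg
  · exact (hc 0).mul (hB.comp h1)
  · exact (hc 3).mul (hB.comp h2)
  · exact ((hc 2).mul (hB.comp h2)).neg

theorem fderiv_calibForm (B : Polynomial ℝ) (p v : E4) : fderiv ℝ (calibForm B) p v =
    !₂[-(v 1 * B.eval (radSq₁ p)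
        + p 1 * (B.derivative.eval (radSq₁ p) * (2 * (p 0 * v 0 + p 1 * v 1)))),
      v 0 * B.eval (radSq₁ p)
        + p 0 * (B.derivative.eval (radSq₁ p) * (2 * (p 0 * v 0 + p 1 * v 1))),
      v 3 * B.eval (radSq₂ p)
        + p 3 * (B.derivative.eval (radSq₂ p) * (2 * (p 2 * v 2 + p 3 * v 3))),
      -(v 2 * B.eval (radSq₂ p)
        + p 2 * (B.derivative.eval (radSq₂ p) * (2 * (p 2 * v 2 + p 3 * v 3))))] := by
  have hD := ((contDiff_calibForm B).differentiable one_ne_zero p).hasFDerivAt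
  have hc : ∀ i : Fin 4, HasFDerivAt (fun q : E4 => q i) (EuclideanSpace.proj i : E4 →L[ℝ] ℝ) p :=
    fun i => (EuclideanSpace.proj i : E4 →L[ℝ] ℝ).hasFDerivAt
  have hcoord : ∀ i : Fin 4, HasFDerivAt (fun q => calibForm B q i)
      ((EuclideanSpace.proj i : E4 →L[ℝ] ℝ).comp (fderiv ℝ (calibForm B) p)) p :=
    fun i => (EuclideanSpace.proj i : E4 →L[ℝ] ℝ).hasFDerivAt.comp p hD
  have h1 : HasFDerivAt (fun q => B.eval (radSq₁ q)) _ p :=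
    (B.hasDerivAt (radSq₁ p)).comp_hasFDerivAt p (((hc 0).pow 2).add ((hc 1).pow 2))
  have h2 : HasFDerivAt (fun q => B.eval (radSq₂ q)) _ p :=
    (B.hasDerivAt (radSq₂ p)).comp_hasFDerivAt p (((hc 2).pow 2).add ((hc 3).pow 2))
  apply E4_ext
  · have := congrArg (fun L : E4 →L[ℝ] ℝ => L v) ((hcoord 0).unique ((hc 1).mul h1).neg)
    simp at this
    simp [this]
    ring
  · have := congrArg (fun L : E4 →L[ℝ] ℝ => L v) ((hcoord 1).unique ((hc 0).mul h1))
    simp at this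
    simp [this]
    ring
  · have := congrArg (fun L : E4 →L[ℝ] ℝ => L v) ((hcoord 2).unique ((hc 3).mul h2))
    simp at this
    simp [this]
    ring
  · have := congrArg (fun L : E4 →L[ℝ] ℝ => L v) ((hcoord 3).unique ((hc 2).mul h2).neg)
    simp at this
    simp [this]
    ring

theorem exists_derivative_X_mul (R : Polynomial ℝ) :
    ∃ B : Polynomial ℝ, (Polynomial.X * B).derivative = R := by
  induction R using Polynomial.induction_on' with
  | add P Q hP hQ =>
    obtain ⟨B, hB⟩ := hP
    obtain ⟨C, hC⟩ := hQ
    exact ⟨B + C, by rw [mul_add, Polynomial.derivative_add, hB, hC]⟩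
  | monomial n a =>
    refine ⟨Polynomial.monomial n (a / (n + 1)), ?_⟩
    rw [Polynomial.X_mul_monomial, Polynomial.derivative_monomial]
    congr 1
    push_cast
    field_simp

/-- The polynomial 1-forms whose exterior derivative is dual to a multiple of the calibrating
field. -/
theorem exists_calibForm (P : Polynomial ℝ) : ∃ B : Polynomial ℝ,
    (∀ p ∈ sphere3, ∀ n : E4, dualForm (fderiv ℝ (calibForm B) p) p n =
      -(P.eval (radSq₁ p * radSq₂ p) * ⟪n, calibField p⟫_ℝ)) ∧
    (∀ p ∈ circleC0, ⟪calibForm B p, hopf p⟫_ℝ =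
      -((∫ s in (0 : ℝ)..1, s * P.eval (s * (1 - s))) / 2)) := by
  set R : Polynomial ℝ := Polynomial.C (1 / 2) * Polynomial.X *
    P.comp (Polynomial.X * (1 - Polynomial.X)) with hR
  obtain ⟨B, hB⟩ := exists_derivative_X_mul R
  have hRs : ∀ s : ℝ, R.eval s = s / 2 * P.eval (s * (1 - s)) := by
    intro s
    simp only [hR, Polynomial.eval_mul, Polynomial.eval_X, Polynomial.eval_one, Polynomial.eval_C,
      Polynomial.eval_comp, Polynomial.eval_sub]
    ring
  have hRe : ∀ s : ℝ, B.eval s + s * B.derivative.eval s = s / 2 * P.eval (s * (1 - s)) := by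
    intro s
    have := congrArg (Polynomial.eval s) hB
    rw [hRs] at this
    simp only [Polynomial.derivative_mul, Polynomial.derivative_X, Polynomial.eval_add,
      Polynomial.eval_mul, Polynomial.eval_X, Polynomial.eval_one] at this
    linear_combination this
  refine ⟨B, fun p hp n => ?_, fun p hp => ?_⟩
  · have e1 := hRe (radSq₁ p)
    have e2 := hRe (radSq₂ p)
    have h := radSq_add hp
    rw [show 1 - radSq₁ p = radSq₂ p by linarith] at e1
    rw [show 1 - radSq₂ p = radSq₁ p by linarith, mul_comm (radSq₂ p) (radSq₁ p)] at e2
    rw [dualForm, inner_E4]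
    simp only [fderiv_calibForm]
    simp only [calibField, PiLp.single_apply, Matrix.cons_val_zero, Matrix.cons_val_one,
      Matrix.cons_val, Fin.isValue, reduceIte, Fin.reduceEq]
    simp only [radSq₁, radSq₂] at e1 e2 ⊢
    linear_combination 2 * (p 2 * n 3 - p 3 * n 2) * e1 - 2 * (p 0 * n 1 - p 1 * n 0) * e2
  · obtain ⟨p0, p1, p2⟩ := mem_circleC0_iff.1 hp
    have hint : ∫ s in (0 : ℝ)..1, (s / 2 * P.eval (s * (1 - s))) = B.eval 1 := by
      have hd : ∀ s ∈ uIcc (0 : ℝ) 1, HasDerivAt (fun s => (Polynomial.X * B).eval s)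
          (s / 2 * P.eval (s * (1 - s))) s := fun s _ => by
        have := (Polynomial.X * B).hasDerivAt s
        rwa [hB, hRs] at this
      rw [intervalIntegral.integral_eq_sub_of_hasDerivAt hd]
      · simp
      · apply Continuous.intervalIntegrable
        fun_prop
    have hhalf : (∫ s in (0 : ℝ)..1, s * P.eval (s * (1 - s))) / 2 = B.eval 1 := by
      rw [← hint, ← intervalIntegral.integral_div]
      congr 1
      funext s
      ring
    have h2 : radSq₂ p = 1 := p2
    rw [hhalf, inner_E4]
    simp only [calibForm, hopf_apply, p0, p1, h2, Matrix.cons_val_zero, Matrix.cons_val_one,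
      Matrix.cons_val]
    linear_combination -B.eval 1 * p2

/-! ### The calibration inequality -/

/-- This improper integral is `1 / π` times the flux of the normalized calibrating field. -/
theorem integral_div_sqrt : IntervalIntegrable (fun s : ℝ => s * (√(s * (1 - s)))⁻¹) volume 0 1 ∧
    ∫ s in (0 : ℝ)..1, s * (√(s * (1 - s)))⁻¹ = Real.pi / 2 := by
  set G : ℝ → ℝ := fun s => Real.arcsin (2 * s - 1) / 2 - √(s * (1 - s)) with hG
  have hcont : ContinuousOn G (Icc 0 1) := by
    apply Continuous.continuousOn
    have := Real.continuous_arcsin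
    fun_prop
  have hderiv : ∀ s ∈ Ioo (0 : ℝ) 1, HasDerivAt G (s * (√(s * (1 - s)))⁻¹) s := by
    intro s hs
    have hpos : 0 < s * (1 - s) := mul_pos hs.1 (sub_pos.2 hs.2)
    have h1 : HasDerivAt (fun s : ℝ => 2 * s - 1) 2 s := by
      simpa using ((hasDerivAt_id s).const_mul 2).sub_const 1
    have h2 := (Real.hasDerivAt_arcsin (x := 2 * s - 1) (by linarith [hs.1]) (by linarith [hs.2])).comp
      s h1
    have h3 : HasDerivAt (fun s : ℝ => s * (1 - s)) (1 * (1 - s) + s * (0 - 1)) s :=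
      (hasDerivAt_id s).mul ((hasDerivAt_const s (1 : ℝ)).sub (hasDerivAt_id s))
    have h4 : √(1 - (2 * s - 1) ^ 2) = 2 * √(s * (1 - s)) := by
      rw [show 1 - (2 * s - 1) ^ 2 = 2 ^ 2 * (s * (1 - s)) by ring, Real.sqrt_mul (by norm_num),
        Real.sqrt_sq (by norm_num)]
    have h5 := (h2.div_const 2).sub (h3.sqrt hpos.ne')
    refine h5.congr_deriv ?_
    rw [h4]
    have := (Real.sqrt_pos.2 hpos).ne'
    field_simp
    ring
  have hint : IntervalIntegrable (fun s : ℝ => s * (√(s * (1 - s)))⁻¹) volume 0 1 := by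
    rw [intervalIntegrable_iff_integrableOn_Ioc_of_le zero_le_one]
    exact intervalIntegral.integrableOn_deriv_of_nonneg hcont hderiv fun s hs =>
      mul_nonneg hs.1.le (by positivity)
  refine ⟨hint, ?_⟩
  rw [intervalIntegral.integral_eq_sub_of_hasDerivAt_of_le zero_le_one hcont hderiv hint]
  have e1 : Real.arcsin (2 * 1 - 1) = Real.pi / 2 := by norm_num
  have e0 : Real.arcsin (2 * 0 - 1) = -(Real.pi / 2) := by norm_num
  simp only [hG, e1, e0]
  simp
  ring

/-- Polynomial approximation of `x ↦ 1 / √x`, with a domination that survives multiplication by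
`√x`. -/
theorem exists_polynomial_approx_inv_sqrt : ∃ P : ℕ → Polynomial ℝ,
    (∀ n, ∀ x ∈ Icc (0 : ℝ) 1, |(P n).eval x * √x| ≤ 2) ∧
    ∀ x ∈ Ioc (0 : ℝ) 1, Tendsto (fun n => (P n).eval x) atTop (𝓝 (√x)⁻¹) := by
  have hpos : ∀ n : ℕ, (0 : ℝ) < 1 / ((n : ℝ) + 1) := fun n => by positivity
  have hex : ∀ n : ℕ, ∃ P : Polynomial ℝ, ∀ x ∈ Icc (0 : ℝ) 1,
      |P.eval x - (√(x + 1 / ((n : ℝ) + 1)))⁻¹| < 1 / ((n : ℝ) + 1) := fun n => by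
    refine exists_polynomial_near_of_continuousOn 0 1 _ (ContinuousOn.inv₀ (by fun_prop) ?_) _
      (hpos n)
    exact fun x hx => (Real.sqrt_pos.2 (by linarith [hx.1, hpos n])).ne'
  choose P hP using hex
  refine ⟨P, fun n x hx => ?_, fun x hx => ?_⟩
  · have h1 := hP n x hx
    have hs : 0 < √(x + 1 / ((n : ℝ) + 1)) := Real.sqrt_pos.2 (by linarith [hx.1, hpos n])
    have h2 : (√(x + 1 / ((n : ℝ) + 1)))⁻¹ * √x ≤ 1 := by
      rw [inv_mul_le_one₀ hs]
      exact Real.sqrt_le_sqrt (by linarith [hpos n])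
    have h3 : √x ≤ 1 := Real.sqrt_le_one.2 hx.2
    have h4 : 1 / ((n : ℝ) + 1) ≤ 1 := by
      rw [div_le_one (by positivity)]
      linarith [n.cast_nonneg (α := ℝ)]
    have h5 : |(P n).eval x| ≤ (√(x + 1 / ((n : ℝ) + 1)))⁻¹ + 1 := by
      have := abs_sub_abs_le_abs_sub ((P n).eval x) (√(x + 1 / ((n : ℝ) + 1)))⁻¹
      rw [abs_of_pos (inv_pos.2 hs)] at this
      linarith
    rw [abs_mul, abs_of_nonneg (Real.sqrt_nonneg x)]
    calc |(P n).eval x| * √x ≤ ((√(x + 1 / ((n : ℝ) + 1)))⁻¹ + 1) * √x := by gcongr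
      _ ≤ 2 := by rw [add_mul]; linarith
  · have hlim : Tendsto (fun n : ℕ => (√(x + 1 / ((n : ℝ) + 1)))⁻¹) atTop (𝓝 (√x)⁻¹) := by
      have h0 := tendsto_one_div_add_atTop_nhds_zero_nat (𝕜 := ℝ)
      have h1 := (h0.const_add x).sqrt
      rw [add_zero] at h1
      exact h1.inv₀ (Real.sqrt_pos.2 hx.1).ne'
    have hdiff : Tendsto (fun n => (P n).eval x - (√(x + 1 / ((n : ℝ) + 1)))⁻¹) atTop (𝓝 0) :=
      squeeze_zero_norm (fun n => (hP n x ⟨hx.1.le, hx.2⟩).le)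
        (tendsto_one_div_add_atTop_nhds_zero_nat (𝕜 := ℝ))
    simpa using hdiff.add hlim

theorem radSq_mul_mem {p : E4} (hp : p ∈ sphere3) : radSq₁ p * radSq₂ p ∈ Icc (0 : ℝ) 1 := by
  have h1 := radSq₁_nonneg p
  have h2 := radSq₂_nonneg p
  have h := radSq_add hp
  exact ⟨mul_nonneg h1 h2, by nlinarith⟩

theorem horizontalPart_smul (p X : E4) (c : ℝ) :
    horizontalPart p (c • X) = c • horizontalPart p X := by
  rw [horizontalPart, horizontalPart, inner_smul_left, smul_sub, smul_smul]
  simp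

theorem inner_horizontalPart_calibField (p n : E4) :
    ⟪horizontalPart p n, calibField p⟫_ℝ = ⟪n, calibField p⟫_ℝ := by
  rw [horizontalPart, inner_sub_left, inner_smul_left, real_inner_comm (calibField p) (hopf p),
    inner_calibField_hopf]
  simp

theorem inner_calibField_le {p : E4} (hp : p ∈ sphere3) (n : E4) :
    ⟪n, calibField p⟫_ℝ * (√(radSq₁ p * radSq₂ p))⁻¹ ≤ ‖horizontalPart p n‖ := by
  rcases (Real.sqrt_nonneg (radSq₁ p * radSq₂ p)).eq_or_lt with h | h
  · rw [← h]
    simp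
  · rw [mul_inv_le_iff₀ h, ← inner_horizontalPart_calibField, ← norm_calibField hp]
    exact real_inner_le_norm _ _

theorem normNh_eq {S : Set E4} (hsurf : IsC2Surface S) {p n : E4} (hp : p ∈ S)
    (hn : n ∈ unitNormals S p) : normNh S p = ‖horizontalPart p n‖ₑ := by
  obtain ⟨P, hP⟩ := exists_surfacePatch hsurf hp
  obtain ⟨x, hx, rfl⟩ := P.exists_φ_eq ⟨hp, hP⟩
  have hpos := P.norm_normal_pos hsurf.1 hx
  have key : ∀ m ∈ unitNormals S (P.φ x), ‖horizontalPart (P.φ x) (P.normal x)‖ =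
      ‖P.normal x‖ * ‖horizontalPart (P.φ x) m‖ := by
    intro m hm
    conv_lhs => rw [P.normal_eq_smul hsurf.1 hx hm, horizontalPart_smul, norm_smul,
      Real.norm_eq_abs, P.abs_inner_normal hsurf.1 hx hm]
  have heq : ∀ m ∈ unitNormals S (P.φ x),
      ‖horizontalPart (P.φ x) m‖ₑ = ‖horizontalPart (P.φ x) n‖ₑ := by
    intro m hm
    have := mul_left_cancel₀ hpos.ne' ((key m hm).symm.trans (key n hn))
    rw [enorm_eq_iff_norm_eq, this]
  exact le_antisymm (iSup₂_le fun m hm => (heq m hm).le)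
    (le_iSup₂ (f := fun m (_ : m ∈ unitNormals S (P.φ x)) => ‖horizontalPart (P.φ x) m‖ₑ) n hn)

theorem continuousOn_horizontalPart {S : Set E4} {N : E4 → E4} (hN : ContinuousOn N S) :
    ContinuousOn (fun p => horizontalPart p (N p)) S := by
  have h := continuous_hopf.continuousOn (s := S)
  exact hN.sub ((hN.inner h).fun_smul h)

theorem area_eq {S : Set E4} (hsurf : IsC2Surface S) (hcomp : IsCompact S) {N : E4 → E4}
    (hN : ContinuousOn N S) (hN' : ∀ p ∈ S, N p ∈ unitNormals S p) :
    area S = ENNReal.ofReal (∫ p in S, ‖horizontalPart p (N p)‖ ∂(μHE[2] : Measure E4)) := by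
  rw [ofReal_integral_eq_lintegral_ofReal
    (integrableOn_surface hsurf hcomp (continuousOn_horizontalPart hN).norm)
    (ae_of_all _ fun p => norm_nonneg _), area]
  refine setLIntegral_congr_fun hcomp.measurableSet fun p hp => ?_
  rw [normNh_eq hsurf hp (hN' p hp), ofReal_norm]

section Flux

variable {S : Set E4} (hsurf : IsC2Surface S) (hcomp : IsCompact S)
  (hbdry : surfaceBoundary S = circleC0) (hseg : ContainsOrthogonalSegments S)

include hsurf hcomp hbdry hseg in
/-- The sign in Stokes' theorem is absorbed into the choice of the unit normal. -/
theorem exists_normal_flux_polynomial (horient : IsOrientableSurface S) : ∃ N : E4 → E4,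
    ContinuousOn N S ∧ (∀ p ∈ S, N p ∈ unitNormals S p) ∧ ∀ P : Polynomial ℝ,
      ∫ p in S, P.eval (radSq₁ p * radSq₂ p) * ⟪N p, calibField p⟫_ℝ ∂(μHE[2] : Measure E4) =
        Real.pi * ∫ s in (0 : ℝ)..1, s * P.eval (s * (1 - s)) := by
  obtain ⟨N, hN, hN'⟩ := horient
  obtain ⟨ε, hε, h⟩ := exists_stokes hsurf hcomp hbdry hseg hN hN'
  have hεε : ε * ε = 1 := by rcases hε with rfl | rfl <;> norm_num
  have hεn : ‖ε‖ = 1 := by rcases hε with rfl | rfl <;> simp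
  refine ⟨fun p => ε • N p, hN.const_smul ε, fun p hp => ⟨?_, ?_, fun v hv => ?_⟩, fun P => ?_⟩
  · rw [norm_smul, hεn, (hN' p hp).1, one_mul]
  · rw [inner_smul_left, (hN' p hp).2.1, mul_zero]
  · rw [inner_smul_left, (hN' p hp).2.2 v hv, mul_zero]
  obtain ⟨B, hB, hBC⟩ := exists_calibForm P
  set I := ∫ s in (0 : ℝ)..1, s * P.eval (s * (1 - s))
  have h1 := h _ (contDiff_calibForm B)
  rw [setIntegral_congr_fun hcomp.measurableSet fun p hp => hB p (hsurf.1 hp) (N p),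
    integral_neg, setIntegral_congr_fun measurableSet_Ioc fun θ _ => hBC _ (circleMapC0_mem θ),
    setIntegral_const, Real.volume_real_Ioc_of_le (by linarith [Real.pi_pos]), smul_eq_mul] at h1
  have h2 : ∫ p in S, P.eval (radSq₁ p * radSq₂ p) * ⟪ε • N p, calibField p⟫_ℝ
      ∂(μHE[2] : Measure E4) = ε * ∫ p in S, P.eval (radSq₁ p * radSq₂ p) * ⟪N p, calibField p⟫_ℝ
      ∂(μHE[2] : Measure E4) := by
    rw [← integral_const_mul]
    congr 1
    funext p
    rw [inner_smul_left, conj_trivial]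
    ring
  rw [h2]
  linear_combination -ε * h1 + Real.pi * I * hεε

include hsurf hcomp hbdry hseg in
/-- The flux through `S` of the normalized calibrating field does not depend on `S`. The field is
singular along two great circles, and is a limit of fields that are smooth. -/
theorem exists_normal_flux (horient : IsOrientableSurface S) : ∃ N : E4 → E4,
    ContinuousOn N S ∧ (∀ p ∈ S, N p ∈ unitNormals S p) ∧
      IntegrableOn (fun p => ⟪N p, calibField p⟫_ℝ * (√(radSq₁ p * radSq₂ p))⁻¹) S
        (μHE[2] : Measure E4) ∧
      ∫ p in S, ⟪N p, calibField p⟫_ℝ * (√(radSq₁ p * radSq₂ p))⁻¹ ∂(μHE[2] : Measure E4) =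
        Real.pi ^ 2 / 2 := by
  obtain ⟨N, hN, hN', hflux⟩ := exists_normal_flux_polynomial hsurf hcomp hbdry hseg horient
  refine ⟨N, hN, hN', ?_⟩
  obtain ⟨P, hP2, hPlim⟩ := exists_polynomial_approx_inv_sqrt
  have : IsFiniteMeasure ((μHE[2] : Measure E4).restrict S) :=
    isFiniteMeasure_restrict.2 (measure_surface_lt_top hsurf hcomp).ne
  have hle : ∀ p ∈ S, |⟪N p, calibField p⟫_ℝ| ≤ √(radSq₁ p * radSq₂ p) := fun p hp => by
    rw [← norm_calibField (hsurf.1 hp)]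
    simpa [(hN' p hp).1] using abs_real_inner_le_norm (N p) (calibField p)
  have hu := fun p (hp : p ∈ S) => radSq_mul_mem (hsurf.1 hp)
  have hin : ContinuousOn (fun p => ⟪N p, calibField p⟫_ℝ) S :=
    hN.inner continuous_calibField.continuousOn
  have hmeas : ∀ n, AEStronglyMeasurable
      (fun p => (P n).eval (radSq₁ p * radSq₂ p) * ⟪N p, calibField p⟫_ℝ)
      ((μHE[2] : Measure E4).restrict S) := fun n => by
    have hc : ContinuousOn (fun p => (P n).eval (radSq₁ p * radSq₂ p)) S :=
      ((P n).continuous.comp (continuous_radSq₁.mul continuous_radSq₂)).continuousOn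
    exact (integrableOn_surface hsurf hcomp (hc.mul hin)).aestronglyMeasurable
  have hlim : ∀ᵐ p ∂(μHE[2] : Measure E4).restrict S, Tendsto
      (fun n => (P n).eval (radSq₁ p * radSq₂ p) * ⟪N p, calibField p⟫_ℝ) atTop
      (𝓝 (⟪N p, calibField p⟫_ℝ * (√(radSq₁ p * radSq₂ p))⁻¹)) := by
    refine ae_restrict_of_forall_mem hcomp.measurableSet fun p hp => ?_
    rw [mul_comm (⟪N p, calibField p⟫_ℝ)]
    rcases (hu p hp).1.eq_or_lt with h | h
    · have h0 : ⟪N p, calibField p⟫_ℝ = 0 := by simpa [← h] using hle p hp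
      simp [h0]
    · exact (hPlim _ ⟨h, (hu p hp).2⟩).mul_const _
  have hlimS := tendsto_integral_of_dominated_convergence (fun _ => (2 : ℝ)) hmeas
    (integrable_const 2) (fun n => ae_restrict_of_forall_mem hcomp.measurableSet fun p hp => by
      rw [Real.norm_eq_abs]
      refine le_trans ?_ (hP2 n _ (hu p hp))
      rw [abs_mul, abs_mul, abs_of_nonneg (Real.sqrt_nonneg _)]
      exact mul_le_mul_of_nonneg_left (hle p hp) (abs_nonneg _)) hlim
  have hmem : ∀ s ∈ Ioo (0 : ℝ) 1, s * (1 - s) ∈ Ioc (0 : ℝ) 1 := fun s hs =>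
    ⟨mul_pos hs.1 (sub_pos.2 hs.2), by nlinarith [hs.1, hs.2]⟩
  have hae : ∀ᵐ s : ℝ, s ∈ uIoc (0 : ℝ) 1 → s ∈ Ioo (0 : ℝ) 1 := by
    filter_upwards [compl_mem_ae_iff.2 (measure_singleton (1 : ℝ))] with s hs hs'
    rw [uIoc_of_le zero_le_one] at hs'
    exact ⟨hs'.1, lt_of_le_of_ne hs'.2 hs⟩
  have hlimI : Tendsto (fun n => ∫ s in (0 : ℝ)..1, s * (P n).eval (s * (1 - s))) atTop
      (𝓝 (∫ s in (0 : ℝ)..1, s * (√(s * (1 - s)))⁻¹)) := by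
    refine intervalIntegral.tendsto_integral_filter_of_dominated_convergence
      (fun s => 2 * (s * (√(s * (1 - s)))⁻¹)) (Eventually.of_forall fun n => ?_)
      (Eventually.of_forall fun n => ?_) (integral_div_sqrt.1.const_mul 2) ?_
    · have : Continuous fun s => s * (P n).eval (s * (1 - s)) := by fun_prop
      exact this.aestronglyMeasurable
    · filter_upwards [hae] with s hs hs'
      have hsq := Real.sqrt_pos.2 (hmem s (hs hs')).1
      have h2 := hP2 n _ (Ioc_subset_Icc_self (hmem s (hs hs')))
      rw [abs_mul, abs_of_pos hsq, ← le_div_iff₀ hsq] at h2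
      rw [norm_mul, Real.norm_eq_abs, Real.norm_eq_abs, abs_of_pos (hs hs').1]
      calc s * |(P n).eval (s * (1 - s))| ≤ s * (2 / √(s * (1 - s))) :=
            mul_le_mul_of_nonneg_left h2 (hs hs').1.le
        _ = 2 * (s * (√(s * (1 - s)))⁻¹) := by ring
    · filter_upwards [hae] with s hs hs'
      exact (hPlim _ (hmem s (hs hs'))).const_mul s
  refine ⟨?_, ?_⟩
  · refine Integrable.of_bound (aestronglyMeasurable_of_tendsto_ae atTop hmeas hlim) 1 ?_
    refine ae_restrict_of_forall_mem hcomp.measurableSet fun p hp => ?_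
    rw [norm_mul, norm_inv, Real.norm_eq_abs, Real.norm_eq_abs, abs_of_nonneg (Real.sqrt_nonneg _)]
    exact mul_inv_le_one_of_le₀ (hle p hp) (Real.sqrt_nonneg _)
  · simp only [hflux] at hlimS
    rw [tendsto_nhds_unique hlimS (hlimI.const_mul Real.pi), integral_div_sqrt.2]
    ring

end Flux

/-! ### The area of the half-sphere -/

/-- Spherical coordinates on the half-sphere `𝒮₀⁺`. -/
def hemiMap (x : E2) : E4 :=
  !₂[Real.sin (x 0), 0, Real.cos (x 0) * Real.cos (x 1), Real.cos (x 0) * Real.sin (x 1)]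

theorem contDiff_hemiMap : ContDiff ℝ 1 hemiMap := by
  have h0 : ContDiff ℝ 1 fun x : E2 => x 0 := (EuclideanSpace.proj 0 : E2 →L[ℝ] ℝ).contDiff
  have h1 : ContDiff ℝ 1 fun x : E2 => x 1 := (EuclideanSpace.proj 1 : E2 →L[ℝ] ℝ).contDiff
  rw [contDiff_euclidean]
  intro i
  fin_cases i
  · exact h0.sin
  · exact contDiff_const
  · exact h0.cos.mul h1.cos
  · exact h0.cos.mul h1.sin

theorem fderiv_hemiMap (x v : E2) : fderiv ℝ hemiMap x v =
    !₂[Real.cos (x 0) * v 0, 0,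
      -(Real.sin (x 0) * Real.cos (x 1) * v 0) - Real.cos (x 0) * Real.sin (x 1) * v 1,
      -(Real.sin (x 0) * Real.sin (x 1) * v 0) + Real.cos (x 0) * Real.cos (x 1) * v 1] := by
  have hD := (contDiff_hemiMap.differentiable one_ne_zero x).hasFDerivAt
  have hc : ∀ i : Fin 2, HasFDerivAt (fun q : E2 => q i) (EuclideanSpace.proj i : E2 →L[ℝ] ℝ) x :=
    fun i => (EuclideanSpace.proj i : E2 →L[ℝ] ℝ).hasFDerivAt
  have hcoord : ∀ i : Fin 4, HasFDerivAt (fun q => hemiMap q i)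
      ((EuclideanSpace.proj i : E4 →L[ℝ] ℝ).comp (fderiv ℝ hemiMap x)) x :=
    fun i => (EuclideanSpace.proj i : E4 →L[ℝ] ℝ).hasFDerivAt.comp x hD
  apply E4_ext
  · have := congrArg (fun L : E2 →L[ℝ] ℝ => L v) ((hcoord 0).unique (hc 0).sin)
    simp at this
    simp [this]
  · have := congrArg (fun L : E2 →L[ℝ] ℝ => L v)
      ((hcoord 1).unique (hasFDerivAt_const (0 : ℝ) x))
    simp at this
    simp [this]
  · have := congrArg (fun L : E2 →L[ℝ] ℝ => L v) ((hcoord 2).unique ((hc 0).cos.mul (hc 1).cos))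
    simp at this
    simp [this]
    ring
  · have := congrArg (fun L : E2 →L[ℝ] ℝ => L v) ((hcoord 3).unique ((hc 0).cos.mul (hc 1).sin))
    simp at this
    simp [this]
    ring

theorem mem_sphere3_iff {p : E4} : p ∈ sphere3 ↔ p 0 ^ 2 + p 1 ^ 2 + p 2 ^ 2 + p 3 ^ 2 = 1 := by
  rw [← norm_sq_E4, sphere3, mem_sphere_zero_iff_norm]
  exact (pow_eq_one_iff_of_nonneg (norm_nonneg p) two_ne_zero).symm

theorem hemiMap_mem_sphere3 (x : E2) : hemiMap x ∈ sphere3 := by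
  rw [mem_sphere3_iff]
  simp only [hemiMap, Matrix.cons_val_zero, Matrix.cons_val_one, Matrix.cons_val]
  linear_combination Real.cos (x 0) ^ 2 * Real.sin_sq_add_cos_sq (x 1)
    + Real.sin_sq_add_cos_sq (x 0)

/-- The parameters of spherical coordinates. -/
def hemiDomain : Set E2 := {x | x 0 ∈ Ioo 0 (Real.pi / 2) ∧ x 1 ∈ Ioc (-Real.pi) Real.pi}

theorem measurableSet_hemiDomain : MeasurableSet hemiDomain :=
  ((PiLp.continuous_apply 2 _ 0).measurable measurableSet_Ioo).inter
    ((PiLp.continuous_apply 2 _ 1).measurable measurableSet_Ioc)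

theorem cos_pos_of_mem {x : E2} (hx : x ∈ hemiDomain) : 0 < Real.cos (x 0) :=
  Real.cos_pos_of_mem_Ioo ⟨by linarith [hx.1.1, Real.pi_pos], hx.1.2⟩

theorem injective_fderiv_hemiMap {x : E2} (hx : x ∈ hemiDomain) :
    Function.Injective (fderiv ℝ hemiMap x) := by
  rw [injective_iff_map_eq_zero]
  intro v hv
  rw [fderiv_hemiMap] at hv
  have hc := (cos_pos_of_mem hx).ne'
  have h0 : Real.cos (x 0) * v 0 = 0 := congrArg (fun p : E4 => p 0) hv
  have v0 : v 0 = 0 := (mul_eq_zero.1 h0).resolve_left hc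
  have h2 : -(Real.sin (x 0) * Real.cos (x 1) * v 0) - Real.cos (x 0) * Real.sin (x 1) * v 1 = 0 :=
    congrArg (fun p : E4 => p 2) hv
  have h3 : -(Real.sin (x 0) * Real.sin (x 1) * v 0) + Real.cos (x 0) * Real.cos (x 1) * v 1 = 0 :=
    congrArg (fun p : E4 => p 3) hv
  rw [v0] at h2 h3
  have h4 : Real.cos (x 0) * v 1 = 0 := by
    linear_combination Real.cos (x 1) * h3 - Real.sin (x 1) * h2
      - Real.cos (x 0) * v 1 * Real.sin_sq_add_cos_sq (x 1)
  have v1 : v 1 = 0 := (mul_eq_zero.1 h4).resolve_left hc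
  ext i
  fin_cases i
  · exact v0
  · exact v1

theorem injOn_hemiMap : InjOn hemiMap hemiDomain := by
  intro x hx y hy h
  have h0 : Real.sin (x 0) = Real.sin (y 0) := congrArg (fun p : E4 => p 0) h
  have e0 : x 0 = y 0 := Real.injOn_sin ⟨by linarith [hx.1.1, Real.pi_pos], hx.1.2.le⟩
    ⟨by linarith [hy.1.1, Real.pi_pos], hy.1.2.le⟩ h0
  have h2 : Real.cos (x 0) * Real.cos (x 1) = Real.cos (y 0) * Real.cos (y 1) :=
    congrArg (fun p : E4 => p 2) h
  have h3 : Real.cos (x 0) * Real.sin (x 1) = Real.cos (y 0) * Real.sin (y 1) :=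
    congrArg (fun p : E4 => p 3) h
  rw [← e0] at h2 h3
  have hc := (cos_pos_of_mem hx).ne'
  have e1 : x 1 = y 1 := injOn_circleMapC0 hx.2 hy.2 (by
    rw [circleMapC0, circleMapC0, mul_left_cancel₀ hc h2, mul_left_cancel₀ hc h3])
  ext i
  fin_cases i
  · exact e0
  · exact e1

theorem image_hemiMap_subset : hemiMap '' hemiDomain ⊆ halfSphere := by
  rintro _ ⟨x, hx, rfl⟩
  refine ⟨hemiMap_mem_sphere3 x, rfl, ?_⟩
  exact Real.sin_nonneg_of_nonneg_of_le_pi hx.1.1.le (by linarith [hx.1.2, Real.pi_pos])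

theorem halfSphere_diff_subset :
    halfSphere \ hemiMap '' hemiDomain ⊆ circleC0 ∪ {EuclideanSpace.single 0 1} := by
  rintro p ⟨⟨hp, hp1, hp0⟩, hpn⟩
  by_contra hcon
  rw [mem_union, not_or, mem_singleton_iff] at hcon
  have hsq := mem_sphere3_iff.1 hp
  have h0 : 0 < p 0 := lt_of_le_of_ne hp0 fun h => hcon.1 ⟨hp, h.symm, hp1⟩
  have h1 : p 0 < 1 := by
    by_contra h
    push Not at h
    have h2 : p 2 = 0 := by nlinarith [sq_nonneg (p 2), sq_nonneg (p 3), sq_nonneg (p 1)]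
    have h3 : p 3 = 0 := by nlinarith [sq_nonneg (p 2), sq_nonneg (p 3), sq_nonneg (p 1)]
    have h4 : p 0 = 1 := by nlinarith
    exact hcon.2 (by apply E4_ext <;> simp [h2, h3, h4, hp1])
  refine hpn ?_
  have hc : 0 < √(1 - p 0 ^ 2) := Real.sqrt_pos.2 (by nlinarith)
  have hc2 : √(1 - p 0 ^ 2) ^ 2 = 1 - p 0 ^ 2 := Real.sq_sqrt (by nlinarith)
  have hmem : (!₂[0, 0, p 2 / √(1 - p 0 ^ 2), p 3 / √(1 - p 0 ^ 2)] : E4) ∈ circleC0 := by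
    rw [mem_circleC0_iff]
    refine ⟨rfl, rfl, ?_⟩
    simp only [Matrix.cons_val]
    rw [div_pow, div_pow, hc2, ← add_div, div_eq_one_iff_eq (by nlinarith)]
    rw [hp1] at hsq
    linarith
  rw [← image_circleMapC0] at hmem
  obtain ⟨θ, hθ, hθp⟩ := hmem
  have e2 : Real.cos θ = p 2 / √(1 - p 0 ^ 2) := congrArg (fun p : E4 => p 2) hθp
  have e3 : Real.sin θ = p 3 / √(1 - p 0 ^ 2) := congrArg (fun p : E4 => p 3) hθp
  refine ⟨!₂[Real.arcsin (p 0), θ], ⟨⟨Real.arcsin_pos.2 h0, Real.arcsin_lt_pi_div_two.2 h1⟩, hθ⟩, ?_⟩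
  apply E4_ext
  · change Real.sin (Real.arcsin (p 0)) = p 0
    exact Real.sin_arcsin (by linarith) h1.le
  · exact hp1.symm
  · change Real.cos (Real.arcsin (p 0)) * Real.cos θ = p 2
    rw [Real.cos_arcsin, e2, mul_div_cancel₀ _ hc.ne']
  · change Real.cos (Real.arcsin (p 0)) * Real.sin θ = p 3
    rw [Real.cos_arcsin, e3, mul_div_cancel₀ _ hc.ne']

theorem measure_circleC0_union :
    (μHE[2] : Measure E4) (circleC0 ∪ {EuclideanSpace.single 0 1}) = 0 := by
  have h1 : dimH circleC0 ≤ 1 := by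
    rw [← image_circleMapC0]
    have := contDiff_circleMapC0.dimH_range_le
    rw [finrank_self] at this
    exact (dimH_mono (image_subset_range _ _)).trans (by simpa using this)
  have h2 : dimH (circleC0 ∪ {EuclideanSpace.single 0 1}) < ((2 : ℝ≥0) : ℝ≥0∞) := by
    rw [dimH_union, dimH_singleton]
    exact lt_of_le_of_lt (max_le h1 zero_le_one) (by norm_num)
  have h3 := hausdorffMeasure_of_dimH_lt h2
  rw [Measure.euclideanHausdorffMeasure_def, Measure.smul_apply]
  have h4 : (μH[((2 : ℕ) : ℝ)] : Measure E4) (circleC0 ∪ {EuclideanSpace.single 0 1}) = 0 := by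
    rw [Nat.cast_two]
    exact h3
  rw [h4, smul_zero]

theorem inner_fderiv_hemiMap (x v : E2) : ⟪fderiv ℝ hemiMap x v, hemiMap x⟫_ℝ = 0 := by
  rw [fderiv_hemiMap, inner_E4]
  simp only [hemiMap, Matrix.cons_val_zero, Matrix.cons_val_one, Matrix.cons_val]
  linear_combination (-(Real.sin (x 0) * Real.cos (x 0) * v 0)) * Real.sin_sq_add_cos_sq (x 1)

theorem cross_hemiMap (x : E2) :
    cross (hemiMap x) (fderiv ℝ hemiMap x (EuclideanSpace.single 0 1))
      (fderiv ℝ hemiMap x (EuclideanSpace.single 1 1)) =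
    (-Real.cos (x 0)) • EuclideanSpace.single 1 1 := by
  rw [fderiv_hemiMap, fderiv_hemiMap]
  apply E4_ext
  · rw [cross_zero]; simp [hemiMap]
  · rw [cross_one]
    simp [hemiMap]
    linear_combination (-(Real.sin (x 0) ^ 2 * Real.cos (x 0)) - Real.cos (x 0) ^ 3) *
      Real.sin_sq_add_cos_sq (x 1) - Real.cos (x 0) * Real.sin_sq_add_cos_sq (x 0)
  · rw [cross_two]; simp [hemiMap]
  · rw [cross_three]; simp [hemiMap]

theorem single_mem_unitNormals {p : E4} (hp : p ∈ halfSphere) :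
    EuclideanSpace.single 1 1 ∈ unitNormals halfSphere p := by
  refine ⟨by simp, by simp [hp.2.1, inner_E4], fun v hv => ?_⟩
  have hle : tangentPlane halfSphere p ≤ (EuclideanSpace.proj 1 : E4 →L[ℝ] ℝ).ker := by
    refine Submodule.span_le.2 fun v hv => ?_
    have h1 : HasFDerivWithinAt (fun q : E4 => q 1) (EuclideanSpace.proj 1 : E4 →L[ℝ] ℝ)
        halfSphere p := (EuclideanSpace.proj 1 : E4 →L[ℝ] ℝ).hasFDerivAt.hasFDerivWithinAt
    have h2 : HasFDerivWithinAt (fun q : E4 => q 1) (0 : E4 →L[ℝ] ℝ) halfSphere p :=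
      (hasFDerivWithinAt_const (0 : ℝ) p halfSphere).congr (fun q hq => hq.2.1) hp.2.1
    exact h1.unique_on h2 hv
  have : v 1 = 0 := hle hv
  simp [inner_E4, this]

theorem fderiv_hemiMap_mem_tangentPlane {x : E2} (hx : x ∈ hemiDomain) (v : E2) :
    fderiv ℝ hemiMap x v ∈ tangentPlane halfSphere (hemiMap x) := by
  set D : Set E2 := {x | x 0 ∈ Ioo 0 (Real.pi / 2)} with hDdef
  have hD : IsOpen D := isOpen_Ioo.preimage (PiLp.continuous_apply 2 _ 0)
  have h1 := ((contDiff_hemiMap.differentiable one_ne_zero x).hasFDerivAt.hasFDerivWithinAt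
    (s := D)).mapsTo_tangent_cone
  rw [tangentConeAt_of_mem_nhds (hD.mem_nhds hx.1)] at h1
  refine Submodule.subset_span (tangentConeAt_mono ?_ (h1 (mem_univ v)))
  rintro _ ⟨y, hy, rfl⟩
  refine ⟨hemiMap_mem_sphere3 y, rfl, ?_⟩
  exact Real.sin_nonneg_of_nonneg_of_le_pi hy.1.le (by linarith [hy.2, Real.pi_pos])

theorem normNh_halfSphere {x : E2} (hx : x ∈ hemiDomain) :
    normNh halfSphere (hemiMap x) = ENNReal.ofReal (Real.cos (x 0)) := by
  have hc := cos_pos_of_mem hx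
  have hp : ‖hemiMap x‖ = 1 := by simpa [sphere3] using hemiMap_mem_sphere3 x
  have key : ∀ m ∈ unitNormals halfSphere (hemiMap x),
      ‖horizontalPart (hemiMap x) m‖ =
        ‖horizontalPart (hemiMap x) (EuclideanSpace.single 1 1)‖ := by
    intro m hm
    have h1 := cross_eq_inner_smul hp (inner_fderiv_hemiMap x (EuclideanSpace.single 0 1))
      (inner_fderiv_hemiMap x (EuclideanSpace.single 1 1)) hm.1 hm.2.1
      (hm.2.2 _ (fderiv_hemiMap_mem_tangentPlane hx _))
      (hm.2.2 _ (fderiv_hemiMap_mem_tangentPlane hx _))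
    rw [cross_hemiMap] at h1
    have h2 := congrArg norm h1
    rw [norm_smul, norm_smul, hm.1] at h2
    have h3 := congrArg (fun v => ‖horizontalPart (hemiMap x) v‖) h1
    simp only [horizontalPart_smul, norm_smul] at h3
    rw [← mul_one ‖⟪_, m⟫_ℝ‖, ← h2] at h3
    simp only [PiLp.norm_single, norm_one, mul_one, norm_neg, Real.norm_eq_abs] at h3
    exact (mul_left_cancel₀ (abs_pos.2 hc.ne').ne' h3).symm
  have hval : ‖horizontalPart (hemiMap x) (EuclideanSpace.single 1 1)‖ = Real.cos (x 0) := by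
    rw [← sq_eq_sq₀ (norm_nonneg _) hc.le, norm_sq_E4]
    simp only [horizontalPart, inner_E4, hopf_apply, PiLp.sub_apply, PiLp.smul_apply, smul_eq_mul]
    simp [hemiMap]
    have h0 := Real.sin_sq_add_cos_sq (x 0)
    linear_combination Real.sin (x 0) ^ 2 * Real.cos (x 0) ^ 2 * Real.sin_sq_add_cos_sq (x 1)
      + (Real.sin (x 0) ^ 2 - 1) * h0
  rw [← hval, ofReal_norm]
  refine le_antisymm (iSup₂_le fun m hm => ?_) (le_iSup₂
    (f := fun m (_ : m ∈ unitNormals halfSphere (hemiMap x)) => ‖horizontalPart (hemiMap x) m‖ₑ)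
    _ (single_mem_unitNormals (image_hemiMap_subset ⟨x, hx, rfl⟩)))
  rw [← ofReal_norm, ← ofReal_norm, key m hm]

theorem area_halfSphere : area halfSphere = ENNReal.ofReal (Real.pi ^ 2 / 2) := by
  have h1 : area halfSphere =
      ∫⁻ p in hemiMap '' hemiDomain, normNh halfSphere p ∂(μHE[2] : Measure E4) := by
    refine setLIntegral_congr ?_
    refine EventuallyLE.antisymm (ae_le_set.2 ?_) (LE.le.eventuallyLE image_hemiMap_subset)
    exact measure_mono_null halfSphere_diff_subset measure_circleC0_union
  have h2 := lintegral_image_eq_lintegral_normDet_mul (f := hemiMap) (f' := fderiv ℝ hemiMap)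
    measurableSet_hemiDomain
    (fun x _ => contDiff_hemiMap.contDiffAt.hasStrictFDerivAt one_ne_zero)
    (contDiff_hemiMap.continuous_fderiv one_ne_zero).continuousOn
    (fun x hx => injective_fderiv_hemiMap hx) injOn_hemiMap (normNh halfSphere)
  rw [finrank_euclideanSpace_fin] at h2
  rw [h1, h2]
  have h3 : ∀ x ∈ hemiDomain, ENNReal.ofReal (fderiv ℝ hemiMap x).toLinearMap.normDet *
      normNh halfSphere (hemiMap x) = ENNReal.ofReal (Real.cos (x 0) ^ 2) := by
    intro x hx
    have hc := cos_pos_of_mem hx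
    have hp : ‖hemiMap x‖ = 1 := by simpa [sphere3] using hemiMap_mem_sphere3 x
    rw [normNh_halfSphere hx, normDet_eq_norm_cross _ hp (inner_fderiv_hemiMap x), cross_hemiMap,
      norm_smul, norm_neg, Real.norm_eq_abs, abs_of_pos hc, ← ENNReal.ofReal_mul (by positivity)]
    simp [sq]
  rw [setLIntegral_congr_fun measurableSet_hemiDomain h3,
    ← measurePreserving_planeEquiv.setLIntegral_comp_preimage_emb planeEquiv.measurableEmbedding]
  have h4 : planeEquiv ⁻¹' hemiDomain = Ioo 0 (Real.pi / 2) ×ˢ Ioc (-Real.pi) Real.pi := by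
    ext z
    simp [planeEquiv_apply, hemiDomain]
  have h5 : ∫⁻ s in Ioo 0 (Real.pi / 2), ENNReal.ofReal (Real.cos s ^ 2) =
      ENNReal.ofReal (Real.pi / 4) := by
    rw [← ofReal_integral_eq_lintegral_ofReal _ (ae_of_all _ fun s => sq_nonneg _),
      ← integral_Ioc_eq_integral_Ioo, ← intervalIntegral.integral_of_le (by positivity),
      integral_cos_sq]
    · congr 1
      simp
      ring
    · exact (Real.continuous_cos.pow 2).integrableOn_Icc.mono_set Ioo_subset_Icc_self
  rw [h4, Measure.volume_eq_prod, ← Measure.prod_restrict]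
  have h6 := lintegral_prod_mul (μ := volume.restrict (Ioo 0 (Real.pi / 2)))
    (ν := volume.restrict (Ioc (-Real.pi) Real.pi))
    (f := fun s => ENNReal.ofReal (Real.cos s ^ 2)) (g := fun _ => 1)
    (by fun_prop) aemeasurable_const
  simp only [mul_one, lintegral_const, one_mul, Measure.restrict_apply MeasurableSet.univ,
    univ_inter, Real.volume_Ioc] at h6
  refine h6.trans ?_
  rw [h5, ← ENNReal.ofReal_mul (by positivity)]
  congr 1
  ring

/-! ### Equality in the calibration inequality -/

namespace SurfacePatch

variable {S : Set E4} (P : SurfacePatch S)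

theorem measure_image_pos (hS : S ⊆ sphere3) {A : Set E2} (hA : IsOpen A)
    (hAU : A ⊆ P.U ∩ halfPlane) (hne : A.Nonempty) : 0 < (μHE[2] : Measure E4) (P.φ '' A) := by
  have h := lintegral_image_eq_lintegral_normDet_mul (f := P.φ) (f' := fderiv ℝ P.φ)
    hA.measurableSet (fun x hx => P.hasStrictFDerivAt (hAU hx).1)
    (P.continuousOn_fderiv.mono fun x hx => (hAU hx).1) (fun x hx => P.injective x (hAU hx).1)
    (P.injOn.mono hAU) (fun _ => 1)
  rw [finrank_euclideanSpace_fin, setLIntegral_one] at h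
  rw [h, pos_iff_ne_zero]
  simp only [mul_one]
  have hc : ContinuousOn (fun x => (fderiv ℝ P.φ x).toLinearMap.normDet) A :=
    continuous_normDet.comp_continuousOn (P.continuousOn_fderiv.mono fun x hx => (hAU hx).1)
  intro h0
  rw [lintegral_eq_zero_iff' (hc.aemeasurable hA.measurableSet).ennreal_ofReal,
    EventuallyEq, ae_restrict_iff' hA.measurableSet, ae_iff] at h0
  refine (hA.measure_pos volume hne).ne' (measure_mono_null (fun x hx => ?_) h0)
  refine fun hx0 => (ENNReal.ofReal_pos.2 (P.norm_normal_pos hS (hAU hx))).ne' ?_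
  rw [← P.normDet_eq hS (hAU hx)]
  exact hx0 hx

/-- Moving inwards from any point of the domain leads to interior points. -/
theorem tendsto_inward (x : E2) :
    Tendsto (fun t : ℝ => x + t • EuclideanSpace.single (0 : Fin 2) (1 : ℝ)) (𝓝[>] 0) (𝓝 x) := by
  have : Continuous fun t : ℝ => x + t • EuclideanSpace.single (0 : Fin 2) (1 : ℝ) := by fun_prop
  simpa using (this.tendsto 0).mono_left nhdsWithin_le_nhds

end SurfacePatch

/-- A continuous function that vanishes almost everywhere on a surface vanishes. -/
theorem eq_zero_of_ae_eq_zero {S : Set E4} (hsurf : IsC2Surface S) (hSm : MeasurableSet S)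
    {f : E4 → ℝ} (hae : ∀ᵐ p ∂(μHE[2] : Measure E4).restrict S, f p = 0) {p : E4} (hp : p ∈ S)
    (hf : ContinuousWithinAt f S p) : f p = 0 := by
  by_contra hfp
  obtain ⟨P, hP⟩ := exists_surfacePatch hsurf hp
  obtain ⟨x, hx, rfl⟩ := P.exists_φ_eq ⟨hp, hP⟩
  obtain ⟨V, hV, hxV, hVf⟩ := mem_nhdsWithin.1 (hf.eventually_ne hfp)
  have hB : IsOpen (P.U ∩ P.φ ⁻¹' V) := P.continuousOn_φ.isOpen_inter_preimage P.isOpen_U hV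
  set A : Set E2 := (P.U ∩ P.φ ⁻¹' V) ∩ {y | 0 < y 0} with hAdef
  have hA : IsOpen A := hB.inter (isOpen_lt continuous_const (PiLp.continuous_apply 2 _ 0))
  have hAU : A ⊆ P.U ∩ halfPlane := fun y hy => ⟨hy.1.1, (mem_ofPred.1 hy.2).le⟩
  have hne : A.Nonempty := by
    obtain ⟨t, ht, ht0⟩ := (((SurfacePatch.tendsto_inward x).eventually
      (hB.mem_nhds ⟨hx.1, hxV⟩)).and self_mem_nhdsWithin).exists
    refine ⟨_, ht, ?_⟩
    have h1 : 0 ≤ x 0 := hx.2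
    have h2 : 0 < t := ht0
    have : (x + t • EuclideanSpace.single (0 : Fin 2) (1 : ℝ)) 0 = x 0 + t := by simp
    rw [mem_ofPred, this]
    linarith
  have h0 := (ae_restrict_iff' hSm).1 hae
  rw [ae_iff] at h0
  refine (P.measure_image_pos hsurf.1 hA hAU hne).ne' (measure_mono_null ?_ h0)
  rintro _ ⟨y, hy, rfl⟩
  have hyS := (P.φ_mem (hAU hy)).1
  exact fun h => hVf ⟨hy.1.2, hyS⟩ (h hyS)

/-- A surface of minimal area is calibrated: the horizontal part of its normal is a nonnegative
multiple of the calibrating field. -/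
theorem exists_calibrated_normal {S : Set E4} (hsurf : IsC2Surface S) (hcomp : IsCompact S)
    (hbdry : surfaceBoundary S = circleC0) (hseg : ContainsOrthogonalSegments S)
    (horient : IsOrientableSurface S) (harea : area S ≤ ENNReal.ofReal (Real.pi ^ 2 / 2)) :
    ∃ N : E4 → E4, ContinuousOn N S ∧ (∀ p ∈ S, N p ∈ unitNormals S p) ∧
      ∀ p ∈ S, √(radSq₁ p * radSq₂ p) • horizontalPart p (N p) =
        ‖horizontalPart p (N p)‖ • calibField p := by
  obtain ⟨N, hN, hN', hint, hflux⟩ := exists_normal_flux hsurf hcomp hbdry hseg horient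
  refine ⟨N, hN, hN', fun p hp => ?_⟩
  have hNh := continuousOn_horizontalPart hN
  rw [area_eq hsurf hcomp hN hN', ENNReal.ofReal_le_ofReal_iff (by positivity), ← hflux] at harea
  have hle : ∀ᵐ q ∂(μHE[2] : Measure E4).restrict S,
      ⟪N q, calibField q⟫_ℝ * (√(radSq₁ q * radSq₂ q))⁻¹ ≤ ‖horizontalPart q (N q)‖ :=
    ae_restrict_of_forall_mem hcomp.measurableSet fun q hq =>
      inner_calibField_le (hsurf.1 hq) (N q)
  have hintN := integrableOn_surface hsurf hcomp hNh.norm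
  have hae := (integral_eq_iff_of_ae_le hint hintN hle).1
    (le_antisymm (integral_mono_ae hint hintN hle) harea)
  have hnorm := norm_calibField (hsurf.1 hp)
  rcases (Real.sqrt_nonneg (radSq₁ p * radSq₂ p)).eq_or_lt with h | h
  · rw [← h] at hnorm ⊢
    rw [norm_eq_zero.1 hnorm, zero_smul, smul_zero]
  have hcont : ContinuousWithinAt (fun q => ⟪N q, calibField q⟫_ℝ * (√(radSq₁ q * radSq₂ q))⁻¹ -
      ‖horizontalPart q (N q)‖) S p := by
    have h1 : ContinuousWithinAt (fun q => √(radSq₁ q * radSq₂ q)) S p :=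
      ((continuous_radSq₁.mul continuous_radSq₂).sqrt).continuousWithinAt
    exact (((hN p hp).inner continuous_calibField.continuousWithinAt).mul (h1.inv₀ h.ne')).sub
      (hNh p hp).norm
  have hzero := eq_zero_of_ae_eq_zero hsurf hcomp.measurableSet
    (hae.mono fun q hq => sub_eq_zero.2 hq) hp hcont
  rw [sub_eq_zero, ← div_eq_mul_inv, div_eq_iff h.ne', ← inner_horizontalPart_calibField,
    ← hnorm] at hzero
  rw [← hnorm]
  exact inner_eq_norm_mul_iff_real.1 hzero

/-! ### Meridians -/

/-- The horizontal field `(|z₂|² z₁, -|z₁|² z₂)`, tangent to the great circles that meet the circles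
`z₁ = 0` and `z₂ = 0` orthogonally. -/
def radialField (p : E4) : E4 :=
  !₂[radSq₂ p * p 0, radSq₂ p * p 1, -(radSq₁ p * p 2), -(radSq₁ p * p 3)]

theorem inner_radialField_self (p : E4) : ⟪radialField p, p⟫_ℝ = 0 := by
  rw [inner_E4]
  change (radSq₂ p * p 0) * p 0 + (radSq₂ p * p 1) * p 1 + -(radSq₁ p * p 2) * p 2
    + -(radSq₁ p * p 3) * p 3 = 0
  unfold radSq₁ radSq₂
  ring

theorem inner_radialField_hopf (p : E4) : ⟪radialField p, hopf p⟫_ℝ = 0 := by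
  rw [inner_E4]
  change (radSq₂ p * p 0) * (-p 1) + (radSq₂ p * p 1) * p 0 + -(radSq₁ p * p 2) * (-p 3)
    + -(radSq₁ p * p 3) * p 2 = 0
  ring

theorem inner_radialField_calibField (p : E4) : ⟪radialField p, calibField p⟫_ℝ = 0 := by
  rw [inner_E4]
  change (radSq₂ p * p 0) * (-(radSq₂ p * p 1)) + (radSq₂ p * p 1) * (radSq₂ p * p 0)
    + -(radSq₁ p * p 2) * (radSq₁ p * p 3) + -(radSq₁ p * p 3) * (-(radSq₁ p * p 2)) = 0
  ring

/-- The radial field is tangent to a calibrated surface. -/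
theorem inner_radialField_eq_zero {p n : E4} (hu : 0 < radSq₁ p * radSq₂ p)
    (hcal : √(radSq₁ p * radSq₂ p) • horizontalPart p n = ‖horizontalPart p n‖ • calibField p) :
    ⟪radialField p, n⟫_ℝ = 0 := by
  have h1 : ⟪radialField p, n⟫_ℝ = ⟪radialField p, horizontalPart p n⟫_ℝ := by
    rw [horizontalPart, inner_sub_right, inner_smul_right, inner_radialField_hopf, mul_zero,
      sub_zero]
  have h2 := congrArg (fun v => ⟪radialField p, v⟫_ℝ) hcal
  simp only [inner_smul_right, inner_radialField_calibField, mul_zero] at h2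
  rw [h1]
  exact (mul_eq_zero.1 h2).resolve_left (Real.sqrt_pos.2 hu).ne'

namespace SurfacePatch

variable {S : Set E4} (P : SurfacePatch S)

theorem exists_fderiv_eq (hS : S ⊆ sphere3) {x : E2} (hx : x ∈ P.U ∩ halfPlane) {n v : E4}
    (hn : n ∈ unitNormals S (P.φ x)) (hv : ⟪v, P.φ x⟫_ℝ = 0) (hvn : ⟪v, n⟫_ℝ = 0) :
    ∃ ξ : E2, fderiv ℝ P.φ x ξ = v := by
  set a := fderiv ℝ P.φ x (EuclideanSpace.single 0 1) with ha
  set b := fderiv ℝ P.φ x (EuclideanSpace.single 1 1) with hb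
  set ν := P.normal x with hν
  have hpn := P.norm_φ hS hx
  have hap := P.inner_fderiv_self hS hx (EuclideanSpace.single 0 1)
  have hbp := P.inner_fderiv_self hS hx (EuclideanSpace.single 1 1)
  have hνp : ⟪ν, P.φ x⟫_ℝ = 0 := by
    rw [real_inner_comm]
    exact inner_cross_left _ _ _
  have hvν : ⟪v, ν⟫_ℝ = 0 := by
    rw [hν, P.normal_eq_smul hS hx hn, inner_smul_right, hvn, mul_zero]
  -- the double cross product with the normal is a multiple of the identity on the tangent plane
  have h1 := cross_cross ν hpn hv hνp
  rw [hvν, zero_smul, zero_sub, real_inner_self_eq_norm_sq] at h1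
  have h2 := cross_cross (cross (P.φ x) v ν) hpn hap hbp
  have h3 : cross (P.φ x) ν (cross (P.φ x) v ν) = ‖ν‖ ^ 2 • v := by
    rw [← neg_neg (‖ν‖ ^ 2 • v), ← h1]
    apply E4_ext <;> simp only [PiLp.neg_apply, cross_zero, cross_one, cross_two, cross_three] <;>
      ring
  have hpos : (0 : ℝ) < ‖ν‖ ^ 2 := pow_pos (P.norm_normal_pos hS hx) 2
  refine ⟨(‖ν‖ ^ 2)⁻¹ • (⟪a, cross (P.φ x) v ν⟫_ℝ • EuclideanSpace.single 1 1
    - ⟪b, cross (P.φ x) v ν⟫_ℝ • EuclideanSpace.single 0 1), ?_⟩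
  rw [map_smul, map_sub, map_smul, map_smul, inv_smul_eq_iff₀ hpos.ne', ← h3]
  exact h2.symm

/-- Integral curves of a field tangent to the surface stay in the surface as long as they do not
reach its boundary. -/
theorem eventually_mem_of_tangent {X : E4 → E4} {γ : ℝ → E4} {x : E2} {t₀ : ℝ} (hx : x ∈ P.U)
    (hx0 : 0 < x 0) (hX : ContDiffAt ℝ 1 X (P.φ x))
    (htan : ∀ᶠ y in 𝓝 x, ∃ ξ, fderiv ℝ P.φ y ξ = X (P.φ y)) (hγ0 : γ t₀ = P.φ x)
    (hγ : ∀ᶠ t in 𝓝 t₀, HasDerivAt γ (X (γ t)) t) : ∀ᶠ t in 𝓝 t₀, γ t ∈ S := by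
  obtain ⟨K0, hK0⟩ := (fderiv ℝ P.φ x).toLinearMap.exists_leftInverse_of_injective
    (LinearMap.ker_eq_bot.2 (P.injective x hx))
  set K : E4 →L[ℝ] E2 := K0.toContinuousLinearMap with hK
  have hKA : K.comp (fderiv ℝ P.φ x) = (ContinuousLinearEquiv.refl ℝ E2 : E2 →L[ℝ] E2) :=
    ContinuousLinearMap.ext fun v => LinearMap.congr_fun hK0 v
  have hU := P.isOpen_U.mem_nhds hx
  have hφ : ContDiffAt ℝ 1 P.φ x := (P.contDiffOn.contDiffAt hU).of_le (by norm_num)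
  -- `ξ` is the pull-back of the field `X` to the parameter domain
  set G : E2 → E2 →L[ℝ] E2 := fun y => K.comp (fderiv ℝ P.φ y) with hG
  have hGC : ContDiffAt ℝ 1 G x :=
    contDiffAt_const.clm_comp (P.contDiffOn_fderiv.contDiffAt hU)
  have hinv : ContDiffAt ℝ 1 (fun y => (G y).inverse) x := by
    have h1 := contDiffAt_map_inverse (n := 1) (ContinuousLinearEquiv.refl ℝ E2)
    rw [← hKA] at h1
    exact h1.comp x hGC
  set ξ : E2 → E2 := fun y => (G y).inverse (K (X (P.φ y))) with hξ
  have hξC : ContDiffAt ℝ 1 ξ x :=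
    hinv.clm_apply (K.contDiff.contDiffAt.comp x (hX.comp x hφ))
  obtain ⟨y, hy0, ε, hε, hy⟩ := hξC.exists_forall_mem_closedBall_exists_eq_forall_mem_Ioo_hasDerivAt₀ t₀
  have hyc : ContinuousAt y t₀ := (hy t₀ ⟨by linarith, by linarith⟩).continuousAt
  have hunit : ∀ᶠ z in 𝓝 x, IsUnit (G z) := by
    refine hGC.continuousAt.eventually (Units.isOpen.mem_nhds ?_)
    change IsUnit (K.comp (fderiv ℝ P.φ x))
    rw [hKA]
    exact isUnit_one
  have hgood : ∀ᶠ z in 𝓝 x, z ∈ P.U ∩ halfPlane ∧ fderiv ℝ P.φ z (ξ z) = X (P.φ z) := by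
    filter_upwards [hU, hunit, htan, (isOpen_lt continuous_const
      (PiLp.continuous_apply 2 (fun _ : Fin 2 => ℝ) 0)).mem_nhds hx0] with z hz hzu ⟨η, hη⟩ hz0
    refine ⟨⟨hz, le_of_lt hz0⟩, ?_⟩
    have h1 : ξ z = η := by
      change (G z).inverse (K (X (P.φ z))) = η
      rw [← hη]
      change (G z).inverse (G z η) = η
      obtain ⟨e, he⟩ := hzu
      have he' : (ContinuousLinearEquiv.unitsEquiv ℝ E2 e : E2 →L[ℝ] E2) = G z := he
      rw [← he', ContinuousLinearMap.inverse_equiv]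
      exact (ContinuousLinearEquiv.unitsEquiv ℝ E2 e).symm_apply_apply η
    rw [h1, hη]
  rw [← hy0] at hgood
  obtain ⟨C, s, hs, hLip⟩ := hX.exists_lipschitzOnWith
  have hφy : ContinuousAt (fun t => P.φ (y t)) t₀ := by
    have : ContinuousAt P.φ (y t₀) := hy0 ▸ hφ.continuousAt
    exact this.comp hyc
  have hsol : ∀ᶠ t in 𝓝 t₀, HasDerivAt (fun t => P.φ (y t)) (X (P.φ (y t))) t ∧ P.φ (y t) ∈ s := by
    filter_upwards [hyc.eventually hgood, Ioo_mem_nhds (show t₀ - ε < t₀ by linarith)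
      (show t₀ < t₀ + ε by linarith), hφy.eventually (show s ∈ 𝓝 (P.φ (y t₀)) from hy0 ▸ hs)]
      with t ht htε hts
    refine ⟨?_, hts⟩
    rw [← ht.2]
    exact (P.hasFDerivAt ht.1.1).comp_hasDerivAt t (hy t htε)
  have hγs : ∀ᶠ t in 𝓝 t₀, HasDerivAt γ (X (γ t)) t ∧ γ t ∈ s :=
    hγ.and (hγ.self_of_nhds.continuousAt.eventually (hγ0.symm ▸ hs))
  have heq := ODE_solution_unique_of_eventually (v := fun _ => X) (s := fun _ => s)
    (Eventually.of_forall fun _ => hLip) hγs hsol (by rw [hγ0, hy0])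
  filter_upwards [heq, hyc.eventually hgood] with t ht hty
  rw [ht]
  exact (P.φ_mem hty.1).1

end SurfacePatch

/-- The great circle `C₁ = 𝕊¹ × {0}`. -/
def circleC1 : Set E4 := {p | p ∈ sphere3 ∧ p 2 = 0 ∧ p 3 = 0}

theorem mem_circleC1_iff {p : E4} :
    p ∈ circleC1 ↔ p 0 ^ 2 + p 1 ^ 2 = 1 ∧ p 2 = 0 ∧ p 3 = 0 := by
  rw [circleC1, mem_ofPred, mem_sphere3_iff]
  constructor
  · rintro ⟨h1, h2, h3⟩
    exact ⟨by simpa [h2, h3] using h1, h2, h3⟩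
  · rintro ⟨h1, h2, h3⟩
    exact ⟨by simpa [h2, h3] using h1, h2, h3⟩

/-- The great circle through `W` and `U`, for orthonormal `W` and `U`. -/
def meridian (W U : E4) (a : ℝ) : E4 := Real.cos a • W + Real.sin a • U

theorem continuous_meridian (W U : E4) : Continuous (meridian W U) := by
  unfold meridian
  fun_prop

theorem hasDerivAt_meridian (W U : E4) (a : ℝ) :
    HasDerivAt (meridian W U) (-Real.sin a • W + Real.cos a • U) a :=
  ((Real.hasDerivAt_cos a).smul_const W).fun_add ((Real.hasDerivAt_sin a).smul_const U)

section Coordinates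

variable {W U : E4} (hW : W ∈ circleC0) (hU : U ∈ circleC1) (a : ℝ)
include hW hU

theorem meridian_apply : meridian W U a 0 = Real.sin a * U 0 ∧ meridian W U a 1 = Real.sin a * U 1 ∧
    meridian W U a 2 = Real.cos a * W 2 ∧ meridian W U a 3 = Real.cos a * W 3 := by
  obtain ⟨w0, w1, -⟩ := mem_circleC0_iff.1 hW
  obtain ⟨-, u2, u3⟩ := mem_circleC1_iff.1 hU
  simp [meridian, w0, w1, u2, u3]

theorem radSq₁_meridian : radSq₁ (meridian W U a) = Real.sin a ^ 2 := by
  obtain ⟨h0, h1, -, -⟩ := meridian_apply hW hU a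
  rw [radSq₁, h0, h1]
  linear_combination Real.sin a ^ 2 * (mem_circleC1_iff.1 hU).1

theorem radSq₂_meridian : radSq₂ (meridian W U a) = Real.cos a ^ 2 := by
  obtain ⟨-, -, h2, h3⟩ := meridian_apply hW hU a
  rw [radSq₂, h2, h3]
  linear_combination Real.cos a ^ 2 * (mem_circleC0_iff.1 hW).2.2

theorem calibField_meridian : calibField (meridian W U a) =
    (Real.sin a * Real.cos a) • (Real.cos a • rotate U - Real.sin a • hopf W) := by
  obtain ⟨h0, h1, h2, h3⟩ := meridian_apply hW hU a
  obtain ⟨w0, w1, -⟩ := mem_circleC0_iff.1 hW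
  rw [calibField, radSq₁_meridian hW hU, radSq₂_meridian hW hU, h0, h1, h2, h3]
  apply E4_ext <;> simp [rotate, hopf, w0, w1] <;> ring

theorem radialField_meridian : radialField (meridian W U a) =
    (Real.sin a * Real.cos a) • (-Real.sin a • W + Real.cos a • U) := by
  obtain ⟨h0, h1, h2, h3⟩ := meridian_apply hW hU a
  obtain ⟨w0, w1, -⟩ := mem_circleC0_iff.1 hW
  obtain ⟨-, u2, u3⟩ := mem_circleC1_iff.1 hU
  rw [radialField, radSq₁_meridian hW hU, radSq₂_meridian hW hU, h0, h1, h2, h3]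
  apply E4_ext <;> simp [w0, w1, u2, u3] <;> ring

end Coordinates

theorem sin_pos_cos_pos {a : ℝ} (ha : a ∈ Ioo 0 (Real.pi / 2)) : 0 < Real.sin a ∧ 0 < Real.cos a :=
  ⟨Real.sin_pos_of_pos_of_lt_pi ha.1 (by linarith [ha.2, Real.pi_pos]),
    Real.cos_pos_of_mem_Ioo ⟨by linarith [ha.1, Real.pi_pos], ha.2⟩⟩

theorem sqrt_meridian {W U : E4} (hW : W ∈ circleC0) (hU : U ∈ circleC1) {a : ℝ}
    (ha : a ∈ Ioo 0 (Real.pi / 2)) :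
    √(radSq₁ (meridian W U a) * radSq₂ (meridian W U a)) = Real.sin a * Real.cos a := by
  obtain ⟨hs, hc⟩ := sin_pos_cos_pos ha
  rw [radSq₁_meridian hW hU, radSq₂_meridian hW hU, ← mul_pow, Real.sqrt_sq (mul_pos hs hc).le]

/-- The radial field of unit length. -/
def unitRadialField (p : E4) : E4 := (√(radSq₁ p * radSq₂ p))⁻¹ • radialField p

theorem contDiffAt_unitRadialField {p : E4} (hp : 0 < radSq₁ p * radSq₂ p) :
    ContDiffAt ℝ 1 unitRadialField p := by
  have hc : ∀ i : Fin 4, ContDiff ℝ 1 fun p : E4 => p i := fun i =>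
    (EuclideanSpace.proj i : E4 →L[ℝ] ℝ).contDiff
  have h1 : ContDiff ℝ 1 radSq₁ := ((hc 0).pow 2).add ((hc 1).pow 2)
  have h2 : ContDiff ℝ 1 radSq₂ := ((hc 2).pow 2).add ((hc 3).pow 2)
  have hR : ContDiff ℝ 1 radialField := by
    rw [contDiff_euclidean]
    intro i
    fin_cases i
    · exact h2.mul (hc 0)
    · exact h2.mul (hc 1)
    · exact (h1.mul (hc 2)).neg
    · exact (h1.mul (hc 3)).neg
  have hs : ContDiffAt ℝ 1 (fun p => (√(radSq₁ p * radSq₂ p))⁻¹) p :=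
    ContDiffAt.inv ((h1.mul h2).contDiffAt.sqrt hp.ne') (Real.sqrt_pos.2 hp).ne'
  exact hs.smul hR.contDiffAt

theorem unitRadialField_meridian {W U : E4} (hW : W ∈ circleC0) (hU : U ∈ circleC1) {a : ℝ}
    (ha : a ∈ Ioo 0 (Real.pi / 2)) :
    unitRadialField (meridian W U a) = -Real.sin a • W + Real.cos a • U := by
  obtain ⟨hs, hc⟩ := sin_pos_cos_pos ha
  rw [unitRadialField, sqrt_meridian hW hU ha, radialField_meridian hW hU,
    inv_smul_smul₀ (mul_pos hs hc).ne']

/-- Points off `C₀` and `C₁` lie on a meridian. -/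
theorem exists_meridian_eq {p : E4} (hp : p ∈ sphere3) (h1 : 0 < radSq₁ p) (h2 : 0 < radSq₂ p) :
    ∃ W ∈ circleC0, ∃ U ∈ circleC1, ∃ a ∈ Ioo 0 (Real.pi / 2), p = meridian W U a ∧
      p 0 = √(radSq₁ p) * U 0 ∧ p 1 = √(radSq₁ p) * U 1 := by
  have hsum := radSq_add hp
  have hs1 := Real.sqrt_pos.2 h1
  have hs2 := Real.sqrt_pos.2 h2
  set U : E4 := !₂[p 0 / √(radSq₁ p), p 1 / √(radSq₁ p), 0, 0] with hUdef
  set W : E4 := !₂[0, 0, p 2 / √(radSq₂ p), p 3 / √(radSq₂ p)] with hWdef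
  have hU : U ∈ circleC1 := by
    refine mem_circleC1_iff.2 ⟨?_, rfl, rfl⟩
    change (p 0 / √(radSq₁ p)) ^ 2 + (p 1 / √(radSq₁ p)) ^ 2 = 1
    rw [div_pow, div_pow, Real.sq_sqrt h1.le, ← add_div]
    exact div_self h1.ne'
  have hW : W ∈ circleC0 := by
    refine mem_circleC0_iff.2 ⟨rfl, rfl, ?_⟩
    change (p 2 / √(radSq₂ p)) ^ 2 + (p 3 / √(radSq₂ p)) ^ 2 = 1
    rw [div_pow, div_pow, Real.sq_sqrt h2.le, ← add_div]
    exact div_self h2.ne'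
  have hlt : √(radSq₁ p) < 1 := by
    rw [Real.sqrt_lt' one_pos]
    linarith
  have hsin : Real.sin (Real.arcsin (√(radSq₁ p))) = √(radSq₁ p) :=
    Real.sin_arcsin (by linarith) hlt.le
  have hcos : Real.cos (Real.arcsin (√(radSq₁ p))) = √(radSq₂ p) := by
    rw [Real.cos_arcsin, Real.sq_sqrt h1.le]
    congr 1
    linarith
  have e0 : p 0 = √(radSq₁ p) * U 0 := (mul_div_cancel₀ _ hs1.ne').symm
  have e1 : p 1 = √(radSq₁ p) * U 1 := (mul_div_cancel₀ _ hs1.ne').symm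
  have e2 : p 2 = √(radSq₂ p) * W 2 := (mul_div_cancel₀ _ hs2.ne').symm
  have e3 : p 3 = √(radSq₂ p) * W 3 := (mul_div_cancel₀ _ hs2.ne').symm
  refine ⟨W, hW, U, hU, Real.arcsin (√(radSq₁ p)),
    ⟨Real.arcsin_pos.2 hs1, Real.arcsin_lt_pi_div_two.2 hlt⟩, ?_, e0, e1⟩
  obtain ⟨m0, m1, m2, m3⟩ := meridian_apply hW hU (Real.arcsin (√(radSq₁ p)))
  apply E4_ext
  · rw [m0, hsin, ← e0]
  · rw [m1, hsin, ← e1]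
  · rw [m2, hcos, ← e2]
  · rw [m3, hcos, ← e3]

section Calibrated

variable {S : Set E4} (hsurf : IsC2Surface S) (hclosed : IsClosed S)
  (hbdry : surfaceBoundary S = circleC0) {N : E4 → E4} (hN : ContinuousOn N S)
  (hN' : ∀ p ∈ S, N p ∈ unitNormals S p)
  (hcal : ∀ p ∈ S, √(radSq₁ p * radSq₂ p) • horizontalPart p (N p) =
    ‖horizontalPart p (N p)‖ • calibField p)

include hbdry in
theorem SurfacePatch.coord_pos (P : SurfacePatch S) {x : E2} (hx : x ∈ P.U ∩ halfPlane)
    (h : P.φ x ∉ circleC0) : 0 < x 0 :=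
  lt_of_le_of_ne hx.2 fun h0 => h (hbdry ▸ P.φ_mem_boundary hx.1 h0.symm)

include hsurf hclosed hbdry hN' hcal in
/-- A calibrated surface is a union of meridians. -/
theorem meridian_mem {W U : E4} (hW : W ∈ circleC0) (hU : U ∈ circleC1) {a₀ : ℝ}
    (ha₀ : a₀ ∈ Ioo 0 (Real.pi / 2)) (hmem : meridian W U a₀ ∈ S) :
    ∀ a ∈ Icc 0 (Real.pi / 2), meridian W U a ∈ S := by
  have hcont := continuous_meridian W U
  set u : Set ℝ := {a | a ∈ Ioo 0 (Real.pi / 2) ∧ meridian W U a ∈ S} with hu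
  have hopen : IsOpen u := by
    rw [isOpen_iff_mem_nhds]
    rintro a ⟨ha, haS⟩
    obtain ⟨P, hP⟩ := exists_surfacePatch hsurf haS
    obtain ⟨x, hx, hxa⟩ := P.exists_φ_eq ⟨haS, hP⟩
    obtain ⟨hs, hc⟩ := sin_pos_cos_pos ha
    have hpos : 0 < radSq₁ (P.φ x) * radSq₂ (P.φ x) := by
      rw [hxa, radSq₁_meridian hW hU, radSq₂_meridian hW hU]
      positivity
    have hnot : P.φ x ∉ circleC0 := fun h => by
      obtain ⟨h0, h1, -⟩ := mem_circleC0_iff.1 h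
      rw [radSq₁, h0, h1] at hpos
      norm_num at hpos
    have hx0 := P.coord_pos hbdry hx hnot
    have htan : ∀ᶠ y in 𝓝 x, ∃ ξ, fderiv ℝ P.φ y ξ = unitRadialField (P.φ y) := by
      have hcu : ContinuousAt (fun y => radSq₁ (P.φ y) * radSq₂ (P.φ y)) x :=
        (continuous_radSq₁.mul continuous_radSq₂).continuousAt.comp
          (P.hasFDerivAt hx.1).continuousAt
      filter_upwards [P.isOpen_U.mem_nhds hx.1, (isOpen_lt continuous_const
        (PiLp.continuous_apply 2 (fun _ : Fin 2 => ℝ) 0)).mem_nhds hx0,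
        hcu.eventually (lt_mem_nhds hpos)] with y hy hy0 hyu
      have hyH : y ∈ P.U ∩ halfPlane := ⟨hy, le_of_lt hy0⟩
      have hyS := (P.φ_mem hyH).1
      refine P.exists_fderiv_eq hsurf.1 hyH (hN' _ hyS) ?_ ?_
      · rw [unitRadialField, inner_smul_left, inner_radialField_self, mul_zero]
      · rw [unitRadialField, inner_smul_left, inner_radialField_eq_zero hyu (hcal _ hyS), mul_zero]
    have hγ : ∀ᶠ t in 𝓝 a, HasDerivAt (meridian W U) (unitRadialField (meridian W U t)) t := by
      filter_upwards [isOpen_Ioo.mem_nhds ha] with t ht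
      rw [unitRadialField_meridian hW hU ht]
      exact hasDerivAt_meridian W U t
    filter_upwards [isOpen_Ioo.mem_nhds ha, P.eventually_mem_of_tangent hx.1 hx0
      (contDiffAt_unitRadialField hpos) htan hxa.symm hγ] with t ht htS using ⟨ht, htS⟩
  have hsub : Ioo 0 (Real.pi / 2) ⊆ u := by
    refine isPreconnected_Ioo.subset_of_closure_inter_subset hopen ⟨a₀, ha₀, ha₀, hmem⟩ ?_
    rintro a ⟨hau, ha⟩
    have : closure u ⊆ meridian W U ⁻¹' S :=
      closure_minimal (fun t ht => ht.2) (hclosed.preimage hcont)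
    exact ⟨ha, this hau⟩
  have hcl : closure (Ioo 0 (Real.pi / 2)) ⊆ meridian W U ⁻¹' S :=
    closure_minimal (fun t ht => (hsub ht).2) (hclosed.preimage hcont)
  rw [closure_Ioo (by linarith [Real.pi_pos])] at hcl
  exact hcl

theorem continuous_rotate : Continuous rotate := by
  refine (PiLp.continuous_toLp 2 _).comp (continuous_pi fun i => ?_)
  fin_cases i
  · exact (PiLp.continuous_apply 2 _ 1).neg
  · exact PiLp.continuous_apply 2 _ 0
  · exact continuous_const
  · exact continuous_const

include hbdry in
theorem hopf_mem_tangentPlane {W : E4} (hW : W ∈ circleC0) : hopf W ∈ tangentPlane S W := by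
  obtain ⟨θ, -, rfl⟩ : W ∈ circleMapC0 '' Ioc (-Real.pi) Real.pi := image_circleMapC0 ▸ hW
  have h1 := ((hasDerivAt_circleMapC0 θ).hasFDerivAt.hasFDerivWithinAt
    (s := univ)).mapsTo_tangent_cone
  rw [tangentConeAt_univ] at h1
  have h2 := h1 (mem_univ (1 : ℝ))
  rw [ContinuousLinearMap.toSpanSingleton_apply, one_smul] at h2
  refine Submodule.subset_span (tangentConeAt_mono ?_ h2)
  rintro _ ⟨t, -, rfl⟩
  exact circleC0_subset hbdry (circleMapC0_mem t)

include hbdry hN hN' hcal in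
/-- The normal at a boundary point determines the meridian that leaves from it. -/
theorem normal_eq_rotate {W U : E4} (hW : W ∈ circleC0) (hU : U ∈ circleC1)
    (hmem : ∀ a ∈ Icc 0 (Real.pi / 2), meridian W U a ∈ S) : N W = rotate U := by
  have hcont := continuous_meridian W U
  have hNh := (continuousOn_horizontalPart hN).comp hcont.continuousOn hmem
  have heq : EqOn (fun a => horizontalPart (meridian W U a) (N (meridian W U a)))
      (fun a => ‖horizontalPart (meridian W U a) (N (meridian W U a))‖ •
        (Real.cos a • rotate U - Real.sin a • hopf W)) (Icc 0 (Real.pi / 2)) := by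
    refine EqOn.of_subset_closure (s := Ioo 0 (Real.pi / 2)) (fun a ha => ?_) hNh ?_
      Ioo_subset_Icc_self (by rw [closure_Ioo (by linarith [Real.pi_pos])])
    · obtain ⟨hs, hc⟩ := sin_pos_cos_pos ha
      have h := hcal _ (hmem a (Ioo_subset_Icc_self ha))
      rw [sqrt_meridian hW hU ha, calibField_meridian hW hU, smul_comm] at h
      exact smul_right_injective E4 (mul_pos hs hc).ne' h
    · exact hNh.norm.smul (by fun_prop)
  have h0 := heq ⟨le_rfl, by linarith [Real.pi_pos]⟩
  have hm0 : meridian W U 0 = W := by simp [meridian]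
  have hWn := hN' W (circleC0_subset hbdry hW)
  have hNW : horizontalPart W (N W) = N W := by
    rw [horizontalPart, hWn.2.2 _ (hopf_mem_tangentPlane hbdry hW), zero_smul, sub_zero]
  simpa [hm0, hNW, hWn.1] using h0

include hsurf hbdry hN hN' hcal in
/-- On the great circle `C₁` the normal of a calibrated surface is vertical: the calibrating field
has different limits along different meridians. -/
theorem horizontalPart_eq_zero {q : E4} (hq : q ∈ S) (hqC : q ∈ circleC1) :
    horizontalPart q (N q) = 0 := by
  obtain ⟨P, hP⟩ := exists_surfacePatch hsurf hq
  obtain ⟨x, hx, rfl⟩ := P.exists_φ_eq ⟨hq, hP⟩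
  set q := P.φ x with hqdef
  obtain ⟨q01, q2, q3⟩ := mem_circleC1_iff.1 hqC
  have hnot : q ∉ circleC0 := fun h => by
    obtain ⟨h0, h1, -⟩ := mem_circleC0_iff.1 h
    rw [h0, h1] at q01
    norm_num at q01
  have hx0 := P.coord_pos hbdry hx hnot
  set m := horizontalPart q (N q) with hm
  have hqn : ‖q‖ = 1 := P.norm_φ hsurf.1 hx
  have hhh : ⟪hopf q, hopf q⟫_ℝ = 1 := by rw [real_inner_self_eq_norm_sq, norm_hopf, hqn, one_pow]
  have hqh : ⟪hopf q, q⟫_ℝ = 0 := by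
    rw [inner_E4]
    simp only [hopf_apply]
    ring
  have hmh : ⟪m, hopf q⟫_ℝ = 0 := by
    rw [hm, horizontalPart, inner_sub_left, inner_smul_left, hhh]
    simp
  have hmq : ⟪m, q⟫_ℝ = 0 := by
    rw [hm, horizontalPart, inner_sub_left, inner_smul_left, hqh, (hN' q hq).2.1]
    simp
  rw [inner_E4] at hmh hmq
  simp only [hopf_apply, q2, q3] at hmh hmq
  have m0 : m 0 = 0 := by linear_combination q 0 * hmq - q 1 * hmh - m 0 * q01
  have m1 : m 1 = 0 := by linear_combination q 1 * hmq + q 0 * hmh - m 1 * q01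
  -- the tangent direction along which the limit of the calibrating field is opposite to `m`
  set v : E4 := !₂[0, 0, m 3, -m 2] with hv
  have hvq : ⟪v, q⟫_ℝ = 0 := by
    rw [inner_E4, q2, q3]
    simp [hv]
  have hvN : ⟪v, N q⟫_ℝ = 0 := by
    have h1 : N q = m + ⟪N q, hopf q⟫_ℝ • hopf q := by rw [hm, horizontalPart, sub_add_cancel]
    have h2 : ⟪v, hopf q⟫_ℝ = 0 := by
      rw [inner_E4]
      simp [hv, hopf, q2, q3]
    have h3 : ⟪v, m⟫_ℝ = 0 := by
      rw [inner_E4]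
      simp [hv]
      ring
    rw [h1, inner_add_right, inner_smul_right, h2, h3, mul_zero, add_zero]
  obtain ⟨ξ, hξ⟩ := P.exists_fderiv_eq hsurf.1 hx (hN' q hq) hvq hvN
  set c : ℝ → E4 := fun t => P.φ (x + t • ξ) with hc
  have hline : HasDerivAt (fun t : ℝ => x + t • ξ) ξ 0 := by
    simpa using ((hasDerivAt_id (0 : ℝ)).smul_const ξ).const_add x
  have hcd : HasDerivAt c v 0 := by
    have hφ : HasFDerivAt P.φ (fderiv ℝ P.φ x) (x + (0 : ℝ) • ξ) := by
      simpa using P.hasFDerivAt hx.1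
    have := hφ.comp_hasDerivAt (0 : ℝ) hline
    rwa [hξ] at this
  have hc0 : c 0 = q := by simp [hc, hqdef]
  have hcS : ∀ᶠ t in 𝓝[>] (0 : ℝ), c t ∈ S := by
    have hopen : IsOpen (P.U ∩ {y : E2 | 0 < y 0}) :=
      P.isOpen_U.inter (isOpen_lt continuous_const (PiLp.continuous_apply 2 _ 0))
    have h1 : Tendsto (fun t : ℝ => x + t • ξ) (𝓝 0) (𝓝 x) := by
      simpa using hline.continuousAt.tendsto
    filter_upwards [mem_nhdsWithin_of_mem_nhds (h1.eventually (hopen.mem_nhds ⟨hx.1, hx0⟩))]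
      with t ht
    exact (P.φ_mem ⟨ht.1, show 0 ≤ (x + t • ξ) 0 from le_of_lt ht.2⟩).1
  have hcq : Tendsto c (𝓝[>] 0) (𝓝 q) := by
    rw [← hc0]
    exact hcd.continuousAt.tendsto.mono_left nhdsWithin_le_nhds
  have hNh : Tendsto (fun t => horizontalPart (c t) (N (c t))) (𝓝[>] 0) (𝓝 m) :=
    ((continuousOn_horizontalPart hN) q hq).tendsto.comp
      (tendsto_nhdsWithin_iff.2 ⟨hcq, hcS⟩)
  have hslope : ∀ i : Fin 4, c 0 i = 0 → Tendsto (fun t => c t i / t) (𝓝[>] 0) (𝓝 (v i)) := by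
    intro i hi
    have h1 : HasDerivAt (fun t => c t i) (v i) 0 :=
      (EuclideanSpace.proj i : E4 →L[ℝ] ℝ).hasFDerivAt.comp_hasDerivAt (0 : ℝ) hcd
    have h2 := hasDerivWithinAt_iff_tendsto_slope.1 (h1.hasDerivWithinAt (s := Ioi 0))
    rw [show Ioi (0 : ℝ) \ {0} = Ioi 0 by simp] at h2
    refine h2.congr fun t => ?_
    rw [slope_def_field, hi, sub_zero, sub_zero]
  have hs2 := hslope 2 (by rw [hc0, q2])
  have hs3 := hslope 3 (by rw [hc0, q3])
  have hr1 : Tendsto (fun t => radSq₁ (c t)) (𝓝[>] 0) (𝓝 1) := by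
    have := (continuous_radSq₁.tendsto q).comp hcq
    rwa [show radSq₁ q = 1 from q01] at this
  have hmn : ‖m‖ = √(1 * ((v 2) ^ 2 + (v 3) ^ 2)) := by
    rw [eq_comm, one_mul, Real.sqrt_eq_iff_eq_sq (by positivity) (norm_nonneg _), norm_sq_E4, m0, m1]
    simp [hv]
    ring
  have hsq : Tendsto (fun t => √(radSq₁ (c t) * ((c t 2 / t) ^ 2 + (c t 3 / t) ^ 2)))
      (𝓝[>] 0) (𝓝 ‖m‖) := by
    rw [hmn]
    exact (hr1.mul ((hs2.pow 2).add (hs3.pow 2))).sqrt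
  have hcalt : ∀ᶠ t in 𝓝[>] (0 : ℝ),
      √(radSq₁ (c t) * ((c t 2 / t) ^ 2 + (c t 3 / t) ^ 2)) • horizontalPart (c t) (N (c t)) =
        ‖horizontalPart (c t) (N (c t))‖ • (t⁻¹ • calibField (c t)) := by
    filter_upwards [hcS, self_mem_nhdsWithin] with t htS ht
    have ht0 : (0 : ℝ) < t := ht
    have h1 : radSq₁ (c t) * ((c t 2 / t) ^ 2 + (c t 3 / t) ^ 2) =
        radSq₁ (c t) * radSq₂ (c t) / t ^ 2 := by
      rw [radSq₂, div_pow, div_pow, ← add_div, mul_div_assoc]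
    rw [h1, Real.sqrt_div' _ (sq_nonneg t), Real.sqrt_sq ht0.le, div_eq_inv_mul, mul_smul,
      hcal _ htS, smul_comm]
  have hlim := hsq.smul hNh
  have hcomp : ∀ (i : Fin 4) (b : ℝ),
      Tendsto (fun t => t⁻¹ * calibField (c t) i) (𝓝[>] 0) (𝓝 b) → ‖m‖ * m i = ‖m‖ * b := by
    intro i b hb
    have h1 : Tendsto (fun t => (√(radSq₁ (c t) * ((c t 2 / t) ^ 2 + (c t 3 / t) ^ 2)) •
        horizontalPart (c t) (N (c t))) i) (𝓝[>] 0) (𝓝 (‖m‖ * m i)) :=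
      ((PiLp.continuous_apply 2 (fun _ : Fin 4 => ℝ) i).tendsto _).comp hlim
    have h2 := hNh.norm.mul hb
    refine tendsto_nhds_unique h1 (h2.congr' ?_)
    filter_upwards [hcalt] with t ht
    rw [ht]
    rfl
  have e2 : ‖m‖ * m 2 = ‖m‖ * -m 2 := by
    refine hcomp 2 _ ?_
    have := hr1.mul hs3
    rw [one_mul] at this
    refine this.congr fun t => ?_
    change _ = t⁻¹ * (radSq₁ (c t) * c t 3)
    ring
  have e3 : ‖m‖ * m 3 = ‖m‖ * -m 3 := by
    refine hcomp 3 _ ?_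
    have := (hr1.mul hs2).neg
    rw [one_mul] at this
    refine this.congr fun t => ?_
    change _ = t⁻¹ * (-(radSq₁ (c t) * c t 2))
    ring
  by_contra hne
  have hpos : ‖m‖ ≠ 0 := norm_ne_zero_iff.2 hne
  have m2 : m 2 = 0 := by linarith [mul_left_cancel₀ hpos e2]
  have m3 : m 3 = 0 := by linarith [mul_left_cancel₀ hpos e3]
  exact hne (by apply E4_ext <;> simpa)

include hsurf hbdry hN hN' hcal in
/-- A calibrated surface meets the great circle `C₁` transversally. -/
theorem SurfacePatch.eventually_notMem_circleC1 (P : SurfacePatch S) {x : E2}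
    (hx : x ∈ P.U ∩ halfPlane) (hxC : P.φ x ∈ circleC1) : ∀ᶠ y in 𝓝[≠] x, P.φ y ∉ circleC1 := by
  have hq := (P.φ_mem hx).1
  set q := P.φ x with hqdef
  obtain ⟨q01, q2, q3⟩ := mem_circleC1_iff.1 hxC
  have hNq : N q = ⟪N q, hopf q⟫_ℝ • hopf q :=
    sub_eq_zero.1 (horizontalPart_eq_zero hsurf hbdry hN hN' hcal hq hxC)
  set L : E4 →L[ℝ] E4 := ContinuousLinearMap.id ℝ E4
    - (EuclideanSpace.proj 0 : E4 →L[ℝ] ℝ).smulRight (EuclideanSpace.single 0 1)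
    - (EuclideanSpace.proj 1 : E4 →L[ℝ] ℝ).smulRight (EuclideanSpace.single 1 1) with hL
  have hLap : ∀ p : E4, L p = !₂[0, 0, p 2, p 3] := fun p => by
    apply E4_ext <;> simp [hL]
  have hLD : L.comp (fderiv ℝ P.φ x) = fderiv ℝ P.φ x := by
    ext1 η
    set v := fderiv ℝ P.φ x η with hv
    have h1 : ⟪v, q⟫_ℝ = 0 := P.inner_fderiv_self hsurf.1 hx η
    have h2 : ⟪v, hopf q⟫_ℝ = 0 := by
      have h3 : ⟪N q, v⟫_ℝ = 0 := P.inner_unitNormal hx (hN' q hq) η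
      rw [hNq, inner_smul_left] at h3
      rw [real_inner_comm]
      refine (mul_eq_zero.1 h3).resolve_left fun h0 => ?_
      have h4 := (hN' q hq).1
      rw [hNq, show ⟪N q, hopf q⟫_ℝ = 0 from h0, zero_smul, norm_zero] at h4
      norm_num at h4
    rw [inner_E4] at h1 h2
    simp only [hopf_apply, q2, q3] at h1 h2
    have v0 : v 0 = 0 := by linear_combination q 0 * h1 - q 1 * h2 - v 0 * q01
    have v1 : v 1 = 0 := by linear_combination q 1 * h1 + q 0 * h2 - v 1 * q01
    change L v = v
    rw [hLap]
    apply E4_ext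
    · exact v0.symm
    · exact v1.symm
    · rfl
    · rfl
  have hd := L.hasFDerivAt.comp x (P.hasFDerivAt hx.1)
  rw [hLD] at hd
  obtain ⟨K, -, hK⟩ := LinearMap.exists_antilipschitzWith (fderiv ℝ P.φ x).toLinearMap
    (LinearMap.ker_eq_bot.2 (P.injective x hx.1))
  filter_upwards [hd.eventually_ne (c := 0) ⟨K, hK⟩] with y hy hyC
  obtain ⟨-, y2, y3⟩ := mem_circleC1_iff.1 hyC
  refine hy ?_
  rw [Function.comp_apply, hLap, y2, y3]
  apply E4_ext <;> simp

include hsurf hbdry hN hN' hcal in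
theorem isDiscrete_inter_circleC1 : IsDiscrete (S ∩ circleC1) := by
  refine IsDiscrete.of_nhdsWithin fun q hq => ?_
  obtain ⟨P, hP⟩ := exists_surfacePatch hsurf hq.1
  obtain ⟨hx, hxq⟩ := P.ψ_mem ⟨hq.1, hP⟩
  have h1 := P.eventually_notMem_circleC1 hsurf hbdry hN hN' hcal hx (hxq.symm ▸ hq.2)
  rw [eventually_nhdsWithin_iff] at h1
  have hψ : Tendsto P.ψ (𝓝[S ∩ P.W] q) (𝓝 (P.ψ q)) := P.continuousOn_ψ q ⟨hq.1, hP⟩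
  have hle : 𝓝[S ∩ circleC1] q ≤ 𝓝[S ∩ P.W] q := by
    rw [nhdsWithin_inter_of_mem' (mem_nhdsWithin_of_mem_nhds (P.isOpen_W.mem_nhds hP))]
    exact nhdsWithin_mono q inter_subset_left
  intro s hs
  rw [mem_pure] at hs
  filter_upwards [(hψ.mono_left hle).eventually h1, self_mem_nhdsWithin,
    mem_nhdsWithin_of_mem_nhds (P.isOpen_W.mem_nhds hP)] with p hp hpS hpW
  have hpψ := (P.ψ_mem ⟨hpS.1, hpW⟩).2
  have : P.ψ p = P.ψ q := by
    by_contra hne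
    exact hp hne (hpψ.symm ▸ hpS.2)
  rwa [← hpψ, this, hxq]

end Calibrated

/-! ### Calibrated surfaces are half-spheres -/

theorem mem_halfSphereTrans_iff {t : ℝ} {p : E4} : p ∈ halfSphereTrans t ↔ p ∈ sphere3 ∧
    p 0 = √(radSq₁ p) * Real.cos t ∧ p 1 = √(radSq₁ p) * Real.sin t := by
  have ht := Real.sin_sq_add_cos_sq t
  constructor
  · rintro ⟨h, ⟨hS, h1, h0⟩, rfl⟩
    have e0 : vertTrans t h 0 = Real.cos t * h 0 - Real.sin t * h 1 := rfl
    have e1 : vertTrans t h 1 = Real.sin t * h 0 + Real.cos t * h 1 := rfl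
    have e2 : vertTrans t h 2 = Real.cos t * h 2 - Real.sin t * h 3 := rfl
    have e3 : vertTrans t h 3 = Real.sin t * h 2 + Real.cos t * h 3 := rfl
    have hr : √(radSq₁ (vertTrans t h)) = h 0 := by
      rw [Real.sqrt_eq_iff_eq_sq (radSq₁_nonneg _) h0, radSq₁, e0, e1, h1]
      linear_combination h 0 ^ 2 * ht
    rw [mem_sphere3_iff] at hS ⊢
    rw [hr, e0, e1, e2, e3, h1]
    rw [h1] at hS
    exact ⟨by linear_combination (h 0 ^ 2 + h 2 ^ 2 + h 3 ^ 2) * ht + hS, by ring, by ring⟩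
  · rintro ⟨hS, h0, h1⟩
    have hr : √(radSq₁ p) ^ 2 = p 0 ^ 2 + p 1 ^ 2 := Real.sq_sqrt (radSq₁_nonneg p)
    refine ⟨!₂[√(radSq₁ p), 0, Real.cos t * p 2 + Real.sin t * p 3,
      -(Real.sin t * p 2) + Real.cos t * p 3], ⟨?_, rfl, Real.sqrt_nonneg _⟩, ?_⟩
    · rw [mem_sphere3_iff] at hS ⊢
      simp only [Matrix.cons_val_zero, Matrix.cons_val_one, Matrix.cons_val]
      linear_combination (p 2 ^ 2 + p 3 ^ 2) * ht + hS + hr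
    · apply E4_ext
      · change Real.cos t * √(radSq₁ p) - Real.sin t * 0 = p 0
        rw [h0, mul_zero, sub_zero, mul_comm]
      · change Real.sin t * √(radSq₁ p) + Real.cos t * 0 = p 1
        rw [h1, mul_zero, add_zero, mul_comm]
      · change Real.cos t * (Real.cos t * p 2 + Real.sin t * p 3) -
          Real.sin t * (-(Real.sin t * p 2) + Real.cos t * p 3) = p 2
        linear_combination p 2 * ht
      · change Real.sin t * (Real.cos t * p 2 + Real.sin t * p 3) +
          Real.cos t * (-(Real.sin t * p 2) + Real.cos t * p 3) = p 3
        linear_combination p 3 * ht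

theorem exists_angle {U : E4} (hU : U ∈ circleC1) :
    ∃ t ∈ Ico (0 : ℝ) (2 * Real.pi), U 0 = Real.cos t ∧ U 1 = Real.sin t := by
  obtain ⟨h, -, -⟩ := mem_circleC1_iff.1 hU
  have hmem : (!₂[0, 0, U 0, U 1] : E4) ∈ circleC0 := mem_circleC0_iff.2 ⟨rfl, rfl, h⟩
  rw [← image_circleMapC0] at hmem
  obtain ⟨θ, hθ, hθU⟩ := hmem
  have e0 : Real.cos θ = U 0 := congrArg (fun p : E4 => p 2) hθU
  have e1 : Real.sin θ = U 1 := congrArg (fun p : E4 => p 3) hθU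
  rcases lt_or_ge θ 0 with h0 | h0
  · refine ⟨θ + 2 * Real.pi, ⟨by linarith [hθ.1, Real.pi_pos], by linarith⟩, ?_, ?_⟩
    · rw [Real.cos_add_two_pi, e0]
    · rw [Real.sin_add_two_pi, e1]
  · exact ⟨θ, ⟨h0, by linarith [hθ.2, Real.pi_pos]⟩, e0.symm, e1.symm⟩

section Calibrated

variable {S : Set E4} (hsurf : IsC2Surface S) (hclosed : IsClosed S)
  (hbdry : surfaceBoundary S = circleC0) (hseg : ContainsOrthogonalSegments S)
  {N : E4 → E4} (hN : ContinuousOn N S) (hN' : ∀ p ∈ S, N p ∈ unitNormals S p)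
  (hcal : ∀ p ∈ S, √(radSq₁ p * radSq₂ p) • horizontalPart p (N p) =
    ‖horizontalPart p (N p)‖ • calibField p)

include hsurf hclosed hbdry hseg hN hN' hcal in
/-- All meridians of a calibrated surface end at the same point of `C₁`: their end point depends
continuously on the initial point, and takes values in a discrete set. -/
theorem exists_meridian_endpoint : ∃ U ∈ circleC1, U ∈ S ∧
    (∀ W ∈ circleC0, N W = rotate U) ∧
    ∀ W ∈ circleC0, ∀ a ∈ Icc 0 (Real.pi / 2), meridian W U a ∈ S := by
  choose! u hu1 hup huT hu using hseg
  have hC1 : ∀ W ∈ circleC0, u W ∈ circleC1 := by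
    intro W hW
    obtain ⟨-, h2, h3⟩ := cross_hopf_eq hW (hup W hW) (huT W hW)
    exact ⟨by simpa [sphere3] using hu1 W hW, h2, h3⟩
  have hmem : ∀ W ∈ circleC0, ∀ a ∈ Icc 0 (Real.pi / 2), meridian W (u W) a ∈ S := by
    intro W hW
    obtain ⟨δ, hδ, hδS⟩ := hu W hW
    have hpi : (0 : ℝ) < Real.pi / 2 := by positivity
    obtain ⟨a₀, ha₀, ha₀'⟩ := exists_between (lt_min hδ hpi)
    exact meridian_mem hsurf hclosed hbdry hN' hcal hW (hC1 W hW)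
      ⟨ha₀, ha₀'.trans_le (min_le_right _ _)⟩
      (hδS a₀ ⟨ha₀.le, ha₀'.trans_le (min_le_left _ _)⟩)
  have hrot : ∀ W ∈ circleC0, N W = rotate (u W) := fun W hW =>
    normal_eq_rotate hbdry hN hN' hcal hW (hC1 W hW) (hmem W hW)
  have heq : ∀ W ∈ circleC0, u W = -rotate (N W) := by
    intro W hW
    obtain ⟨-, h2, h3⟩ := mem_circleC1_iff.1 (hC1 W hW)
    rw [hrot W hW]
    apply E4_ext <;> simp [rotate, h2, h3]
  have hcont : ContinuousOn u circleC0 :=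
    ((continuous_rotate.comp_continuousOn (hN.mono (circleC0_subset hbdry))).neg).congr heq
  have hend : ∀ W ∈ circleC0, u W ∈ S ∩ circleC1 := fun W hW => by
    have h := hmem W hW (Real.pi / 2) ⟨by positivity, le_rfl⟩
    simp only [meridian, Real.cos_pi_div_two, Real.sin_pi_div_two, zero_smul, one_smul,
      zero_add] at h
    exact ⟨h, hC1 W hW⟩
  have hconst : ∀ W ∈ circleC0, u W = u (circleMapC0 0) := fun W hW =>
    isPreconnected_circleC0.constant_of_mapsTo
      (isDiscrete_inter_circleC1 hsurf hbdry hN hN' hcal) hcont hend hW (circleMapC0_mem 0)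
  have h0 := hend _ (circleMapC0_mem 0)
  exact ⟨u (circleMapC0 0), h0.2, h0.1, fun W hW => hconst W hW ▸ hrot W hW,
    fun W hW => hconst W hW ▸ hmem W hW⟩

include hsurf hbdry hN hN' hcal in
/-- The part of a calibrated surface off `C₁` is dense. -/
theorem subset_closure_diff_circleC1 : S ⊆ closure (S \ circleC1) := by
  intro p hp
  by_cases hpC : p ∈ circleC1
  swap
  · exact subset_closure ⟨hp, hpC⟩
  obtain ⟨P, hP⟩ := exists_surfacePatch hsurf hp
  obtain ⟨x, hx, rfl⟩ := P.exists_φ_eq ⟨hp, hP⟩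
  set y : ℝ → E2 := fun t => x + t • EuclideanSpace.single (0 : Fin 2) (1 : ℝ) with hy
  have hy0 : ∀ t, y t 0 = x 0 + t := fun t => by simp [hy]
  have h1 : Tendsto y (𝓝[>] 0) (𝓝[≠] x) := by
    refine tendsto_nhdsWithin_iff.2 ⟨SurfacePatch.tendsto_inward x, ?_⟩
    filter_upwards [self_mem_nhdsWithin] with t ht h
    have h2 := hy0 t
    rw [mem_singleton_iff.1 h] at h2
    have h3 : (0 : ℝ) < t := ht
    linarith
  have h2 : Tendsto (fun t => P.φ (y t)) (𝓝[>] 0) (𝓝 (P.φ x)) :=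
    ((P.hasFDerivAt hx.1).continuousAt.tendsto).comp (SurfacePatch.tendsto_inward x)
  refine mem_closure_of_tendsto h2 ?_
  filter_upwards [h1.eventually (P.eventually_notMem_circleC1 hsurf hbdry hN hN' hcal hx hpC),
    (SurfacePatch.tendsto_inward x).eventually (P.isOpen_U.mem_nhds hx.1), self_mem_nhdsWithin]
    with t ht htU ht0
  have h3 : (0 : ℝ) < t := ht0
  have h4 : 0 ≤ x 0 := hx.2
  refine ⟨(P.φ_mem ⟨htU, ?_⟩).1, ht⟩
  change 0 ≤ y t 0
  rw [hy0]
  linarith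

include hsurf hclosed hbdry hseg hN hN' hcal in
theorem exists_eq_halfSphereTrans :
    ∃ t ∈ Ico (0 : ℝ) (2 * Real.pi), S = halfSphereTrans t := by
  obtain ⟨U, hU, hUS, hrot, hmem⟩ :=
    exists_meridian_endpoint hsurf hclosed hbdry hseg hN hN' hcal
  obtain ⟨t, ht, hU0, hU1⟩ := exists_angle hU
  obtain ⟨-, hU2, hU3⟩ := mem_circleC1_iff.1 hU
  refine ⟨t, ht, Subset.antisymm ?_ ?_⟩
  · have hcl : IsClosed {p : E4 | p 0 = √(radSq₁ p) * Real.cos t ∧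
        p 1 = √(radSq₁ p) * Real.sin t} := by
      have h := continuous_radSq₁
      exact (isClosed_eq (PiLp.continuous_apply 2 _ 0) (by fun_prop)).inter
        (isClosed_eq (PiLp.continuous_apply 2 _ 1) (by fun_prop))
    have hsub : S \ circleC1 ⊆ {p : E4 | p 0 = √(radSq₁ p) * Real.cos t ∧
        p 1 = √(radSq₁ p) * Real.sin t} := by
      rintro p ⟨hp, hpC⟩
      have hpS := hsurf.1 hp
      rcases (radSq₁_nonneg p).eq_or_lt with h1 | h1
      · have h0 : p 0 ^ 2 + p 1 ^ 2 = 0 := h1.symm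
        have p0 : p 0 = 0 := by nlinarith [sq_nonneg (p 0), sq_nonneg (p 1)]
        have p1 : p 1 = 0 := by nlinarith [sq_nonneg (p 0), sq_nonneg (p 1)]
        rw [mem_ofPred, ← h1, p0, p1]
        simp
      rcases (radSq₂_nonneg p).eq_or_lt with h2 | h2
      · have h0 : p 2 ^ 2 + p 3 ^ 2 = 0 := h2.symm
        exact absurd ⟨hpS, by nlinarith [sq_nonneg (p 2), sq_nonneg (p 3)],
          by nlinarith [sq_nonneg (p 2), sq_nonneg (p 3)]⟩ hpC
      obtain ⟨W, hW, V, hV, a, ha, hpa, e0, e1⟩ := exists_meridian_eq hpS h1 h2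
      have hVN := normal_eq_rotate hbdry hN hN' hcal hW hV
        (meridian_mem hsurf hclosed hbdry hN' hcal hW hV ha (hpa ▸ hp))
      rw [hrot W hW] at hVN
      have f1 : -U 1 = -V 1 := congrArg (fun q : E4 => q 0) hVN
      have f0 : U 0 = V 0 := congrArg (fun q : E4 => q 1) hVN
      exact ⟨by rw [← hU0, f0]; exact e0, by rw [← hU1, neg_inj.1 f1]; exact e1⟩
    exact fun p hp => mem_halfSphereTrans_iff.2 ⟨hsurf.1 hp, closure_minimal hsub hcl
      (subset_closure_diff_circleC1 hsurf hbdry hN hN' hcal hp)⟩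
  · intro p hp
    obtain ⟨hpS, h0, h1⟩ := mem_halfSphereTrans_iff.1 hp
    rcases (radSq₁_nonneg p).eq_or_lt with hr1 | hr1
    · rw [← hr1, Real.sqrt_zero, zero_mul] at h0 h1
      exact circleC0_subset hbdry ⟨hpS, h0, h1⟩
    rcases (radSq₂_nonneg p).eq_or_lt with hr2 | hr2
    · have h2 : p 2 ^ 2 + p 3 ^ 2 = 0 := hr2.symm
      have hr : radSq₁ p = 1 := by linarith [radSq_add hpS]
      rw [hr, Real.sqrt_one, one_mul] at h0 h1
      have : p = U := E4_ext (h0.trans hU0.symm) (h1.trans hU1.symm)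
        (by rw [hU2]; nlinarith [sq_nonneg (p 2), sq_nonneg (p 3)])
        (by rw [hU3]; nlinarith [sq_nonneg (p 2), sq_nonneg (p 3)])
      exact this ▸ hUS
    obtain ⟨W, hW, V, hV, a, ha, hpa, e0, e1⟩ := exists_meridian_eq hpS hr1 hr2
    obtain ⟨-, hV2, hV3⟩ := mem_circleC1_iff.1 hV
    have hsq := (Real.sqrt_pos.2 hr1).ne'
    have hVU : V = U := E4_ext (by rw [hU0]; exact mul_left_cancel₀ hsq (e0.symm.trans h0))
      (by rw [hU1]; exact mul_left_cancel₀ hsq (e1.symm.trans h1))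
      (hV2.trans hU2.symm) (hV3.trans hU3.symm)
    rw [hpa, hVU]
    exact hmem W hW a (Ioo_subset_Icc_self ha)

end Calibrated

end SubRiemannianSphere

end

theorem proposition4p2 (S : Set SubRiemannianSphere.E4)
    (hsurf : SubRiemannianSphere.IsC2Surface S)
    (hcompact : IsCompact S) (hconn : IsConnected S)
    (horient : SubRiemannianSphere.IsOrientableSurface S)
    (hbdry : SubRiemannianSphere.surfaceBoundary S = SubRiemannianSphere.circleC0)
    (hseg : SubRiemannianSphere.ContainsOrthogonalSegments S)
    (hne : ∀ t ∈ Set.Ico (0 : ℝ) (2 * Real.pi), S ≠ SubRiemannianSphere.halfSphereTrans t) :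
    SubRiemannianSphere.area SubRiemannianSphere.halfSphere = ENNReal.ofReal (Real.pi ^ 2 / 2) ∧
      SubRiemannianSphere.area SubRiemannianSphere.halfSphere < SubRiemannianSphere.area S := by
  refine ⟨SubRiemannianSphere.area_halfSphere, lt_of_not_ge fun harea => ?_⟩
  rw [SubRiemannianSphere.area_halfSphere] at harea
  obtain ⟨N, hN, hN', hcal⟩ :=
    SubRiemannianSphere.exists_calibrated_normal hsurf hcompact hbdry hseg horient harea
  obtain ⟨t, ht, hSt⟩ := SubRiemannianSphere.exists_eq_halfSphereTrans hsurf hcompact.isClosed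
    hbdry hseg hN hN' hcal
  exact hne t ht hSt
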